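/- Let $M$ be a (finite-dimensional, Hausdorff, $\sigma$-compact) smooth manifold, $r\ge 0$ an integer and $\sigma\in\Omega^{r+1}(M)$ a closed form. Write $\mathfrak X=\mathfrak X(M)$ for the Lie algebra of vector fields, $\Omega^k=\Omega^k(M)$, $L_X$ for the Lie derivative and $\iota_X$ for the contraction. **The DGLAs.** Let $\mathfrak g_{r,\sigma}$ be the DGLA with underlying graded vector space $\Omega[r]\oplus\mathfrak X[1]\oplus\mathfrak X$: forms of degree $k$ have degree $k-r$, the elements $X_{[1]}$ of $\mathfrak X[1]$ (a copy of $\mathfrak X\ni X$) have degree $-1$, and the elements $X\in\mathfrak X$ have degree $0$. Its differential is $d\alpha=d_{\mathrm{dR}}\alpha$, $dX_{[1]}=X+\iota_X\sigma$, $dX=-L_X\sigma$. Its bracket is determined by graded skew-symmetry and $$\{X,Y\}=[X,Y],\quad \{X,Y_{[1]}\}=[X,Y]_{[1]},\quad \{X,\alpha\}=L_X\alpha,\quad \{X_{[1]},\alpha\}=\iota_X\alpha,\quad \{X_{[1]},Y_{[1]}\}=0,\quad \{\alpha,\beta\}=0.$$ Let $\mathfrak g_{r,\sigma}^{\ge0}\subseteq\mathfrak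 g_{r,\sigma}$ be the sub-DGLA of elements of degree $\ge 0$. Let $\mathrm{Trunc}(\Omega[r])\subseteq\mathfrak g_{r,\sigma}$ be the abelian sub-DGLA $\Omega^0\to\Omega^1\to\dots\to\Omega^{r-1}\to d\Omega^{r-1}$ in degrees $-r,\dots,0$ (with $d\Omega^{-1}=0$). Let $\mathfrak X_{\mathrm{ham},\sigma}=\{X\in\mathfrak X: \iota_X\sigma \text{ is exact}\}$, a Lie subalgebra of $\mathfrak X$ (for $r=0$, "exact" means $\iota_X\sigma=0$). **The Chevalley–Eilenberg DGLA.** For a Lie algebra $\mathfrak l$ (in degree $0$) and a DGLA $\mathfrak h$, an element of $\mathrm{CE}(\mathfrak l,\mathfrak h)$ of degree $n$ is a family of alternating multilinear maps $f_a:\mathfrak l^{a}\to\mathfrak h^{n-a}$, one for each arity $a\ge1$. For $f:\mathfrak l^{a}\to\mathfrak h^{d}$ and $g:\mathfrak l^{a'}\to\mathfrak h^{d'}$, the bracket and the differential are $$[f,g]=-(-1)^{d(a'+d')}\,[\cdot,\cdot]_{\mathfrak h}\circ(f\otimes g)\circ P_{a,a'},\qquad d f=f\triangleleft[\cdot,\cdot]_{\mathfrak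 l}-(-1)^{a+d-1}\,d_{\mathfrak h}\circ f,$$ where $P_{p,q}(x_1\otimes\dots\otimes x_{p+q})=\sum_\tau \mathrm{sgn}(\tau)\,x_{\tau(1)}\otimes\dots\otimes x_{\tau(p+q)}$ is the sum over $(p,q)$-unshuffles, and $f\triangleleft[\cdot,\cdot]_{\mathfrak l}=f\circ([\cdot,\cdot]_{\mathfrak l}\otimes\mathrm{id})\circ P_{2,a-1}$. A Maurer–Cartan element is an $x$ of degree $1$ with $dx+\tfrac12[x,x]=0$. The gauge action of $\xi$ of degree $0$ on $x$ of degree $1$ is $$e^\xi\star x=x+\sum_{n\ge0}\frac{(\mathrm{ad}_\xi)^n}{(n+1)!}\big([\xi,x]-d\xi\big).$$ An $L_\infty$-morphism $\Phi:\mathfrak l\to\mathfrak h$ is a family of alternating maps $\Phi_k:\mathfrak l^k\to\mathfrak h^{1-k}$ ($k\ge1$) such that, for all $k\ge 1$ (with $\Phi_0=0$), $$\Phi_{k-1}\triangleleft[\cdot,\cdot]_{\mathfrak l}=d_{\mathfrak h}\circ\Phi_k+\tfrac12\sum_{i+j=k,\ i,j\ge1}(-1)^{1-i}[\cdot,\cdot]_{\mathfrak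 h}\circ(\Phi_i\otimes\Phi_j)\circ P_{i,j}.$$ **The maps.** Let $L:\mathfrak X_{\mathrm{ham},\sigma}\to\mathfrak g_{r,\sigma}^{\ge0}$ be the inclusion $X\mapsto X$ (where $X$ acts on forms by $L_X$). Let $\iota_\infty\sigma:\mathfrak X_{\mathrm{ham},\sigma}\to\mathrm{Trunc}(\Omega[r])$ have the components $(\iota_\infty\sigma)_k(X_1,\dots,X_k)=-\iota_{X_1}\cdots\iota_{X_k}\sigma$, $k\ge1$. Let $\iota\in\mathrm{CE}(\mathfrak X_{\mathrm{ham},\sigma},\mathfrak g_{r,\sigma})$ be the element of degree $0$ with the single component $X\mapsto X_{[1]}$ of arity $1$. **Proposition.** 1. $L$ and $\iota_\infty\sigma$ are $L_\infty$-morphisms. Composed with the inclusions of $\mathfrak g_{r,\sigma}^{\ge0}$ and of $\mathrm{Trunc}(\Omega[r])$ into $\mathfrak g_{r,\sigma}$, they are Maurer–Cartan elements of $\mathrm{CE}(\mathfrak X_{\mathrm{ham},\sigma},\mathfrak g_{r,\sigma})$ (denoted by the same letters). 2. These two elements are gauge equivalent via $\iota$: $$\iota_\infty\sigma=e^{\iota}\star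 L ,$$ where the series on the right has only finitely many nonzero terms. 3. The square with sides $\mathfrak X_{\mathrm{ham},\sigma}\xrightarrow{\ \iota_\infty\sigma\ }\mathrm{Trunc}(\Omega[r])\hookrightarrow\mathfrak g_{r,\sigma}$ and $\mathfrak X_{\mathrm{ham},\sigma}\xrightarrow{\ L\ }\mathfrak g_{r,\sigma}^{\ge0}\hookrightarrow\mathfrak g_{r,\sigma}$ commutes up to the homotopy $e^{t\iota}$. Precisely, let $\mathfrak g_{r,\sigma}[t,dt]=\mathfrak g_{r,\sigma}\otimes\Omega^\bullet(\Delta^1)$, with $\Omega^\bullet(\Delta^1)=\mathbb R[t,dt]$ the polynomial forms on the interval. The series $H=e^{t\iota}\star L$ in $\mathrm{CE}(\mathfrak X_{\mathrm{ham},\sigma},\mathfrak g_{r,\sigma}[t,dt])$ has only finitely many nonzero terms, and $H$ is a Maurer–Cartan element, i.e. an $L_\infty$-morphism $\mathfrak X_{\mathrm{ham},\sigma}\to\mathfrak g_{r,\sigma}[t,dt]$, whose evaluation at $t=0$ is $L$ and at $t=1$ is $\iota_\infty\sigma$. -/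

import Mathlib

open scoped Manifold ContDiff

universe u

set_option linter.unusedSectionVars false
set_option linter.unusedSimpArgs false

noncomputable section

/-! ### Functions and vector fields -/

/-- The algebra `C^∞(M)` of smooth real functions. -/
abbrev SmoothFun (n : ℕ) (M : Type*) [TopologicalSpace M]
    [ChartedSpace (EuclideanSpace ℝ (Fin n)) M] :=
  C^∞⟮𝓡 n, M; 𝓘(ℝ, ℝ), ℝ⟯

/-- The space `𝔛(M)` of smooth vector fields, i.e. smooth sections of the tangent bundle. -/
abbrev SmoothVF (n : ℕ) (M : Type*) [TopologicalSpace M]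
    [ChartedSpace (EuclideanSpace ℝ (Fin n)) M] [IsManifold (𝓡 n) ∞ M] :=
  Cₛ^∞⟮𝓡 n; EuclideanSpace ℝ (Fin n), (TangentSpace (𝓡 n) : M → Type _)⟯

namespace SmoothVF

variable {n : ℕ} {M : Type*} [TopologicalSpace M]
  [ChartedSpace (EuclideanSpace ℝ (Fin n)) M] [IsManifold (𝓡 n) ∞ M]

lemma two_le_infty : (2 : ℕ∞ω) ≤ ∞ := ENat.LEInfty.out

lemma three_le_infty : (3 : ℕ∞ω) ≤ ∞ := ENat.LEInfty.out

instance : IsManifold (𝓡 n) (minSmoothness ℝ 2) M :=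
  IsManifold.of_le (n := ∞) (by simpa using two_le_infty)

instance : IsManifold (𝓡 n) (minSmoothness ℝ 3) M :=
  IsManifold.of_le (n := ∞) (by simpa using three_le_infty)

instance : Bracket (SmoothVF n M) (SmoothVF n M) where
  bracket X Y :=
    ⟨fun x => VectorField.mlieBracket (𝓡 n) X Y x, by
      have : IsManifold (𝓡 n) (∞ + 1) M := inferInstanceAs (IsManifold (𝓡 n) ∞ M)
      exact ContDiff.mlieBracket_vectorField (m := ⊤) (n := ⊤) X.contMDiff Y.contMDiff (by simp)⟩

instance : SMul (SmoothFun n M) (SmoothVF n M) where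
  smul f X := ⟨fun x => f x • X x, ContMDiff.smul_section f.contMDiff X.contMDiff⟩

lemma smul_apply (f : SmoothFun n M) (X : SmoothVF n M) (x : M) : (f • X) x = f x • X x := rfl

lemma bracket_apply (X Y : SmoothVF n M) (x : M) :
    ⁅X, Y⁆ x = VectorField.mlieBracket (𝓡 n) X Y x := rfl

lemma mdiffAt (X : SmoothVF n M) (x : M) :
    MDifferentiableAt (𝓡 n) ((𝓡 n).prod 𝓘(ℝ, EuclideanSpace ℝ (Fin n)))
      (fun y => (X y : TangentBundle (𝓡 n) M)) x := X.mdifferentiableAt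

lemma fun_mdiffAt (f : SmoothFun n M) (x : M) :
    MDifferentiableAt (𝓡 n) 𝓘(ℝ, ℝ) f x := f.contMDiff.mdifferentiableAt (by simp)

instance : Module (SmoothFun n M) (SmoothVF n M) where
  one_smul X := by ext x; simp [smul_apply]
  mul_smul f g X := by ext x; simp [smul_apply, mul_smul]
  smul_zero f := by ext x; simp [smul_apply]
  smul_add f X Y := by ext x; simp [smul_apply]
  add_smul f g X := by ext x; simp [smul_apply, add_smul]
  zero_smul X := by ext x; simp [smul_apply]

instance : LieRing (SmoothVF n M) where
  add_lie X Y Z := by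
    ext x
    exact VectorField.mlieBracket_add_left (X.mdiffAt x) (Y.mdiffAt x)
  lie_add X Y Z := by
    ext x
    exact VectorField.mlieBracket_add_right (Y.mdiffAt x) (Z.mdiffAt x)
  lie_self X := by
    ext x
    simp [bracket_apply]
  leibniz_lie X Y Z := by
    ext x
    apply VectorField.leibniz_identity_mlieBracket_apply
    · exact (X.contMDiff x).of_le (by simpa using two_le_infty)
    · exact (Y.contMDiff x).of_le (by simpa using two_le_infty)
    · exact (Z.contMDiff x).of_le (by simpa using two_le_infty)

instance : LieAlgebra ℝ (SmoothVF n M) where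
  lie_smul c X Y := by
    ext x
    exact VectorField.mlieBracket_const_smul_right (Y.mdiffAt x)

/-- The action of vector fields on functions, `⁅X, f⁆ = X(f) = df(X)`. -/
instance : Bracket (SmoothVF n M) (SmoothFun n M) where
  bracket X f := ⟨fun x => mvfderiv (𝓡 n) f x (X x), by
    have h := (f.contMDiff.contMDiff_tangentMap (m := ∞) (by simp)).comp X.contMDiff
    exact (contMDiff_snd_tangentBundle_modelSpace ℝ 𝓘(ℝ, ℝ)).comp h⟩

lemma lie_apply (X : SmoothVF n M) (f : SmoothFun n M) (x : M) :
    ⁅X, f⁆ x = mvfderiv (𝓡 n) f x (X x) := rfl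

lemma mlie_mlie_smul (X Y : SmoothVF n M) (f : SmoothFun n M)
    (W : ∀ y : M, TangentSpace (𝓡 n) y) (x : M)
    (hW : ContMDiffAt (𝓡 n) ((𝓡 n).prod 𝓘(ℝ, EuclideanSpace ℝ (Fin n))) ∞
      (fun y => (W y : TangentBundle (𝓡 n) M)) x) :
    VectorField.mlieBracket (𝓡 n) X (VectorField.mlieBracket (𝓡 n) Y (⇑f • W)) x =
      ⁅X, ⁅Y, f⁆⁆ x • W x + ⁅Y, f⁆ x • VectorField.mlieBracket (𝓡 n) X W x +
      ⁅X, f⁆ x • VectorField.mlieBracket (𝓡 n) Y W x +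
      f x • VectorField.mlieBracket (𝓡 n) X (VectorField.mlieBracket (𝓡 n) Y W) x := by
  have : IsManifold (𝓡 n) (∞ + 1) M := inferInstanceAs (IsManifold (𝓡 n) ∞ M)
  have hYW := ContMDiffAt.mlieBracket_vectorField (m := ⊤) (n := ⊤) (Y.contMDiff x) hW (by simp)
  have h1 : VectorField.mlieBracket (𝓡 n) Y (⇑f • W) =ᶠ[nhds x]
      (⇑⁅Y, f⁆ • W + ⇑f • VectorField.mlieBracket (𝓡 n) Y W) := by
    have := (contMDiffAt_iff_contMDiffAt_nhds (n := 2) (by simp)).1 (hW.of_le two_le_infty)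
    filter_upwards [this] with y hy
    exact VectorField.mlieBracket_smul_right (fun_mdiffAt f y) (hy.mdifferentiableAt (by simp))
  have h2 := Filter.EventuallyEq.mlieBracket_vectorField_eq (I := 𝓡 n)
    (Filter.EventuallyEq.refl (nhds x) (⇑X)) h1
  refine h2.trans ?_
  rw [VectorField.mlieBracket_add_right
      (((⁅Y, f⁆.contMDiff x).smul_section hW).mdifferentiableAt (by simp))
      (((f.contMDiff x).smul_section hYW).mdifferentiableAt (by simp)),
    VectorField.mlieBracket_smul_right (fun_mdiffAt _ x) (hW.mdifferentiableAt (by simp)),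
    VectorField.mlieBracket_smul_right (fun_mdiffAt _ x) (hYW.mdifferentiableAt (by simp)),
    ← lie_apply, ← lie_apply]
  abel

lemma lie_lie_fun (X Y : SmoothVF n M) (f : SmoothFun n M) :
    ⁅⁅X, Y⁆, f⁆ = ⁅X, ⁅Y, f⁆⁆ - ⁅Y, ⁅X, f⁆⁆ := by
  ext x
  by_cases hv : ∃ v : TangentSpace (𝓡 n) x, v ≠ 0
  · obtain ⟨v, hv⟩ := hv
    set W : ∀ y : M, TangentSpace (𝓡 n) y :=
      FiberBundle.extend (EuclideanSpace ℝ (Fin n)) v with hWdef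
    have hW : ContMDiffAt (𝓡 n) ((𝓡 n).prod 𝓘(ℝ, EuclideanSpace ℝ (Fin n))) ∞
        (fun y => (W y : TangentBundle (𝓡 n) M)) x :=
      FiberBundle.contMDiffAt_extend (𝓡 n) (EuclideanSpace ℝ (Fin n)) v
    have hWx : W x = v := by simp [hWdef]
    have hfW := (f.contMDiff x).smul_section hW
    have j1 := VectorField.leibniz_identity_mlieBracket_apply (I := 𝓡 n)
      ((X.contMDiff x).of_le (by simpa using two_le_infty))
      ((Y.contMDiff x).of_le (by simpa using two_le_infty))
      (hfW.of_le (by simpa using two_le_infty))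
    have j2 := VectorField.leibniz_identity_mlieBracket_apply (I := 𝓡 n)
      ((X.contMDiff x).of_le (by simpa using two_le_infty))
      ((Y.contMDiff x).of_le (by simpa using two_le_infty))
      (hW.of_le (by simpa using two_le_infty))
    rw [mlie_mlie_smul X Y f W x hW, mlie_mlie_smul Y X f W x hW] at j1
    have e := VectorField.mlieBracket_smul_right (I := 𝓡 n) (V := ⇑⁅X, Y⁆) (W := W)
      (fun_mdiffAt f x) (hW.mdifferentiableAt (by simp))
    have e' : VectorField.mlieBracket (𝓡 n) (VectorField.mlieBracket (𝓡 n) X Y) (⇑f • W) x =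
      ⁅⁅X, Y⁆, f⁆ x • W x + f x • VectorField.mlieBracket (𝓡 n) 
        (VectorField.mlieBracket (𝓡 n) X Y) W x := e
    rw [e', j2] at j1
    have : (⁅⁅X, Y⁆, f⁆ x - (⁅X, ⁅Y, f⁆⁆ x - ⁅Y, ⁅X, f⁆⁆ x)) • v = 0 := by
      rw [← hWx]
      linear_combination (norm := module) (-1 : ℝ) • j1
    rcases smul_eq_zero.1 this with h | h
    · exact sub_eq_zero.1 h
    · exact absurd h hv
  · push Not at hv
    simp [lie_apply, hv]

instance : LieRingModule (SmoothVF n M) (SmoothFun n M) where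
  add_lie X Y f := by ext x; simp [lie_apply]
  lie_add X f g := by
    ext x
    change mvfderiv (𝓡 n) (⇑f + ⇑g) x (X x) = _
    rw [mvfderiv_add (fun_mdiffAt f x) (fun_mdiffAt g x)]
    rfl
  leibniz_lie X Y f := by rw [lie_lie_fun]; abel

instance : LieRinehartRing (SmoothFun n M) (SmoothVF n M) where
  lie_smul_eq_mul' f g X := by ext x; simp [lie_apply, smul_apply]
  leibniz_mul_right' X f g := by
    ext x
    change mvfderiv (𝓡 n) (⇑f * ⇑g) x (X x) = f x * mvfderiv (𝓡 n) g x (X x) +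
      mvfderiv (𝓡 n) f x (X x) * g x
    rw [mvfderiv_mul (fun_mdiffAt f x) (fun_mdiffAt g x)]
    simp [mul_comm]
  leibniz_smul_right' X Y f := by
    ext x
    have := VectorField.mlieBracket_smul_right (V := X) (W := Y) (I := 𝓡 n)
      (fun_mdiffAt f x) (Y.mdiffAt x)
    rw [add_comm]
    exact this

instance : LieRinehartAlgebra ℝ (SmoothFun n M) (SmoothVF n M) where
  smul_assoc c f X := by ext x; simp [smul_apply, mul_smul]
  smul_lie c X f := by ext x; simp [lie_apply]
  lie_smul c X f := by
    ext x
    change mvfderiv (𝓡 n) (fun y => c • f y) x (X x) = c • mvfderiv (𝓡 n) f x (X x)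
    have := mvfderiv_smul (I := 𝓡 n) (x := x) (a := fun _ : M => c) (g := f)
      mdifferentiableAt_const (fun_mdiffAt f x)
    have h2 : mvfderiv (𝓡 n) (fun y => c • f y) x = _ := this
    rw [h2, mvfderiv_const]
    simp

end SmoothVF

/-! ### Differential forms

Everything is developed for a Lie–Rinehart pair `(A, L)`, i.e. with `A` in place of `C^∞(M)` and `L`
in place of `𝔛(M)`. For `A = C^∞(M)` and `L = 𝔛(M)`, the `A`-multilinear alternating maps
`L × ⋯ × L → A` are precisely the smooth differential forms on `M`. -/

/-- Differential forms of degree `k`: alternating `A`-multilinear maps `Lᵏ → A`. -/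
abbrev DForm (A L : Type u) [CommRing A] [LieRing L] [Module A L] (k : ℕ) := L [⋀^Fin k]→ₗ[A] A

namespace DForm

variable {A L : Type u} [CommRing A] [LieRing L] [Module A L] [LieRingModule L A]

/-- The contraction `ι_x w = w(x, ·, …, ·)`. -/
def contr {k : ℕ} (x : L) (w : DForm A L (k + 1)) : DForm A L k := AlternatingMap.curryLeft w x

@[simp] lemma contr_apply {k : ℕ} (x : L) (w : DForm A L (k + 1)) (v : Fin k → L) :
    contr x w v = w (Fin.cons x v) := rfl

/-- `(L_x w)(v₁, …, v_k) = x(w(v₁, …, v_k)) - ∑_j w(v₁, …, [x, v_j], …, v_k)`. -/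
def lieFun {k : ℕ} (x : L) (w : DForm A L k) (v : Fin k → L) : A :=
  ⁅x, w v⁆ - ∑ j, w (Function.update v j ⁅x, v j⁆)

/-- The Koszul formula for the exterior derivative,
`∑_i (-1)^i v_i(w(…, v̂_i, …)) + ∑_{i < j} (-1)^{i + j} w([v_i, v_j], …, v̂_i, …, v̂_j, …)`,
with `[v_i, v_j]` moved to the place of `v_j`. -/
def extdFun {k : ℕ} (w : DForm A L k) (v : Fin (k + 1) → L) : A :=
  ∑ i : Fin (k + 1), (-1 : A) ^ (i : ℕ) *
    (⁅v i, w (i.removeNth v)⁆ -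
      ∑ j : Fin k with i < j.succ, w (Function.update (i.removeNth v) j ⁅v i, v j.succ⁆))

lemma extdFun_cons {k : ℕ} (w : DForm A L (k + 1)) (x : L) (v : Fin (k + 1) → L) :
    extdFun w (Fin.cons x v) = lieFun x w v - extdFun (contr x w) v := by
  rw [sub_eq_add_neg (lieFun x w v), extdFun, Fin.sum_univ_succ, extdFun,
    ← Finset.sum_neg_distrib]
  refine congrArg₂ (fun a b : A => a + b) ?_ (Finset.sum_congr rfl fun i _ => ?_)
  · simp [lieFun]
  · have : i.succ.removeNth (Fin.cons x v : Fin (k + 2) → L) = Fin.cons x (i.removeNth v) := by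
      ext j
      cases j using Fin.cases <;> simp [Fin.removeNth]
    rw [this]
    simp only [Fin.cons_succ, Fin.val_succ, pow_succ, contr_apply, mul_neg, mul_one, neg_mul]
    congr 3
    rw [Finset.sum_filter, Finset.sum_filter, Fin.sum_univ_succ]
    simp [← Fin.cons_update]

lemma extdFun_zero (w : DForm A L 0) (v : Fin 1 → L) : extdFun w v = ⁅v 0, w ![]⁆ := by
  simp only [extdFun, Fin.sum_univ_succ, Finset.univ_eq_empty, Finset.sum_empty]
  simp
  congr 2
  exact Subsingleton.elim _ _

variable [LieRinehartRing A L]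

lemma lieFun_aux {k : ℕ} (x : L) (w : DForm A L k) (v : Fin k → L) (p j : Fin k) (a b : L) :
    w (Function.update (Function.update v p (a + b)) j ⁅x, Function.update v p (a + b) j⁆) =
    w (Function.update (Function.update v p a) j ⁅x, Function.update v p a j⁆) +
    w (Function.update (Function.update v p b) j ⁅x, Function.update v p b j⁆) := by
  by_cases h : j = p
  · subst h; simp [AlternatingMap.map_update_add]
  · simp [h, Function.update_comm (Ne.symm h), AlternatingMap.map_update_add]

lemma lieFun_aux' {k : ℕ} (x : L) (w : DForm A L k) (v : Fin k → L) (p j : Fin k) (f : A) (a : L) :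
    w (Function.update (Function.update v p (f • a)) j ⁅x, Function.update v p (f • a) j⁆) =
    f * w (Function.update (Function.update v p a) j ⁅x, Function.update v p a j⁆) +
    if j = p then ⁅x, f⁆ * w (Function.update v p a) else 0 := by
  by_cases h : j = p
  · subst h; simp [AlternatingMap.map_update_add, AlternatingMap.map_update_smul]
  · simp [h, Function.update_comm (Ne.symm h), AlternatingMap.map_update_smul]

/-- The Lie derivative of a form. -/
def lieD {k : ℕ} (x : L) (w : DForm A L k) : DForm A L k where
  toFun := lieFun x w
  map_update_add' {inst} v p a b := by
    obtain rfl := Subsingleton.elim inst (instDecidableEqFin k)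
    simp only [lieFun, AlternatingMap.map_update_add, lie_add, lieFun_aux,
      Finset.sum_add_distrib]
    ring
  map_update_smul' {inst} v p f a := by
    obtain rfl := Subsingleton.elim inst (instDecidableEqFin k)
    simp only [lieFun, AlternatingMap.map_update_smul, lieFun_aux',
      Finset.sum_add_distrib, smul_eq_mul, LieRinehartRing.leibniz_mul_right, Finset.sum_ite_eq',
      Finset.mem_univ, if_true, ← Finset.mul_sum]
    ring
  map_eq_zero_of_eq' v i j hv hij := by
    have e : Function.update v j ⁅x, v j⁆ = Function.update v i ⁅x, v i⁆ ∘ Equiv.swap i j := by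
      ext l
      rcases eq_or_ne l j with rfl | h1
      · simp [hv]
      · rcases eq_or_ne l i with rfl | h2
        · simp [h1, hij.symm, hv]
        · simp [h1, h2, Equiv.swap_apply_of_ne_of_ne]
    rw [lieFun, w.map_eq_zero_of_eq v hv hij, lie_zero, zero_sub, neg_eq_zero,
      Finset.sum_eq_add i j hij]
    · rw [e, AlternatingMap.map_swap _ _ hij, add_neg_cancel]
    · rintro l - ⟨h1, h2⟩
      exact w.map_eq_zero_of_eq _ (i := i) (j := j) (by simp [h1.symm, h2.symm, hv]) hij
    · simp
    · simp

@[simp] lemma lieD_apply {k : ℕ} (x : L) (w : DForm A L k) (v : Fin k → L) :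
    lieD x w v = ⁅x, w v⁆ - ∑ j, w (Function.update v j ⁅x, v j⁆) := rfl

lemma extdFun_add {k : ℕ} (w w' : DForm A L k) (v : Fin (k + 1) → L) :
    extdFun (w + w') v = extdFun w v + extdFun w' v := by
  unfold extdFun
  rw [← Finset.sum_add_distrib]
  refine Finset.sum_congr rfl fun i _ => ?_
  simp only [AlternatingMap.add_apply, lie_add, Finset.sum_add_distrib]
  ring

lemma extdFun_zero' {k : ℕ} (v : Fin (k + 1) → L) : extdFun (0 : DForm A L k) v = 0 := by
  simp [extdFun]

lemma contr_lieD {k : ℕ} (x y : L) (w : DForm A L (k + 1)) :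
    contr y (lieD x w) = lieD x (contr y w) - contr ⁅x, y⁆ w := by
  ext v
  simp [Fin.sum_univ_succ, ← Fin.cons_update]
  ring

lemma contr_contr_self {k : ℕ} (x : L) (w : DForm A L (k + 2)) :
    contr x (contr x w) = 0 := AlternatingMap.curryLeft_same w x

lemma exists_extd : ∀ (k : ℕ) (w : DForm A L k), ∃ η : DForm A L (k + 1), ∀ v, η v = extdFun w v
  | 0, w => ⟨AlternatingMap.ofSubsingleton A L A (0 : Fin 1) 
      { toFun := fun x => ⁅x, w ![]⁆
        map_add' := by simp
        map_smul' := by simp }, fun v => by rw [extdFun_zero]; rfl⟩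
  | k + 1, w => by
    have hyp : ∀ x : L, ∃ η : DForm A L (k + 1), ∀ v, η v = extdFun w (Fin.cons x v) := fun x => by
      obtain ⟨η, hη⟩ := exists_extd k (contr x w)
      exact ⟨lieD x w - η, fun v => by rw [extdFun_cons, AlternatingMap.sub_apply, hη]; rfl⟩
    choose G hG using hyp
    have hadd : ∀ x y (v : Fin (k + 1) → L), extdFun w (Fin.cons (x + y) v) =
        extdFun w (Fin.cons x v) + extdFun w (Fin.cons y v) := fun x y v => by
      have e : contr (x + y) w = contr x w + contr y w := map_add (AlternatingMap.curryLeft w) x y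
      simp only [extdFun_cons, lieFun, e, extdFun_add, add_lie, AlternatingMap.map_update_add,
        Finset.sum_add_distrib]
      ring
    have diag : ∀ x (v : Fin k → L), extdFun w (Fin.cons x (Fin.cons x v)) = 0 := fun x v => by
      have e := DFunLike.congr_fun (contr_lieD x x w) v
      rw [contr_apply, lie_self] at e
      have e0 : contr (0 : L) w = 0 := map_zero (AlternatingMap.curryLeft w)
      rw [extdFun_cons, show lieFun x w (Fin.cons x v) = lieD x w (Fin.cons x v) from rfl, e, e0,
        sub_zero]
      rcases k with _ | k
      · rw [extdFun_zero, Fin.cons_zero, lieD_apply, Finset.univ_eq_empty, Finset.sum_empty,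
          sub_zero, sub_eq_zero]
        congr 2
        exact Subsingleton.elim _ _
      · rw [extdFun_cons, contr_contr_self, extdFun_zero', sub_zero, sub_eq_zero]
        rfl
    have alt0 : ∀ x (v : Fin (k + 1) → L) (j : Fin (k + 1)), x = v j →
        extdFun w (Fin.cons x v) = 0 := fun x v j hj => by
      rcases eq_or_ne j 0 with rfl | h0
      · rw [← Fin.cons_self_tail v, ← hj]
        exact diag _ _
      · have := (G x).map_swap v h0
        rw [hG, hG] at this
        rw [← neg_eq_iff_eq_neg.2 this, ← Fin.cons_self_tail (v ∘ Equiv.swap j 0)]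
        simp [← hj, diag]
    have hsw : ∀ x y (v : Fin k → L), extdFun w (Fin.cons x (Fin.cons y v)) =
        - extdFun w (Fin.cons y (Fin.cons x v)) := fun x y v => by
      have h := diag (x + y) v
      have l : ∀ z, extdFun w (Fin.cons z (Fin.cons (x + y) v)) =
          extdFun w (Fin.cons z (Fin.cons x v)) + extdFun w (Fin.cons z (Fin.cons y v)) := by
        intro z
        rw [← hG, ← hG, ← hG]
        simpa using (G z).map_update_add (Fin.cons x v) 0 x y
      rw [hadd, l, l, diag, diag] at h
      linear_combination h
    refine ⟨{ toFun := extdFun w, map_update_add' := ?_, map_update_smul' := ?_,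
              map_eq_zero_of_eq' := ?_ }, fun v => rfl⟩
    · intro inst v p a b
      obtain rfl := Subsingleton.elim inst (instDecidableEqFin _)
      obtain ⟨x, u, rfl⟩ : ∃ x u, v = Fin.cons x u := ⟨v 0, Fin.tail v, (Fin.cons_self_tail v).symm⟩
      cases p using Fin.cases with
      | zero => simp [hadd]
      | succ p => simp [← Fin.cons_update, ← hG, AlternatingMap.map_update_add]
    · intro inst v p f a
      obtain rfl := Subsingleton.elim inst (instDecidableEqFin _)
      obtain ⟨x, u, rfl⟩ : ∃ x u, v = Fin.cons x u := ⟨v 0, Fin.tail v, (Fin.cons_self_tail v).symm⟩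
      cases p using Fin.cases with
      | zero =>
        obtain ⟨y, z, rfl⟩ : ∃ y z, u = Fin.cons y z :=
          ⟨u 0, Fin.tail u, (Fin.cons_self_tail u).symm⟩
        simp only [Fin.update_cons_zero]
        rw [hsw (f • a), hsw a, ← hG, ← hG]
        simpa using (G y).map_update_smul (Fin.cons a z) 0 f a
      | succ p => simp [← Fin.cons_update, ← hG, AlternatingMap.map_update_smul]
    · intro v i j hv hij
      rw [← Fin.cons_self_tail v] at hv ⊢
      cases i using Fin.cases with
      | zero =>
        cases j using Fin.cases with
        | zero => exact absurd rfl hij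
        | succ j => exact alt0 _ _ j (by simpa using hv)
      | succ i =>
        cases j using Fin.cases with
        | zero => exact alt0 _ _ i (by simpa using hv.symm)
        | succ j =>
          rw [← hG]
          exact (G _).map_eq_zero_of_eq _ (i := i) (j := j) (by simpa using hv)
            (fun h => hij (by rw [h]))

/-- The exterior derivative of a form. -/
def extd {k : ℕ} (w : DForm A L k) : DForm A L (k + 1) where
  toFun := extdFun w
  map_update_add' {inst} v p a b := by
    obtain ⟨η, hη⟩ := exists_extd k w
    rw [← hη, ← hη, ← hη, η.map_update_add]
  map_update_smul' {inst} v p f a := by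
    obtain ⟨η, hη⟩ := exists_extd k w
    rw [← hη, ← hη, η.map_update_smul]
  map_eq_zero_of_eq' v i j hv hij := by
    obtain ⟨η, hη⟩ := exists_extd k w
    rw [← hη, η.map_eq_zero_of_eq v hv hij]

lemma ext_contr {k : ℕ} {w w' : DForm A L (k + 1)} (h : ∀ x, contr x w = contr x w') : w = w' := by
  ext v
  rw [← Fin.cons_self_tail v, ← contr_apply, h, contr_apply]

lemma extd_add {k : ℕ} (w w' : DForm A L k) : extd (w + w') = extd w + extd w' := by
  ext v; exact extdFun_add w w' v

lemma contr_extd {k : ℕ} (x : L) (w : DForm A L (k + 1)) :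
    contr x (extd w) = lieD x w - extd (contr x w) := by
  ext v; exact extdFun_cons w x v

lemma contr_extd_zero (x : L) (w : DForm A L 0) : contr x (extd w) = lieD x w := by
  ext v
  refine (extdFun_zero w (Fin.cons x v)).trans ?_
  rw [lieD_apply, Finset.univ_eq_empty, Finset.sum_empty, sub_zero]
  simp only [Fin.cons_zero]
  congr 2
  exact Subsingleton.elim _ _

variable [Algebra ℝ A] [LieAlgebra ℝ L] [LieRinehartAlgebra ℝ A L]

lemma smul_eq (c : ℝ) (x : L) : c • x = (c • (1 : A)) • x := by
  have : IsScalarTower ℝ A L := LieRinehartAlgebra.toIsScalarTower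
  rw [smul_assoc, one_smul]

lemma contr_smul {k : ℕ} (c : ℝ) (x : L) (w : DForm A L (k + 1)) :
    contr (c • x) w = c • contr x w := by
  ext v
  have := (AlternatingMap.curryLeft w).map_smul (c • (1 : A)) x
  rw [← smul_eq] at this
  refine (DFunLike.congr_fun this v).trans ?_
  simp
  rfl

lemma contr_smul' {k : ℕ} (c : ℝ) (x : L) (w : DForm A L (k + 1)) :
    contr x (c • w) = c • contr x w := rfl

lemma contr_add {k : ℕ} (x y : L) (w : DForm A L (k + 1)) :
    contr (x + y) w = contr x w + contr y w := map_add (AlternatingMap.curryLeft w) x y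

lemma contr_add' {k : ℕ} (x : L) (w w' : DForm A L (k + 1)) :
    contr x (w + w') = contr x w + contr x w' := rfl

lemma lieD_add {k : ℕ} (x y : L) (w : DForm A L k) :
    lieD (x + y) w = lieD x w + lieD y w := by
  ext v
  simp [Finset.sum_add_distrib, AlternatingMap.map_update_add]
  ring

lemma lieD_smul {k : ℕ} (c : ℝ) (x : L) (w : DForm A L k) : lieD (c • x) w = c • lieD x w := by
  ext v
  simp only [lieD_apply, smul_lie, AlternatingMap.smul_apply, smul_sub, Finset.smul_sum]
  congr 1
  refine Finset.sum_congr rfl fun j _ => ?_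
  rw [smul_eq (A := A), AlternatingMap.map_update_smul, smul_assoc, one_smul]

lemma lieD_add' {k : ℕ} (x : L) (w w' : DForm A L k) :
    lieD x (w + w') = lieD x w + lieD x w' := by
  ext v
  simp [Finset.sum_add_distrib]
  ring

lemma lieD_smul' {k : ℕ} (c : ℝ) (x : L) (w : DForm A L k) : lieD x (c • w) = c • lieD x w := by
  ext v
  simp [smul_sub, Finset.smul_sum]

lemma extd_smul {k : ℕ} (c : ℝ) (w : DForm A L k) : extd (c • w) = c • extd w := by
  ext v
  change extdFun (c • w) v = c • extdFun w v
  unfold extdFun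
  simp only [Finset.smul_sum, ← mul_smul_comm, smul_sub, AlternatingMap.smul_apply, lie_smul]

end DForm

/-- The graded vector space of all forms, as the product of its homogeneous components. -/
abbrev Forms (A L : Type u) [CommRing A] [LieRing L] [Module A L] := ∀ k : ℕ, DForm A L k

namespace Forms

variable {A L : Type u} [CommRing A] [LieRing L] [Module A L] [LieRingModule L A]
  [LieRinehartRing A L] [Algebra ℝ A] [LieAlgebra ℝ L] [LieRinehartAlgebra ℝ A L]

/-- The de Rham differential. -/
def d : Forms A L →ₗ[ℝ] Forms A L where
  toFun w
    | 0 => 0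
    | k + 1 => DForm.extd (w k)
  map_add' w w' := by
    funext k
    cases k with
    | zero => simp
    | succ k => exact DForm.extd_add _ _
  map_smul' c w := by
    funext k
    cases k with
    | zero => simp
    | succ k => exact DForm.extd_smul _ _

/-- The contraction `x, w ↦ ι_x w`. -/
def ι : L →ₗ[ℝ] Forms A L →ₗ[ℝ] Forms A L :=
  LinearMap.mk₂ ℝ (fun x w k => DForm.contr x (w (k + 1)))
    (fun _ _ _ => funext fun _ => DForm.contr_add _ _ _)
    (fun _ _ _ => funext fun _ => DForm.contr_smul _ _ _)
    (fun _ _ _ => funext fun _ => DForm.contr_add' _ _ _)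
    (fun _ _ _ => funext fun _ => DForm.contr_smul' _ _ _)

/-- The Lie derivative `x, w ↦ L_x w`. -/
def lie : L →ₗ[ℝ] Forms A L →ₗ[ℝ] Forms A L :=
  LinearMap.mk₂ ℝ (fun x w k => DForm.lieD x (w k))
    (fun _ _ _ => funext fun _ => DForm.lieD_add _ _ _)
    (fun _ _ _ => funext fun _ => DForm.lieD_smul _ _ _)
    (fun _ _ _ => funext fun _ => DForm.lieD_add' _ _ _)
    (fun _ _ _ => funext fun _ => DForm.lieD_smul' _ _ _)

@[simp] lemma d_zero (w : Forms A L) : d w 0 = 0 := rfl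
@[simp] lemma d_succ (w : Forms A L) (k : ℕ) : d w (k + 1) = DForm.extd (w k) := rfl
@[simp] lemma ι_apply (x : L) (w : Forms A L) (k : ℕ) : ι x w k = DForm.contr x (w (k + 1)) := rfl
@[simp] lemma lie_apply (x : L) (w : Forms A L) (k : ℕ) : lie x w k = DForm.lieD x (w k) := rfl

lemma cartan (x : L) (w : Forms A L) : d (ι x w) + ι x (d w) = lie x w := by
  funext k
  cases k with
  | zero => simp [DForm.contr_extd_zero]
  | succ k => simp [DForm.contr_extd]

lemma ι_ι (x y : L) (w : Forms A L) : ι x (ι y w) + ι y (ι x w) = 0 := by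
  have h : ∀ z : L, ι z (ι z w) = 0 := fun z => funext fun k => DForm.contr_contr_self z _
  have := h (x + y)
  simpa [h, add_comm] using this

lemma lie_ι (x y : L) (w : Forms A L) : lie x (ι y w) - ι y (lie x w) = ι ⁅x, y⁆ w := by
  funext k
  simp [DForm.contr_lieD]

lemma ext_ι {w w' : Forms A L} (h0 : w 0 = w' 0) (h : ∀ x, ι x w = ι x w') : w = w' := by
  funext k
  cases k with
  | zero => exact h0
  | succ k => exact DForm.ext_contr fun x => congrFun (h x) k

lemma ι_lie (x y : L) (w : Forms A L) : ι y (lie x w) = lie x (ι y w) - ι ⁅x, y⁆ w := by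
  rw [← lie_ι, sub_sub_cancel]

lemma ι_d (x : L) (w : Forms A L) : ι x (d w) = lie x w - d (ι x w) := by
  rw [← cartan, add_sub_cancel_left]

lemma lie_lie (x y : L) (w : Forms A L) : lie x (lie y w) - lie y (lie x w) = lie ⁅x, y⁆ w := by
  funext k
  induction k generalizing w with
  | zero =>
    ext v
    simp
  | succ k ih =>
    refine DForm.ext_contr fun z => ?_
    change ι z (lie x (lie y w) - lie y (lie x w)) k = ι z (lie ⁅x, y⁆ w) k
    have := ih (ι z w)
    simp only [ι_lie, map_sub, Pi.sub_apply, _root_.lie_lie x y z, LinearMap.sub_apply] at this ⊢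
    rw [← this]
    abel

lemma d_lie (x : L) (w : Forms A L) : d (lie x w) = lie x (d w) := by
  funext k
  induction k generalizing w with
  | zero => ext v; simp
  | succ k ih =>
    refine DForm.ext_contr fun z => ?_
    change ι z (d (lie x w)) k = ι z (lie x (d w)) k
    have h1 := ih (ι z w)
    have h2 := congrFun (lie_lie x z w) k
    simp only [ι_lie, ι_d, map_sub, Pi.sub_apply] at h1 h2 ⊢
    rw [h1, ← h2]
    abel

lemma d_d (w : Forms A L) : d (d w) = 0 := by
  funext k
  induction k generalizing w with
  | zero => rfl
  | succ k ih =>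
    refine DForm.ext_contr fun z => ?_
    change ι z (d (d w)) k = 0
    have h1 := ih (ι z w)
    simp only [ι_d, map_sub, d_lie, Pi.sub_apply, h1] at h1 ⊢
    simp

end Forms

/-! ### Differential graded Lie algebras -/

/-- A differential graded Lie algebra over `ℝ`, `ℤ`-graded, with cohomological differential.
To avoid casts, the structure maps take the degree of their value, with a proof that it is the
right one, as arguments. -/
structure DGLA where
  V : ℤ → Type u
  [addCommGroup : ∀ i, AddCommGroup (V i)]
  [module : ∀ i, Module ℝ (V i)]
  d : ∀ i j : ℤ, i + 1 = j → V i →ₗ[ℝ] V j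
  br : ∀ i j k : ℤ, i + j = k → V i →ₗ[ℝ] V j →ₗ[ℝ] V k
  d_d : ∀ i j k hij hjk x, d j k hjk (d i j hij x) = 0
  skew : ∀ i j k h h' x y, br i j k h x y = -((-1 : ℝ) ^ (i * j)) • br j i k h' y x
  leibniz : ∀ i j k l i' j' (hk : i + j = k) (hl : k + 1 = l) (hi : i + 1 = i') (hj : j + 1 = j')
    (hl₁ : i' + j = l) (hl₂ : i + j' = l) x y,
    d k l hl (br i j k hk x y) =
      br i' j l hl₁ (d i i' hi x) y + (-1 : ℝ) ^ i • br i j' l hl₂ x (d j j' hj y)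
  jacobi : ∀ i j k jk ij ik n (h₁ : j + k = jk) (h₂ : i + jk = n) (h₃ : i + j = ij)
    (h₄ : ij + k = n) (h₅ : i + k = ik) (h₆ : j + ik = n) x y z,
    br i jk n h₂ x (br j k jk h₁ y z) =
      br ij k n h₄ (br i j ij h₃ x y) z + (-1 : ℝ) ^ (i * j) • br j ik n h₆ y (br i k ik h₅ x z)

namespace DGLA

attribute [instance] DGLA.addCommGroup DGLA.module

/-- A (strict) morphism of DGLAs. -/
structure Hom (g h : DGLA.{u}) where
  map : ∀ i, g.V i →ₗ[ℝ] h.V i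
  map_d : ∀ i j e x, map j (g.d i j e x) = h.d i j e (map i x)
  map_br : ∀ i j k e x y, map k (g.br i j k e x y) = h.br i j k e (map i x) (map j y)

/-- The elements of `gⁿ` if `n ≥ 0`, and zero if `n < 0`. -/
def nonnegPart (g : DGLA.{u}) (n : ℤ) : Submodule ℝ (g.V n) where
  carrier := {v | n < 0 → v = 0}
  add_mem' ha hb hn := by rw [ha hn, hb hn, add_zero]
  zero_mem' _ := rfl
  smul_mem' c _ ha hn := by rw [ha hn, smul_zero]

/-- The sub-DGLA `g^{≥ 0}` of elements of non-negative degree. -/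
def nonneg (g : DGLA.{u}) : DGLA.{u} where
  V n := g.nonnegPart n
  d i j e := (g.d i j e).restrict fun x hx hj => by
    rw [hx (by omega), map_zero]
  br i j k e := LinearMap.mk₂ ℝ (fun x y => ⟨g.br i j k e x.1 y.1, fun hk => by
      by_cases hi : i < 0
      · rw [x.2 hi, map_zero, LinearMap.zero_apply]
      · rw [y.2 (by omega), map_zero]⟩)
    (fun _ _ _ => Subtype.ext (by simp)) (fun _ _ _ => Subtype.ext (by simp))
    (fun _ _ _ => Subtype.ext (by simp)) (fun _ _ _ => Subtype.ext (by simp))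
  d_d i j k hij hjk x := Subtype.ext (g.d_d i j k hij hjk x.1)
  skew i j k h h' x y := Subtype.ext (g.skew i j k h h' x.1 y.1)
  leibniz i j k l i' j' hk hl hi hj hl₁ hl₂ x y :=
    Subtype.ext (g.leibniz i j k l i' j' hk hl hi hj hl₁ hl₂ x.1 y.1)
  jacobi i j k jk ij ik n h₁ h₂ h₃ h₄ h₅ h₆ x y z :=
    Subtype.ext (g.jacobi i j k jk ij ik n h₁ h₂ h₃ h₄ h₅ h₆ x.1 y.1 z.1)

/-- The inclusion of `g^{≥ 0}` into `g`. -/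
def nonnegIncl (g : DGLA.{u}) : Hom g.nonneg g where
  map _ := Submodule.subtype _
  map_d _ _ _ _ := rfl
  map_br _ _ _ _ _ _ := rfl

end DGLA

/-! ### Tensoring with polynomials -/

open scoped Polynomial TensorProduct

namespace DGLA

section Poly

variable {U V W X Y Z : Type u} [AddCommGroup U] [Module ℝ U] [AddCommGroup V] [Module ℝ V]
  [AddCommGroup W] [Module ℝ W] [AddCommGroup X] [Module ℝ X] [AddCommGroup Y] [Module ℝ Y]
  [AddCommGroup Z] [Module ℝ Z]

/-- The extension `(p ⊗ u, q ⊗ v) ↦ pq ⊗ B(u, v)` of a bilinear map. -/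
def polyBilin (B : U →ₗ[ℝ] V →ₗ[ℝ] W) : ℝ[X] ⊗[ℝ] U →ₗ[ℝ] ℝ[X] ⊗[ℝ] V →ₗ[ℝ] ℝ[X] ⊗[ℝ] W :=
  TensorProduct.map₂ (LinearMap.mul ℝ ℝ[X]) B

@[simp] lemma polyBilin_tmul (B : U →ₗ[ℝ] V →ₗ[ℝ] W) (p q : ℝ[X]) (u : U) (v : V) :
    polyBilin B (p ⊗ₜ u) (q ⊗ₜ v) = (p * q) ⊗ₜ B u v := rfl

/-- `p ⊗ u ↦ p' ⊗ u`. -/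
def polyDeriv (U : Type u) [AddCommGroup U] [Module ℝ U] : ℝ[X] ⊗[ℝ] U →ₗ[ℝ] ℝ[X] ⊗[ℝ] U :=
  Polynomial.derivative.rTensor U

@[simp] lemma polyDeriv_tmul (p : ℝ[X]) (u : U) :
    polyDeriv U (p ⊗ₜ u) = (Polynomial.derivative p) ⊗ₜ u := rfl

/-- `p ⊗ u ↦ p(s) u`. -/
def polyEval (s : ℝ) (U : Type u) [AddCommGroup U] [Module ℝ U] : ℝ[X] ⊗[ℝ] U →ₗ[ℝ] U :=
  TensorProduct.lid ℝ U ∘ₗ (Polynomial.leval s).rTensor U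

@[simp] lemma polyEval_tmul (s : ℝ) (p : ℝ[X]) (u : U) : polyEval s U (p ⊗ₜ u) = p.eval s • u := by
  simp [polyEval, Polynomial.leval]

lemma polyDeriv_lTensor (f : U →ₗ[ℝ] V) (x : ℝ[X] ⊗[ℝ] U) :
    polyDeriv V (f.lTensor _ x) = f.lTensor _ (polyDeriv U x) := by
  induction x with
  | zero => simp
  | tmul p u => simp
  | add x y hx hy => simp [hx, hy]

lemma polyDeriv_bilin (B : U →ₗ[ℝ] V →ₗ[ℝ] W) (x : ℝ[X] ⊗[ℝ] U) (y : ℝ[X] ⊗[ℝ] V) :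
    polyDeriv W (polyBilin B x y) = polyBilin B (polyDeriv U x) y + polyBilin B x (polyDeriv V y) := by
  induction x with
  | zero => simp
  | add x x' hx hx' => simp [hx, hx']; abel
  | tmul p u =>
    induction y with
    | zero => simp
    | add y y' hy hy' => simp only [map_add, hy, hy']; abel
    | tmul q v => simp [TensorProduct.add_tmul]

lemma poly_skew {B : U →ₗ[ℝ] V →ₗ[ℝ] W} {B' : V →ₗ[ℝ] U →ₗ[ℝ] W} {c : ℝ}
    (h : ∀ x y, B x y = c • B' y x) (x : ℝ[X] ⊗[ℝ] U) (y : ℝ[X] ⊗[ℝ] V) :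
    polyBilin B x y = c • polyBilin B' y x := by
  induction x with
  | zero => simp
  | add x x' hx hx' => simp [hx, hx']
  | tmul p u =>
    induction y with
    | zero => simp
    | add y y' hy hy' => simp only [map_add, hy, hy', LinearMap.add_apply, smul_add]
    | tmul q v => simp [h, mul_comm]

lemma poly_leibniz {B : U →ₗ[ℝ] V →ₗ[ℝ] W} {B₁ : X →ₗ[ℝ] V →ₗ[ℝ] Z} {B₂ : U →ₗ[ℝ] Y →ₗ[ℝ] Z}
    {D : W →ₗ[ℝ] Z} {D₁ : U →ₗ[ℝ] X} {D₂ : V →ₗ[ℝ] Y} {c : ℝ}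
    (h : ∀ x y, D (B x y) = B₁ (D₁ x) y + c • B₂ x (D₂ y)) (x : ℝ[X] ⊗[ℝ] U) (y : ℝ[X] ⊗[ℝ] V) :
    D.lTensor _ (polyBilin B x y) =
      polyBilin B₁ (D₁.lTensor _ x) y + c • polyBilin B₂ x (D₂.lTensor _ y) := by
  induction x with
  | zero => simp
  | add x x' hx hx' => simp [hx, hx']; abel
  | tmul p u =>
    induction y with
    | zero => simp
    | add y y' hy hy' => simp only [map_add, hy, hy', smul_add]; abel
    | tmul q v => simp [h, TensorProduct.tmul_add]

variable {U₁ U₂ U₃ : Type u} [AddCommGroup U₁] [Module ℝ U₁] [AddCommGroup U₂] [Module ℝ U₂]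
  [AddCommGroup U₃] [Module ℝ U₃]

lemma poly_jacobi {B₁ : V →ₗ[ℝ] W →ₗ[ℝ] U₁} {B₂ : U →ₗ[ℝ] U₁ →ₗ[ℝ] Z}
    {B₃ : U →ₗ[ℝ] V →ₗ[ℝ] U₂} {B₄ : U₂ →ₗ[ℝ] W →ₗ[ℝ] Z} {B₅ : U →ₗ[ℝ] W →ₗ[ℝ] U₃}
    {B₆ : V →ₗ[ℝ] U₃ →ₗ[ℝ] Z} {c : ℝ}
    (h : ∀ x y z, B₂ x (B₁ y z) = B₄ (B₃ x y) z + c • B₆ y (B₅ x z))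
    (x : ℝ[X] ⊗[ℝ] U) (y : ℝ[X] ⊗[ℝ] V) (z : ℝ[X] ⊗[ℝ] W) :
    polyBilin B₂ x (polyBilin B₁ y z) =
      polyBilin B₄ (polyBilin B₃ x y) z + c • polyBilin B₆ y (polyBilin B₅ x z) := by
  induction x with
  | zero => simp
  | add x x' hx hx' => simp [hx, hx']; abel
  | tmul p u =>
    induction y with
    | zero => simp
    | add y y' hy hy' => simp only [map_add, LinearMap.add_apply, hy, hy', smul_add]; abel
    | tmul q v =>
      induction z with
      | zero => simp
      | add z z' hz hz' => simp only [map_add, hz, hz', smul_add]; abel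
      | tmul s w =>
        simp only [polyBilin_tmul, h, TensorProduct.tmul_add, TensorProduct.tmul_smul, mul_assoc,
          mul_left_comm]

end Poly

variable (h : DGLA.{u})

/-- The identification of homogeneous components of equal degrees. -/
def castL {i j : ℤ} (e : i = j) : h.V i →ₗ[ℝ] h.V j := e ▸ LinearMap.id

lemma castL_rfl {i : ℤ} (x : h.V i) : h.castL (rfl : i = i) x = x := rfl

lemma lTensor_castL_d {i j i' j' : ℤ} (e : i = i') (e' : j = j') (hij : i + 1 = j)
    (hij' : i' + 1 = j') (x : ℝ[X] ⊗[ℝ] h.V i) :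
    (h.d i' j' hij').lTensor _ ((h.castL e).lTensor _ x) =
      (h.castL e').lTensor _ ((h.d i j hij).lTensor _ x) := by
  subst e e'
  simp [castL]

lemma polyBilin_castL_left {i i' j k : ℤ} (e : i = i') (hk : i + j = k) (hk' : i' + j = k)
    (x : ℝ[X] ⊗[ℝ] h.V i) (y : ℝ[X] ⊗[ℝ] h.V j) :
    polyBilin (h.br i' j k hk') ((h.castL e).lTensor _ x) y = polyBilin (h.br i j k hk) x y := by
  subst e
  simp [castL]

lemma polyBilin_castL_right {i j j' k : ℤ} (e : j = j') (hk : i + j = k) (hk' : i + j' = k)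
    (x : ℝ[X] ⊗[ℝ] h.V i) (y : ℝ[X] ⊗[ℝ] h.V j) :
    polyBilin (h.br i j' k hk') x ((h.castL e).lTensor _ y) = polyBilin (h.br i j k hk) x y := by
  subst e
  simp [castL]

lemma castL_polyBilin {i j k k' : ℤ} (e : k = k') (hk : i + j = k) (hk' : i + j = k')
    (x : ℝ[X] ⊗[ℝ] h.V i) (y : ℝ[X] ⊗[ℝ] h.V j) :
    (h.castL e).lTensor _ (polyBilin (h.br i j k hk) x y) = polyBilin (h.br i j k' hk') x y := by
  subst e
  simp [castL]

lemma lTensor_d_d (i j k : ℤ) (hij : i + 1 = j) (hjk : j + 1 = k) (x : ℝ[X] ⊗[ℝ] h.V i) :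
    (h.d j k hjk).lTensor ℝ[X] ((h.d i j hij).lTensor _ x) = 0 := by
  rw [← LinearMap.comp_apply, ← LinearMap.lTensor_comp,
    show h.d j k hjk ∘ₗ h.d i j hij = 0 from LinearMap.ext (h.d_d i j k hij hjk),
    LinearMap.lTensor_zero, LinearMap.zero_apply]

lemma neg_one_zpow_add_one (i : ℤ) : (-1 : ℝ) ^ (i + 1) = -(-1) ^ i := by
  rw [zpow_add₀ (by norm_num)]; simp

lemma neg_one_zpow_sub_one (i : ℤ) : (-1 : ℝ) ^ (i - 1) = -(-1) ^ i := by
  rw [zpow_sub₀ (by norm_num)]; simp [div_neg]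

lemma neg_one_zpow_mul_self (i : ℤ) : (-1 : ℝ) ^ i * (-1) ^ i = 1 := by
  rw [← mul_zpow]; simp

/-- The DGLA `h[t, dt] = h ⊗ Ω(Δ¹)` of polynomial forms on the interval with coefficients in `h`.
A pair `(p, q)` in degree `n` stands for `p(t) + q(t) dt`, with `p` a polynomial with coefficients
in `hⁿ` and `q` a polynomial with coefficients in `hⁿ⁻¹`; the coefficients are written to the left
of the forms, so that `[x p dt, y q] = (-1)^|y| [x, y] p q dt` and
`d (x p) = (d x) p + (-1)^|x| x p' dt`. -/
def poly : DGLA.{u} where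
  V n := (ℝ[X] ⊗[ℝ] h.V n) × (ℝ[X] ⊗[ℝ] h.V (n - 1))
  d i j e := LinearMap.prod
    ((h.d i j e).lTensor _ ∘ₗ LinearMap.fst ℝ _ _)
    ((-1 : ℝ) ^ i • ((h.castL (show i = j - 1 by omega)).lTensor _ ∘ₗ polyDeriv _ ∘ₗ
        LinearMap.fst ℝ _ _) +
      (h.d (i - 1) (j - 1) (by omega)).lTensor _ ∘ₗ LinearMap.snd ℝ _ _)
  br i j k e := LinearMap.mk₂ ℝ
    (fun x y => (polyBilin (h.br i j k e) x.1 y.1,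
      polyBilin (h.br i (j - 1) (k - 1) (by omega)) x.1 y.2 +
        (-1 : ℝ) ^ j • polyBilin (h.br (i - 1) j (k - 1) (by omega)) x.2 y.1))
    (fun _ _ _ => Prod.ext (by simp) (by simp; abel))
    (fun _ _ _ => Prod.ext (by simp) (by simp; module))
    (fun _ _ _ => Prod.ext (by simp) (by simp; abel))
    (fun _ _ _ => Prod.ext (by simp) (by simp; module))
  d_d i j k hij hjk x := by
    subst hij
    refine Prod.ext (h.lTensor_d_d _ _ _ _ _ _) ?_
    simp [h.lTensor_d_d, h.lTensor_castL_d (i := i) (j := i + 1) (i' := i + 1 - 1) (j' := k - 1)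
      (by omega) (by omega) (by omega) (by omega), neg_one_zpow_add_one, polyDeriv_lTensor]
  skew i j k e e' x y := by
    refine Prod.ext (poly_skew (h.skew i j k e e') _ _) ?_
    have h1 := poly_skew (h.skew i (j - 1) (k - 1) (by omega) (by omega)) x.1 y.2
    have h2 := poly_skew (h.skew (i - 1) j (k - 1) (by omega) (by omega)) x.2 y.1
    simp only [LinearMap.mk₂_apply, Prod.smul_snd, h1, h2, mul_sub, sub_mul, one_mul, mul_one,
      zpow_sub₀ (show (-1 : ℝ) ≠ 0 by norm_num)]
    have a1 := neg_one_zpow_mul_self i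
    have a2 := neg_one_zpow_mul_self j
    have a1' : ((-1 : ℝ) ^ i)⁻¹ = (-1) ^ i := inv_eq_of_mul_eq_one_left a1
    have a2' : ((-1 : ℝ) ^ j)⁻¹ = (-1) ^ j := inv_eq_of_mul_eq_one_left a2
    rw [div_eq_mul_inv, div_eq_mul_inv, a1', a2']
    match_scalars
    all_goals first
      | ring1
      | linear_combination (-1 : ℝ) ^ (i * j) * a2
      | linear_combination -(-1 : ℝ) ^ (i * j) * a2
  leibniz i j k l i' j' hk hl hi hj hl₁ hl₂ x y := by
    subst hi hj
    refine Prod.ext (poly_leibniz (h.leibniz i j k l _ _ hk hl rfl rfl hl₁ hl₂) _ _) ?_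
    have h1 := poly_leibniz (h.leibniz i (j - 1) (k - 1) (l - 1) (i + 1) (j + 1 - 1) (by omega)
      (by omega) (by omega) (by omega) (by omega) (by omega)) x.1 y.2
    have h2 := poly_leibniz (h.leibniz (i - 1) j (k - 1) (l - 1) (i + 1 - 1) (j + 1) (by omega)
      (by omega) (by omega) (by omega) (by omega) (by omega)) x.2 y.1
    have h3 := h.polyBilin_castL_left (i := i) (i' := i + 1 - 1) (j := j) (k := l - 1) (by omega)
      (by omega) (by omega) (polyDeriv _ x.1) y.1
    have h4 := h.polyBilin_castL_right (i := i) (j := j) (j' := j + 1 - 1) (k := l - 1) (by omega)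
      (by omega) (by omega) x.1 (polyDeriv _ y.1)
    have h5 := h.castL_polyBilin (i := i) (j := j) (k := k) (k' := l - 1) (by omega) hk (by omega)
    simp only [LinearMap.mk₂_apply, LinearMap.prod_apply, Function.prod, LinearMap.add_apply,
      LinearMap.smul_apply, LinearMap.comp_apply, LinearMap.fst_apply, LinearMap.snd_apply,
      map_add, map_smul, Prod.snd_add, Prod.smul_snd, polyDeriv_bilin, h1, h2, h3, h4, h5]
    rw [show (-1 : ℝ) ^ k = (-1) ^ i * (-1) ^ j by rw [← hk, zpow_add₀ (by norm_num)],
      neg_one_zpow_add_one, neg_one_zpow_sub_one]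
    module
  jacobi i j k jk ij ik n h₁ h₂ h₃ h₄ h₅ h₆ x y z := by
    refine Prod.ext (poly_jacobi (h.jacobi i j k jk ij ik n h₁ h₂ h₃ h₄ h₅ h₆) _ _ _) ?_
    have e1 := poly_jacobi (h.jacobi i j (k - 1) (jk - 1) ij (ik - 1) (n - 1) (by omega) (by omega)
      (by omega) (by omega) (by omega) (by omega)) x.1 y.1 z.2
    have e2 := poly_jacobi (h.jacobi i (j - 1) k (jk - 1) (ij - 1) ik (n - 1) (by omega) (by omega)
      (by omega) (by omega) (by omega) (by omega)) x.1 y.2 z.1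
    have e3 := poly_jacobi (h.jacobi (i - 1) j k jk (ij - 1) (ik - 1) (n - 1) (by omega) (by omega)
      (by omega) (by omega) (by omega) (by omega)) x.2 y.1 z.1
    simp only [LinearMap.mk₂_apply, map_add, map_smul, LinearMap.add_apply, LinearMap.smul_apply,
      Prod.snd_add, Prod.smul_snd, e1, e2, e3]
    have a1 := neg_one_zpow_mul_self i
    have a2 := neg_one_zpow_mul_self j
    have a1' : ((-1 : ℝ) ^ i)⁻¹ = (-1) ^ i := inv_eq_of_mul_eq_one_left a1
    have a2' : ((-1 : ℝ) ^ j)⁻¹ = (-1) ^ j := inv_eq_of_mul_eq_one_left a2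
    rw [show (-1 : ℝ) ^ jk = (-1) ^ j * (-1) ^ k by rw [← h₁, zpow_add₀ (by norm_num)],
      show (-1 : ℝ) ^ ik = (-1) ^ i * (-1) ^ k by rw [← h₅, zpow_add₀ (by norm_num)]]
    simp only [mul_sub, sub_mul, one_mul, mul_one, zpow_sub₀ (show (-1 : ℝ) ≠ 0 by norm_num),
      div_eq_mul_inv, a1', a2']
    match_scalars
    all_goals first
      | ring1
      | linear_combination (-1 : ℝ) ^ (i * j) * (-1) ^ k * a1
      | linear_combination (-1 : ℝ) ^ (i * j) * (-1) ^ k * a2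

/-- The inclusion of `h` into `h[t, dt]` as constant polynomials. -/
def polyConst : Hom h h.poly where
  map _ := LinearMap.prod (TensorProduct.mk ℝ ℝ[X] _ 1) 0
  map_d i j e x := by
    refine Prod.ext ?_ ?_
    · change (1 : ℝ[X]) ⊗ₜ h.d i j e x = (h.d i j e).lTensor _ (1 ⊗ₜ x)
      simp
    · change 0 = (-1 : ℝ) ^ i • (h.castL (show i = j - 1 by omega)).lTensor _
        (polyDeriv _ ((1 : ℝ[X]) ⊗ₜ x)) + (h.d (i - 1) (j - 1) (by omega)).lTensor ℝ[X] 0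
      simp
  map_br i j k e x y := by
    refine Prod.ext ?_ ?_
    · change (1 : ℝ[X]) ⊗ₜ h.br i j k e x y = polyBilin (h.br i j k e) (1 ⊗ₜ x) (1 ⊗ₜ y)
      simp
    · change 0 = polyBilin (h.br i (j - 1) (k - 1) (by omega)) (1 ⊗ₜ x) 0 +
        (-1 : ℝ) ^ j • polyBilin (h.br (i - 1) j (k - 1) (by omega)) 0 (1 ⊗ₜ y)
      simp

/-- Evaluation `h[t, dt] → h` at `t = s`, `dt = 0`. -/
def polyEv (s : ℝ) : Hom h.poly h where
  map _ := polyEval s _ ∘ₗ LinearMap.fst ℝ _ _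
  map_d i j e x := by
    change polyEval s _ ((h.d i j e).lTensor _ x.1) = h.d i j e (polyEval s _ x.1)
    induction x.1 with
    | zero => simp
    | add x y hx hy => simp only [map_add, hx, hy]
    | tmul p u => simp
  map_br i j k e x y := by
    change polyEval s _ (polyBilin (h.br i j k e) x.1 y.1) =
      h.br i j k e (polyEval s _ x.1) (polyEval s _ y.1)
    induction x.1 with
    | zero => simp
    | add x y hx hy => simp only [map_add, hx, hy, LinearMap.add_apply]
    | tmul p u =>
      induction y.1 with
      | zero => simp
      | add x y hx hy => simp only [map_add, hx, hy]
      | tmul q v => simp [mul_smul, smul_comm (p.eval s)]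

end DGLA

/-! ### Unshuffles -/

section Unshuffles

variable {p q N : ℕ}

/-- The `i`-th element of the first block of `{0, …, p + q - 1}`. -/
def blockL (h : p + q = N) (i : Fin p) : Fin N := Fin.cast h (Fin.castAdd q i)

/-- The `j`-th element of the second block of `{0, …, p + q - 1}`. -/
def blockR (h : p + q = N) (j : Fin q) : Fin N := Fin.cast h (Fin.natAdd p j)

/-- The `(p, q)`-unshuffles: permutations `τ` with `τ(1) < ⋯ < τ(p)` and
`τ(p + 1) < ⋯ < τ(p + q)`. -/
def unshuffles (h : p + q = N) : Finset (Equiv.Perm (Fin N)) :=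
  {τ | StrictMono (fun i => τ (blockL h i)) ∧ StrictMono (fun j => τ (blockR h j))}

/-- `{1, …, p} ⊔ {1, …, q} ≃ {1, …, p + q}`. -/
def blockEquiv (h : p + q = N) : Fin p ⊕ Fin q ≃ Fin N := finSumFinEquiv.trans (finCongr h)

lemma blockEquiv_inl (h : p + q = N) (i : Fin p) : blockEquiv h (Sum.inl i) = blockL h i := rfl
lemma blockEquiv_inr (h : p + q = N) (j : Fin q) : blockEquiv h (Sum.inr j) = blockR h j := rfl

/-- The embedding `S_p × S_q → S_{p + q}`. -/
def blockPerm (h : p + q = N) (a : Equiv.Perm (Fin p)) (b : Equiv.Perm (Fin q)) :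
    Equiv.Perm (Fin N) :=
  (blockEquiv h).permCongr (Equiv.sumCongr a b)

lemma blockPerm_blockL (h : p + q = N) (a : Equiv.Perm (Fin p)) (b : Equiv.Perm (Fin q))
    (i : Fin p) : blockPerm h a b (blockL h i) = blockL h (a i) := by
  simp [blockPerm, ← blockEquiv_inl]

lemma blockPerm_blockR (h : p + q = N) (a : Equiv.Perm (Fin p)) (b : Equiv.Perm (Fin q))
    (j : Fin q) : blockPerm h a b (blockR h j) = blockR h (b j) := by
  simp [blockPerm, ← blockEquiv_inr]

lemma sign_blockPerm (h : p + q = N) (a : Equiv.Perm (Fin p)) (b : Equiv.Perm (Fin q)) :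
    Equiv.Perm.sign (blockPerm h a b) = Equiv.Perm.sign a * Equiv.Perm.sign b := by
  rw [blockPerm, Equiv.Perm.sign_permCongr]
  exact Equiv.Perm.sign_sumCongr a b

lemma perm_ext_blocks (h : p + q = N) {s t : Equiv.Perm (Fin N)}
    (hl : ∀ i, s (blockL h i) = t (blockL h i)) (hr : ∀ j, s (blockR h j) = t (blockR h j)) :
    s = t := by
  ext k
  obtain ⟨k, rfl⟩ := (blockEquiv h).surjective k
  rcases k with i | j
  · exact congrArg _ (hl i)
  · exact congrArg _ (hr j)

lemma blockL_injective (h : p + q = N) : Function.Injective (blockL h) := fun _ _ e =>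
  Sum.inl_injective ((blockEquiv h).injective e)

lemma blockR_injective (h : p + q = N) : Function.Injective (blockR h) := fun _ _ e =>
  Sum.inr_injective ((blockEquiv h).injective e)

lemma strictMono_eq_of_comp_perm {m : ℕ} {f g : Fin m → Fin N} (hf : StrictMono f)
    (hg : StrictMono g) (a b : Equiv.Perm (Fin m)) (e : ∀ i, f (a i) = g (b i)) : f = g := by
  have hr : Set.range f = Set.range g := by
    rw [← a.surjective.range_comp f, ← b.surjective.range_comp g]
    congr 1
    exact funext e
  exact (StrictMono.range_inj hf hg).1 hr

lemma unshuffle_bijective (h : p + q = N) :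
    Function.Bijective (fun x : unshuffles h × Equiv.Perm (Fin p) × Equiv.Perm (Fin q) =>
      x.1.1 * blockPerm h x.2.1 x.2.2) := by
  constructor
  · rintro ⟨⟨s, hs⟩, a, b⟩ ⟨⟨t, ht⟩, a', b'⟩ e
    simp only [unshuffles, Finset.mem_filter, Finset.mem_univ, true_and] at hs ht
    have el : ∀ i, s (blockL h (a i)) = t (blockL h (a' i)) := fun i => by
      have := DFunLike.congr_fun e (blockL h i)
      simpa [blockPerm_blockL] using this
    have er : ∀ i, s (blockR h (b i)) = t (blockR h (b' i)) := fun i => by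
      have := DFunLike.congr_fun e (blockR h i)
      simpa [blockPerm_blockR] using this
    have hl := strictMono_eq_of_comp_perm hs.1 ht.1 a a' el
    have hr := strictMono_eq_of_comp_perm hs.2 ht.2 b b' er
    obtain rfl : s = t := perm_ext_blocks h (congrFun hl) (congrFun hr)
    obtain rfl : a = a' := Equiv.ext fun i => blockL_injective h (s.injective (el i))
    obtain rfl : b = b' := Equiv.ext fun i => blockR_injective h (s.injective (er i))
    rfl
  · intro t
    have key : ∀ {m : ℕ} (f : Fin m → Fin N), Function.Injective f →
        StrictMono (f ∘ Tuple.sort f) := fun f hf =>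
      (Tuple.monotone_sort f).strictMono_of_injective (hf.comp (Tuple.sort f).injective)
    set a := Tuple.sort (fun i => t (blockL h i))
    set b := Tuple.sort (fun i => t (blockR h i))
    refine ⟨⟨⟨t * blockPerm h a b, ?_⟩, a⁻¹, b⁻¹⟩, ?_⟩
    · simp only [unshuffles, Finset.mem_filter, Finset.mem_univ, true_and, Equiv.Perm.mul_apply,
        blockPerm_blockL, blockPerm_blockR]
      exact ⟨key _ (t.injective.comp (blockL_injective h)),
        key _ (t.injective.comp (blockR_injective h))⟩
    · refine perm_ext_blocks h (fun i => ?_) fun i => ?_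
      · simp [blockPerm_blockL]
      · simp [blockPerm_blockR]

variable {L W : Type u} [AddCommGroup L] [Module ℝ L] [AddCommGroup W] [Module ℝ W]

/-- `(x₁, …, x_{p + q}) ↦ m(x₁, …, x_p; x_{p + 1}, …, x_{p + q})`. -/
def blockMultilinear (h : p + q = N) (m : L [⋀^Fin p]→ₗ[ℝ] (L [⋀^Fin q]→ₗ[ℝ] W)) :
    MultilinearMap ℝ (fun _ : Fin N => L) W :=
  (MultilinearMap.uncurrySum (N := fun _ : Fin p ⊕ Fin q => L)
    ((AlternatingMap.toMultilinearMapLM (R := ℝ) (S := ℝ) (M := L) (N := W)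
      (ι := Fin q)).compMultilinearMap m.toMultilinearMap)).domDomCongr (blockEquiv h)

lemma blockMultilinear_apply (h : p + q = N) (m : L [⋀^Fin p]→ₗ[ℝ] (L [⋀^Fin q]→ₗ[ℝ] W))
    (x : Fin N → L) :
    blockMultilinear h m x = m (fun i => x (blockL h i)) (fun j => x (blockR h j)) := rfl

lemma alternatization_eq_smul_unshuffleSum (h : p + q = N)
    (m : L [⋀^Fin p]→ₗ[ℝ] (L [⋀^Fin q]→ₗ[ℝ] W)) (x : Fin N → L) :
    MultilinearMap.alternatization (blockMultilinear h m) x =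
      (p.factorial * q.factorial : ℝ) • ∑ τ ∈ unshuffles h, Equiv.Perm.sign τ •
        m (fun i => x (τ (blockL h i))) (fun j => x (τ (blockR h j))) := by
  rw [MultilinearMap.alternatization_apply,
    ← Function.Bijective.sum_comp (unshuffle_bijective h) (fun τ => Equiv.Perm.sign τ •
      (blockMultilinear h m).domDomCongr τ x), Fintype.sum_prod_type, Finset.smul_sum,
    ← Finset.sum_coe_sort (unshuffles h) (fun τ => (p.factorial * q.factorial : ℝ) •
      Equiv.Perm.sign τ • m (fun i => x (τ (blockL h i))) (fun j => x (τ (blockR h j))))]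
  refine Finset.sum_congr rfl fun τ _ => ?_
  have : ∀ ab : Equiv.Perm (Fin p) × Equiv.Perm (Fin q),
      Equiv.Perm.sign (τ.1 * blockPerm h ab.1 ab.2) •
        (blockMultilinear h m).domDomCongr (τ.1 * blockPerm h ab.1 ab.2) x =
      Equiv.Perm.sign τ.1 • m (fun i => x (τ.1 (blockL h i))) (fun j => x (τ.1 (blockR h j))) := by
    rintro ⟨a, b⟩
    change Equiv.Perm.sign (τ.1 * blockPerm h a b) • blockMultilinear h m
      (fun i => x ((τ.1 * blockPerm h a b) i)) = _
    rw [blockMultilinear_apply]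
    simp only [Equiv.Perm.mul_apply, blockPerm_blockL, blockPerm_blockR]
    have e1 := AlternatingMap.map_perm m (fun i => x (τ.1 (blockL h i))) a
    have e2 := fun w : Fin p → L => AlternatingMap.map_perm (m w) (fun j => x (τ.1 (blockR h j))) b
    simp only [Function.comp_def] at e1 e2
    rw [e2, e1, map_mul, sign_blockPerm, AlternatingMap.smul_apply, smul_smul, smul_smul]
    congr 1
    rw [← mul_assoc (Equiv.Perm.sign τ.1), mul_assoc, mul_assoc,
      ← mul_assoc (Equiv.Perm.sign b), Int.units_mul_self, one_mul, mul_assoc,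
      Int.units_mul_self, mul_one]
  rw [Finset.sum_congr rfl fun ab _ => this ab, Finset.sum_const, Finset.card_univ,
    Fintype.card_prod, Fintype.card_perm, Fintype.card_perm, Fintype.card_fin, Fintype.card_fin,
    ← Nat.cast_smul_eq_nsmul ℝ, Nat.cast_mul]

/-- The unshuffle sum `∑_τ sgn(τ) m(x_{τ(1)}, …, x_{τ(p)}; x_{τ(p + 1)}, …, x_{τ(p + q)})` over all
`(p, q)`-unshuffles `τ`, where `m` is alternating in its first `p` and in its last `q` arguments. -/
def unshuffleSum (h : p + q = N) (m : L [⋀^Fin p]→ₗ[ℝ] (L [⋀^Fin q]→ₗ[ℝ] W)) :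
    L [⋀^Fin N]→ₗ[ℝ] W :=
  have key : ∀ x : Fin N → L, (∑ τ ∈ unshuffles h, Equiv.Perm.sign τ •
      m (fun i => x (τ (blockL h i))) (fun j => x (τ (blockR h j)))) =
      ((p.factorial * q.factorial : ℝ)⁻¹ •
        MultilinearMap.alternatization (blockMultilinear h m)) x := fun x => by
    rw [AlternatingMap.smul_apply, alternatization_eq_smul_unshuffleSum, smul_smul,
      inv_mul_cancel₀ (by positivity), one_smul]
  { toFun := fun x => ∑ τ ∈ unshuffles h, Equiv.Perm.sign τ •
      m (fun i => x (τ (blockL h i))) (fun j => x (τ (blockR h j)))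
    map_update_add' := fun v i x y => by simp only [key, AlternatingMap.map_update_add]
    map_update_smul' := fun v i c x => by simp only [key, AlternatingMap.map_update_smul]
    map_eq_zero_of_eq' := fun v i j hv hij => by
      rw [key, AlternatingMap.map_eq_zero_of_eq _ v hv hij] }

lemma unshuffleSum_apply (h : p + q = N) (m : L [⋀^Fin p]→ₗ[ℝ] (L [⋀^Fin q]→ₗ[ℝ] W))
    (x : Fin N → L) :
    unshuffleSum h m x = ∑ τ ∈ unshuffles h, Equiv.Perm.sign τ •
      m (fun i => x (τ (blockL h i))) (fun j => x (τ (blockR h j))) := rfl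

variable {U V : Type u} [AddCommGroup U] [Module ℝ U] [AddCommGroup V] [Module ℝ V]

/-- `(x; y) ↦ B(f(x), g(y))`. -/
def pairAlt (B : U →ₗ[ℝ] V →ₗ[ℝ] W) (f : L [⋀^Fin p]→ₗ[ℝ] U) (g : L [⋀^Fin q]→ₗ[ℝ] V) :
    L [⋀^Fin p]→ₗ[ℝ] (L [⋀^Fin q]→ₗ[ℝ] W) :=
  LinearMap.compAlternatingMap
    { toFun := fun u => (B u).compAlternatingMap g
      map_add' := fun u v => by ext; simp
      map_smul' := fun c u => by ext; simp } f

@[simp] lemma pairAlt_apply (B : U →ₗ[ℝ] V →ₗ[ℝ] W) (f : L [⋀^Fin p]→ₗ[ℝ] U)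
    (g : L [⋀^Fin q]→ₗ[ℝ] V) (x : Fin p → L) (y : Fin q → L) :
    pairAlt B f g x y = B (f x) (g y) := rfl

end Unshuffles

/-! ### The Chevalley–Eilenberg DGLA -/

section Bracket

variable (L : Type u) [LieRing L] [LieAlgebra ℝ L]

/-- The Lie bracket as an alternating map. -/
def lieAlt : L [⋀^Fin 2]→ₗ[ℝ] L where
  toFun x := ⁅x 0, x 1⁆
  map_update_add' {inst} v i x y := by
    obtain rfl := Subsingleton.elim inst (instDecidableEqFin 2)
    fin_cases i <;> simp
  map_update_smul' {inst} v i c x := by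
    obtain rfl := Subsingleton.elim inst (instDecidableEqFin 2)
    fin_cases i <;> simp
  map_eq_zero_of_eq' v i j hv hij := by
    have : v 0 = v 1 := by
      fin_cases i <;> fin_cases j <;> simp_all
    rw [this, lie_self]

@[simp] lemma lieAlt_apply (x : Fin 2 → L) : lieAlt L x = ⁅x 0, x 1⁆ := rfl

variable {L} {W : Type u} [AddCommGroup W] [Module ℝ W]

/-- The composition `f ◁ [·,·]`, sending `x₁, …, x_{a + 2}` to
`∑_τ sgn(τ) f([x_{τ(1)}, x_{τ(2)}], x_{τ(3)}, …, x_{τ(a + 2)})` with `τ` running over the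
`(2, a)`-unshuffles. -/
def compBracket {a : ℕ} (f : L [⋀^Fin (a + 1)]→ₗ[ℝ] W) : L [⋀^Fin (a + 2)]→ₗ[ℝ] W :=
  unshuffleSum (Nat.add_comm 2 a) (f.curryLeft.compAlternatingMap (lieAlt L))

end Bracket

/-- The degree-`n` component of the Chevalley–Eilenberg DGLA `CE(L, h)`, for a Lie algebra `L`
(in degree `0`) and a DGLA `h`: a component `f a d` is an alternating map of arity `a + 1`
and degree `d`, and the arity and the degree add up to `n`. -/
abbrev CE (L : Type u) [LieRing L] [LieAlgebra ℝ L] (h : DGLA.{u}) (n : ℤ) : Type u :=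
  ∀ (a : ℕ) (d : ℤ), (a : ℤ) + 1 + d = n → L [⋀^Fin (a + 1)]→ₗ[ℝ] h.V d

section PropPi

/-! Families indexed by the proofs of a proposition are added componentwise. -/

variable {P : Prop} {X : P → Type u} [∀ p, AddCommGroup (X p)] [∀ p, Module ℝ (X p)]

instance : AddCommGroup (∀ p, X p) where
  add f g := fun p => f p + g p
  zero := fun _ => 0
  neg f := fun p => -f p
  add_assoc _ _ _ := funext fun _ => add_assoc _ _ _
  zero_add _ := funext fun _ => zero_add _
  add_zero _ := funext fun _ => add_zero _
  add_comm _ _ := funext fun _ => add_comm _ _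
  neg_add_cancel _ := funext fun _ => neg_add_cancel _
  nsmul n f := fun p => n • f p
  nsmul_zero f := funext fun p => zero_nsmul (f p)
  nsmul_succ _ _ := funext fun _ => succ_nsmul _ _
  zsmul n f := fun p => n • f p
  zsmul_zero' f := funext fun p => zero_zsmul (f p)
  zsmul_succ' _ _ := funext fun _ => SubNegMonoid.zsmul_succ' _ _
  zsmul_neg' _ _ := funext fun _ => SubNegMonoid.zsmul_neg' _ _

instance : Module ℝ (∀ p, X p) where
  smul c f := fun p => c • f p
  one_smul _ := funext fun _ => one_smul _ _
  mul_smul _ _ _ := funext fun _ => mul_smul _ _ _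
  smul_zero _ := funext fun _ => smul_zero _
  smul_add _ _ _ := funext fun _ => smul_add _ _ _
  add_smul _ _ _ := funext fun _ => add_smul _ _ _
  zero_smul f := funext fun p => zero_smul ℝ (f p)

end PropPi

namespace CE

variable {L : Type u} [LieRing L] [LieAlgebra ℝ L] {g h : DGLA.{u}}

/-- The total differential `f ↦ f ◁ [·,·] - (-1)^{a + d - 1} d_h ∘ f` of `CE(L, h)`. -/
def d {n m : ℤ} (e : n + 1 = m) (f : CE L h n) : CE L h m
  | 0, d, e' => -(-1 : ℝ) ^ (n - 1) • (h.d (d - 1) d (by omega)).compAlternatingMap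
      (f 0 (d - 1) (by omega))
  | a + 1, d, e' => compBracket (f a d (by push_cast at e'; omega)) -
      (-1 : ℝ) ^ (n - 1) • (h.d (d - 1) d (by omega)).compAlternatingMap
        (f (a + 1) (d - 1) (by omega))

/-- The bracket `[f, g] = -(-1)^{d₁ (a₂ + d₂)} [·,·]_h ∘ (f ⊗ g) ∘ P_{a₁,a₂}` of `CE(L, h)`. In the
summand with index `i`, the arities of `f` and `g` are `i + 1` and `a - i`. -/
def br {p q n : ℤ} (e : p + q = n) (f : CE L h p) (g : CE L h q) : CE L h n := fun a d e' =>
  ∑ i : Fin a, -(-1 : ℝ) ^ ((p - (i + 1)) * q) •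
    unshuffleSum (p := i + 1) (q := a - 1 - i + 1) (by omega)
      (pairAlt (h.br (p - (i + 1)) (q - (a - i)) d (by omega)) (f i (p - (i + 1)) (by omega))
        (g (a - 1 - i) (q - (a - i)) (by omega)))

/-- The Maurer–Cartan equation `d f + ½ [f, f] = 0`. -/
def IsMaurerCartan (f : CE L h 1) : Prop :=
  d (n := 1) (m := 2) rfl f + (1 / 2 : ℝ) • br (p := 1) (q := 1) (n := 2) rfl f f = 0

/-- The `n`-th term `(ad_ξ)^n ([ξ, x] - d ξ) / (n + 1)!` of the series defining the gauge action of
`ξ` on `x`. -/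
def gaugeTerm (ξ : CE L h 0) (x : CE L h 1) (n : ℕ) : CE L h 1 :=
  ((n + 1).factorial : ℝ)⁻¹ • (br (zero_add 1) ξ)^[n] (br (zero_add 1) ξ x - d (zero_add 1) ξ)

/-- `y = e^ξ ⋆ x`, where the series `e^ξ ⋆ x = x + ∑ₙ (ad_ξ)^n ([ξ, x] - d ξ) / (n + 1)!` has only
finitely many nonzero terms. -/
def IsGaugeTransform (ξ : CE L h 0) (x y : CE L h 1) : Prop :=
  ∃ N : ℕ, (∀ n, N ≤ n → gaugeTerm ξ x n = 0) ∧ y = x + ∑ n ∈ Finset.range N, gaugeTerm ξ x n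

/-- `Φ = (Φ₁, Φ₂, …)` is an `L∞`-morphism from `L` to `h`:
`Φ_{k-1} ◁ [·,·] = d_h ∘ Φ_k + ½ ∑_{i + j = k} (-1)^{deg Φ_i} [·,·]_h ∘ (Φ_i ⊗ Φ_j) ∘ P_{i,j}`
for all `k ≥ 1`, where `deg Φ_i = 1 - i`. The case `k = 1` comes first, `k = a + 2` second. -/
def IsLInftyMorphism (Φ : CE L h 1) : Prop :=
  (h.d 0 1 rfl).compAlternatingMap (Φ 0 0 rfl) = 0 ∧
  ∀ (a : ℕ), compBracket (Φ a (-a) (by omega)) =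
    (h.d (-a - 1) (-a) (by omega)).compAlternatingMap (Φ (a + 1) (-a - 1) (by push_cast; omega)) +
    (1 / 2 : ℝ) • ∑ i : Fin (a + 1), (-1 : ℝ) ^ (-(i : ℤ)) •
      unshuffleSum (p := i + 1) (q := a - i + 1) (by omega)
        (pairAlt (h.br (-i) (i - a) (-a) (by omega)) (Φ i (-i) (by omega))
          (Φ (a - i) (i - a) (by omega)))

/-- Composition with a strict morphism of DGLAs. -/
def comp {n : ℤ} (F : DGLA.Hom g h) (f : CE L g n) : CE L h n := fun a d e =>
  (F.map d).compAlternatingMap (f a d e)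

/-- `H` is an `L∞`-homotopy with endpoints `x` (at `t = 0`) and `y` (at `t = 1`). -/
def IsHomotopy (H : CE L h.poly 1) (x y : CE L h 1) : Prop :=
  IsLInftyMorphism H ∧ comp (h.polyEv 0) H = x ∧ comp (h.polyEv 1) H = y

/-- The element of `CE(L, h)` of degree `n` given by a linear map from `L` to `h`. -/
def ofLinear {n : ℤ} (f : L →ₗ[ℝ] h.V (n - 1)) : CE L h n
  | 0, d, e => (h.castL (show n - 1 = d by omega)).compAlternatingMap
      (AlternatingMap.ofSubsingleton ℝ L _ (0 : Fin 1) f)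
  | _ + 1, _, _ => 0

/-- The degree-`0` element `tξ` of `CE(L, h[t, dt])`. -/
def smulT (ξ : CE L h 0) : CE L h.poly 0 := fun a d e =>
  (LinearMap.prod (TensorProduct.mk ℝ ℝ[X] _ Polynomial.X) 0).compAlternatingMap (ξ a d e)

end CE

/-! ### The DGLAs attached to a closed form -/


section ClosedForm

open Forms

variable {A L : Type u} [CommRing A] [LieRing L] [Module A L] [LieRingModule L A]
  [LieRinehartRing A L] [Algebra ℝ A] [LieAlgebra ℝ L] [LieRinehartAlgebra ℝ A L]

/-- A form of degree `k`, as an element of the graded space of all forms. -/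
def DForm.toForms {k : ℕ} (w : DForm A L k) : Forms A L := Pi.single k w

lemma d_toForms {k : ℕ} {w : DForm A L k} (hw : DForm.extd w = 0) : d w.toForms = 0 := by
  funext j
  cases j with
  | zero => rfl
  | succ j =>
    rw [d_succ, DForm.toForms]
    rcases eq_or_ne j k with rfl | hj
    · rw [Pi.single_eq_same, hw]; rfl
    · rw [Pi.single_eq_of_ne hj]
      have := DForm.extd_smul (0 : ℝ) (0 : DForm A L j)
      rw [zero_smul, zero_smul] at this
      exact this

/-- The degree-`n` part of `𝔤_{r,σ} = Ω[r] ⊕ 𝔛[1] ⊕ 𝔛`: triples `(w, y, x)` with `w` a form of degree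
`n + r`, with `y`, which stands for `y_{[1]}`, zero unless `n = -1`, and `x` zero unless `n = 0`. -/
def gSigmaPart (A L : Type u) [CommRing A] [LieRing L] [Module A L] [Algebra ℝ A] [LieAlgebra ℝ L]
    (r : ℕ) (n : ℤ) : Submodule ℝ (Forms A L × L × L) where
  carrier := {v | (∀ k : ℕ, (k : ℤ) ≠ n + r → v.1 k = 0) ∧ (n ≠ -1 → v.2.1 = 0) ∧
    (n ≠ 0 → v.2.2 = 0)}
  add_mem' := fun ⟨a, b, c⟩ ⟨a', b', c'⟩ => ⟨fun k hk => by simp [a k hk, a' k hk],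
    fun hn => by simp [b hn, b' hn], fun hn => by simp [c hn, c' hn]⟩
  zero_mem' := ⟨fun _ _ => rfl, fun _ => rfl, fun _ => rfl⟩
  smul_mem' t _ := fun ⟨a, b, c⟩ => ⟨fun k hk => by simp [a k hk],
    fun hn => by simp [b hn], fun hn => by simp [c hn]⟩

/-- `d_σ (w, y, x) = (dw + ι_y σ - L_x σ, 0, y)`, i.e. `d_σ w = dw`, `d_σ y_{[1]} = y + ι_y σ` and
`d_σ x = -L_x σ`. -/
def gSigmaD (s : Forms A L) : Forms A L × L × L →ₗ[ℝ] Forms A L × L × L where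
  toFun v := (d v.1 + ι v.2.1 s - lie v.2.2 s, 0, v.2.1)
  map_add' v v' := Prod.ext (by simp; abel) (by simp)
  map_smul' c v := Prod.ext (by simp; module) (by simp)

/-- The bracket of `v` and `v'`, where `c = (-1)^|v|`: `{y_{[1]}, w} = ι_y w`,
`{w, y_{[1]}} = -(-1)^|w| ι_y w`, `{x, w} = L_x w`, `{w, x} = -L_x w`, `{x, y_{[1]}} = [x, y]_{[1]}`,
`{y_{[1]}, x} = -[x, y]_{[1]}`, and `{x, x'} = [x, x']`, all others being zero. -/
def gSigmaBr (c : ℝ) : Forms A L × L × L →ₗ[ℝ] Forms A L × L × L →ₗ[ℝ] Forms A L × L × L :=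
  LinearMap.mk₂ ℝ (fun v v' =>
      (ι v.2.1 v'.1 - c • ι v'.2.1 v.1 + lie v.2.2 v'.1 - lie v'.2.2 v.1,
        ⁅v.2.2, v'.2.1⁆ - ⁅v'.2.2, v.2.1⁆, ⁅v.2.2, v'.2.2⁆))
    (fun _ _ _ => Prod.ext (by simp; module) (Prod.ext (by simp; abel) (by simp)))
    (fun _ _ _ => Prod.ext (by simp; module) (Prod.ext (by simp [smul_sub]) (by simp)))
    (fun _ _ _ => Prod.ext (by simp; module) (Prod.ext (by simp; abel) (by simp)))
    (fun _ _ _ => Prod.ext (by simp; module) (Prod.ext (by simp [smul_sub]) (by simp)))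

lemma gSigmaBr_apply (c : ℝ) (v v' : Forms A L × L × L) : gSigmaBr c v v' =
      (ι v.2.1 v'.1 - c • ι v'.2.1 v.1 + lie v.2.2 v'.1 - lie v'.2.2 v.1,
        ⁅v.2.2, v'.2.1⁆ - ⁅v'.2.2, v.2.1⁆, ⁅v.2.2, v'.2.2⁆) := rfl

lemma gSigmaD_apply (s : Forms A L) (v : Forms A L × L × L) :
    gSigmaD s v = (d v.1 + ι v.2.1 s - lie v.2.2 s, 0, v.2.1) := rfl

lemma ι_eq_zero {w : Forms A L} {k : ℕ} (h : w (k + 1) = 0) (x : L) : ι x w k = 0 := by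
  rw [ι_apply, h]; rfl

lemma lie_eq_zero {w : Forms A L} {k : ℕ} (h : w k = 0) (x : L) : lie x w k = 0 := by
  have := DForm.lieD_smul' (0 : ℝ) x (0 : DForm A L k)
  rw [zero_smul, zero_smul] at this
  rw [lie_apply, h, this]

lemma d_eq_zero {w : Forms A L} {k : ℕ} (h : w k = 0) : d w (k + 1) = 0 := by
  have := DForm.extd_smul (0 : ℝ) (0 : DForm A L k)
  rw [zero_smul, zero_smul] at this
  rw [d_succ, h, this]

lemma gSigmaD_mem {r : ℕ} (σ : DForm A L (r + 1)) {i j : ℤ} (e : i + 1 = j)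
    (v : Forms A L × L × L) (hv : v ∈ gSigmaPart A L r i) :
    gSigmaD σ.toForms v ∈ gSigmaPart A L r j := by
  obtain ⟨h1, h2, h3⟩ := hv
  have hs : ∀ k, k ≠ r + 1 → σ.toForms k = 0 := fun k hk => Pi.single_eq_of_ne hk _
  refine ⟨fun k hk => ?_, fun _ => rfl, fun hj => h2 (by omega)⟩
  have a1 : d v.1 k = 0 := by
    cases k with
    | zero => rfl
    | succ k => exact d_eq_zero (h1 k (by push_cast at hk; omega))
  have a2 : ι v.2.1 σ.toForms k = 0 := by
    by_cases hi : i = -1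
    · exact ι_eq_zero (hs _ (by omega)) _
    · rw [h2 hi, map_zero]; rfl
  have a3 : lie v.2.2 σ.toForms k = 0 := by
    by_cases hi : i = 0
    · exact lie_eq_zero (hs _ (by omega)) _
    · rw [h3 hi, map_zero]; rfl
  simp only [gSigmaD_apply, Pi.add_apply, Pi.sub_apply, a1, a2, a3, add_zero, sub_zero]

lemma gSigmaBr_mem {r : ℕ} (c : ℝ) {i j k : ℤ} (e : i + j = k) (v v' : Forms A L × L × L)
    (hv : v ∈ gSigmaPart A L r i) (hv' : v' ∈ gSigmaPart A L r j) :
    gSigmaBr c v v' ∈ gSigmaPart A L r k := by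
  obtain ⟨h1, h2, h3⟩ := hv
  obtain ⟨h1', h2', h3'⟩ := hv'
  refine ⟨fun m hm => ?_, fun hn => ?_, fun hn => ?_⟩
  · have a1 : ι v.2.1 v'.1 m = 0 := by
      by_cases hi : i = -1
      · exact ι_eq_zero (h1' _ (by push_cast; omega)) _
      · rw [h2 hi, map_zero]; rfl
    have a2 : ι v'.2.1 v.1 m = 0 := by
      by_cases hi : j = -1
      · exact ι_eq_zero (h1 _ (by push_cast; omega)) _
      · rw [h2' hi, map_zero]; rfl
    have a3 : lie v.2.2 v'.1 m = 0 := by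
      by_cases hi : i = 0
      · exact lie_eq_zero (h1' _ (by omega)) _
      · rw [h3 hi, map_zero]; rfl
    have a4 : lie v'.2.2 v.1 m = 0 := by
      by_cases hi : j = 0
      · exact lie_eq_zero (h1 _ (by omega)) _
      · rw [h3' hi, map_zero]; rfl
    simp only [gSigmaBr_apply, Pi.add_apply, Pi.sub_apply, Pi.smul_apply, a1, a2, a3, a4,
      smul_zero, add_zero, sub_zero]
  · have a1 : ⁅v.2.2, v'.2.1⁆ = 0 := by
      by_cases hi : i = 0
      · rw [h2' (by omega), lie_zero]
      · rw [h3 hi, zero_lie]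
    have a2 : ⁅v'.2.2, v.2.1⁆ = 0 := by
      by_cases hi : j = 0
      · rw [h2 (by omega), lie_zero]
      · rw [h3' hi, zero_lie]
    simp only [gSigmaBr_apply, a1, a2, sub_zero]
  · by_cases hi : i = 0
    · simp only [gSigmaBr_apply, h3' (by omega), lie_zero]
    · simp only [gSigmaBr_apply, h3 hi, zero_lie]

/-- The elements of degree `n` are of one of three kinds. -/
lemma gSigma_cases {r : ℕ} {n : ℤ} {v : Forms A L × L × L} (hv : v ∈ gSigmaPart A L r n) :
    (∃ w, v = (w, 0, 0)) ∨ (n = -1 ∧ ∃ w y, v = (w, y, 0)) ∨ (n = 0 ∧ ∃ w x, v = (w, 0, x)) := by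
  obtain ⟨w, y, x⟩ := v
  obtain ⟨-, h2, h3⟩ := hv
  simp only at h2 h3
  by_cases h : n = -1
  · exact Or.inr (Or.inl ⟨h, w, y, by rw [h3 (by omega)]⟩)
  · by_cases h' : n = 0
    · exact Or.inr (Or.inr ⟨h', w, x, by rw [h2 h]⟩)
    · exact Or.inl ⟨w, by rw [h2 h, h3 h']⟩

lemma gSigma_d_d {s : Forms A L} (hs : d s = 0) (v : Forms A L × L × L) :
    gSigmaD s (gSigmaD s v) = 0 := by
  have h := cartan v.2.1 s
  rw [hs, map_zero, add_zero] at h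
  simp [gSigmaD_apply, d_d, d_lie, hs, h]

lemma inv_neg_one_zpow (i : ℤ) : ((-1 : ℝ) ^ i)⁻¹ = (-1) ^ i :=
  inv_eq_of_mul_eq_one_left (DGLA.neg_one_zpow_mul_self i)

lemma gSigma_skew {r : ℕ} {i j : ℤ} {v v' : Forms A L × L × L}
    (hv : v ∈ gSigmaPart A L r i) (hv' : v' ∈ gSigmaPart A L r j) :
    gSigmaBr ((-1) ^ i) v v' = -((-1 : ℝ) ^ (i * j)) • gSigmaBr ((-1) ^ j) v' v := by
  rcases gSigma_cases hv with ⟨w, rfl⟩ | ⟨rfl, w, y, rfl⟩ | ⟨rfl, w, x, rfl⟩ <;>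
  rcases gSigma_cases hv' with ⟨w', rfl⟩ | ⟨rfl, w', y', rfl⟩ | ⟨rfl, w', x', rfl⟩ <;>
  simp only [gSigmaBr_apply, map_zero, LinearMap.zero_apply, smul_zero, zero_sub, sub_zero,
    add_zero, zero_add, lie_zero, zero_lie, mul_neg, neg_mul, mul_one, one_mul, zero_mul, mul_zero,
    zpow_neg, zpow_one, zpow_zero, inv_neg_one_zpow, Prod.smul_mk, neg_zero, neg_neg, inv_neg,
    inv_one, neg_smul, one_smul, smul_neg, sub_neg_eq_add, smul_smul, DGLA.neg_one_zpow_mul_self]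
  all_goals first
    | done
    | rfl
    | (refine Prod.ext ?_ (Prod.ext ?_ ?_) <;>
        simp only [Prod.fst_neg, Prod.snd_neg, neg_zero, neg_neg] <;>
        first | done | rfl | module | exact (lie_skew _ _).symm)

lemma gSigma_leibniz {r : ℕ} {i j : ℤ} {s : Forms A L} (hs : d s = 0) {v v' : Forms A L × L × L}
    (hv : v ∈ gSigmaPart A L r i) (hv' : v' ∈ gSigmaPart A L r j) :
    gSigmaD s (gSigmaBr ((-1) ^ i) v v') =
      gSigmaBr ((-1) ^ (i + 1)) (gSigmaD s v) v' +
        (-1 : ℝ) ^ i • gSigmaBr ((-1) ^ i) v (gSigmaD s v') := by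
  have h : ∀ y, d (ι y s) = lie y s := fun y => by
    have := cartan y s
    rwa [hs, map_zero, add_zero] at this
  rcases gSigma_cases hv with ⟨w, rfl⟩ | ⟨rfl, w, y, rfl⟩ | ⟨rfl, w, x, rfl⟩ <;>
  rcases gSigma_cases hv' with ⟨w', rfl⟩ | ⟨rfl, w', y', rfl⟩ | ⟨rfl, w', x', rfl⟩ <;>
  simp only [gSigmaBr_apply, gSigmaD_apply, map_zero, LinearMap.zero_apply, smul_zero, zero_sub,
    sub_zero, add_zero, zero_add, lie_zero, zero_lie, mul_neg, neg_mul, mul_one, one_mul, zero_mul,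
    mul_zero, DGLA.neg_one_zpow_add_one,
    zpow_neg, zpow_one, zpow_zero, inv_neg_one_zpow, Prod.smul_mk, neg_zero, neg_neg, inv_neg,
    inv_one, neg_smul, one_smul, smul_neg, sub_neg_eq_add, smul_smul, DGLA.neg_one_zpow_mul_self,
    map_add, map_sub, map_neg, map_smul, d_lie, h, hs, ι_d]
  all_goals first
    | done
    | rfl
    | (refine Prod.ext ?_ (Prod.ext ?_ ?_) <;>
        simp only [Prod.fst_add, Prod.snd_add, Prod.fst_neg, Prod.snd_neg, neg_zero, neg_neg,
          add_zero, ← lie_ι, ← Forms.lie_lie, h, LinearMap.neg_apply] <;>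
        first | done | rfl | module | (rw [← lie_skew]; module) |
          linear_combination (norm := module) (-1 : ℝ) • ι_ι y y' s |
          linear_combination (norm := module) ι_ι y y' s)

set_option maxHeartbeats 1600000 in
lemma gSigma_jacobi {r : ℕ} {i j k : ℤ} {u v v' : Forms A L × L × L}
    (hu : u ∈ gSigmaPart A L r i) (hv : v ∈ gSigmaPart A L r j)
    (hv' : v' ∈ gSigmaPart A L r k) :
    gSigmaBr ((-1) ^ i) u (gSigmaBr ((-1) ^ j) v v') =
      gSigmaBr ((-1) ^ (i + j)) (gSigmaBr ((-1) ^ i) u v) v' +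
        (-1 : ℝ) ^ (i * j) • gSigmaBr ((-1) ^ j) v (gSigmaBr ((-1) ^ i) u v') := by
  rw [zpow_add₀ (by norm_num)]
  rcases gSigma_cases hu with ⟨w, rfl⟩ | ⟨rfl, w, y, rfl⟩ | ⟨rfl, w, x, rfl⟩ <;>
  rcases gSigma_cases hv with ⟨w', rfl⟩ | ⟨rfl, w', y', rfl⟩ | ⟨rfl, w', x', rfl⟩ <;>
  rcases gSigma_cases hv' with ⟨w₂, rfl⟩ | ⟨rfl, w₂, y₂, rfl⟩ | ⟨rfl, w₂, x₂, rfl⟩ <;>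
  simp only [gSigmaBr_apply, map_zero, LinearMap.zero_apply, smul_zero, zero_sub,
    sub_zero, add_zero, zero_add, lie_zero, zero_lie, mul_neg, neg_mul, mul_one, one_mul, zero_mul,
    mul_zero, zpow_neg, zpow_one, zpow_zero, inv_neg_one_zpow, Prod.smul_mk, neg_zero, neg_neg,
    inv_neg, inv_one, neg_smul, one_smul, smul_neg, sub_neg_eq_add, smul_smul,
    DGLA.neg_one_zpow_mul_self, map_add, map_sub, map_neg, map_smul]
  all_goals first
    | done
    | rfl
    | (refine Prod.ext ?_ (Prod.ext ?_ ?_) <;>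
        simp only [Prod.fst_add, Prod.snd_add, Prod.fst_neg, Prod.snd_neg, neg_zero, neg_neg,
          add_zero, zero_add, ← lie_ι, ← Forms.lie_lie, LinearMap.neg_apply, lie_neg, neg_lie,
          _root_.lie_lie, smul_sub, smul_add, smul_smul, smul_neg, DGLA.neg_one_zpow_mul_self] <;>
        first | done | rfl | module |
          linear_combination (norm := module) ι_ι y₂ y' w |
          linear_combination (norm := module) (-(-1 : ℝ) ^ j) • ι_ι y y₂ w' |
          linear_combination (norm := module) (-1 : ℝ) • ι_ι y y₂ w' |
          linear_combination (norm := module) ι_ι y y' w₂ |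
          linear_combination (norm := module) ι_ι y y' w₂ + ι_ι y y₂ w' + ι_ι y₂ y' w +
            (0 : ℝ) • ι_ι y y₂ w₂)

/-- The DGLA `𝔤_{r,σ}`. -/
def gSigma {r : ℕ} (σ : DForm A L (r + 1)) (hσ : DForm.extd σ = 0) : DGLA.{u} where
  V n := gSigmaPart A L r n
  d i j e := (gSigmaD σ.toForms).restrict (gSigmaD_mem σ e)
  br i j k e := LinearMap.mk₂ ℝ
    (fun v v' => ⟨gSigmaBr ((-1) ^ i) v.1 v'.1, gSigmaBr_mem _ e _ _ v.2 v'.2⟩)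
    (fun _ _ _ => Subtype.ext (by simp)) (fun _ _ _ => Subtype.ext (by simp))
    (fun _ _ _ => Subtype.ext (by simp)) (fun _ _ _ => Subtype.ext (by simp))
  d_d i j k hij hjk v := Subtype.ext (gSigma_d_d (d_toForms hσ) v.1)
  skew i j k h h' v z := Subtype.ext (by exact gSigma_skew v.2 z.2)
  leibniz i j k l i' j' hk hl hi hj hl₁ hl₂ v z := Subtype.ext (by
    subst hi
    exact gSigma_leibniz (d_toForms hσ) v.2 z.2)
  jacobi i j k jk ij ik n h₁ h₂ h₃ h₄ h₅ h₆ u v z := Subtype.ext (by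
    subst h₃
    exact gSigma_jacobi u.2 v.2 z.2)

/-- The Lie algebra `𝔛_{ham,σ}` of Hamiltonian vector fields: those `x` with `ι_x σ` exact. The only
exact form of degree `0` is `0`. -/
def hamiltonian {r : ℕ} (σ : DForm A L (r + 1)) (hσ : DForm.extd σ = 0) : LieSubalgebra ℝ L where
  carrier := {x | ι x σ.toForms ∈ LinearMap.range (d (A := A) (L := L))}
  add_mem' hx hy := by
    rw [Set.mem_ofPred_eq] at hx hy ⊢
    rw [map_add, LinearMap.add_apply]
    exact add_mem hx hy
  zero_mem' := by
    rw [Set.mem_ofPred_eq, map_zero, LinearMap.zero_apply]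
    exact zero_mem _
  smul_mem' c x hx := by
    rw [Set.mem_ofPred_eq] at hx ⊢
    rw [map_smul, LinearMap.smul_apply]
    exact Submodule.smul_mem _ _ hx
  lie_mem' := by
    rintro x y ⟨w, hw⟩ ⟨w', hw'⟩
    have h := cartan x σ.toForms
    rw [d_toForms hσ, map_zero, add_zero, ← hw, d_d] at h
    refine ⟨lie x w', ?_⟩
    rw [← lie_ι, ← h, map_zero, sub_zero, ← hw', d_lie]

/-- The degree-`n` part of `Trunc(Ω[r])`: forms of degree `n + r` if `n < 0`, exact forms of degree
`r` if `n = 0`, and zero if `n > 0`. -/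
def truncPart (A L : Type u) [CommRing A] [LieRing L] [Module A L] [LieRingModule L A]
    [LieRinehartRing A L] [Algebra ℝ A] [LieAlgebra ℝ L] [LieRinehartAlgebra ℝ A L]
    (r : ℕ) (n : ℤ) : Submodule ℝ (Forms A L) where
  carrier := {w | (∀ k : ℕ, (k : ℤ) ≠ n + r → w k = 0) ∧
    (n = 0 → w ∈ LinearMap.range (d (A := A) (L := L))) ∧ (0 < n → w = 0)}
  add_mem' := fun ⟨a, b, c⟩ ⟨a', b', c'⟩ => ⟨fun k hk => by simp [a k hk, a' k hk],
    fun hn => add_mem (b hn) (b' hn), fun hn => by simp [c hn, c' hn]⟩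
  zero_mem' := ⟨fun _ _ => rfl, fun _ => zero_mem _, fun _ => rfl⟩
  smul_mem' t _ := fun ⟨a, b, c⟩ => ⟨fun k hk => by simp [a k hk],
    fun hn => Submodule.smul_mem _ _ (b hn), fun hn => by simp [c hn]⟩

/-- The abelian DGLA `Trunc(Ω[r])`, i.e. the complex `Ω⁰ → Ω¹ → ⋯ → Ω^{r-1} → dΩ^{r-1}` in degrees
`-r, …, 0`. -/
def trunc (A L : Type u) [CommRing A] [LieRing L] [Module A L] [LieRingModule L A]
    [LieRinehartRing A L] [Algebra ℝ A] [LieAlgebra ℝ L] [LieRinehartAlgebra ℝ A L] (r : ℕ) :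
    DGLA.{u} where
  V n := truncPart A L r n
  d i j e := d.restrict fun w hw => by
    obtain ⟨h1, h2, h3⟩ := hw
    refine ⟨fun k hk => ?_, fun _ => ⟨w, rfl⟩, fun hj => ?_⟩
    · cases k with
      | zero => rfl
      | succ k => exact d_eq_zero (h1 k (by push_cast at hk; omega))
    · by_cases hi : i = 0
      · obtain ⟨w', rfl⟩ := h2 hi
        exact d_d w'
      · rw [h3 (by omega), map_zero]
  br _ _ _ _ := 0
  d_d _ _ _ _ _ w := Subtype.ext (d_d w.1)
  skew _ _ _ _ _ _ _ := by simp
  leibniz _ _ _ _ _ _ _ _ _ _ _ _ _ _ := by simp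
  jacobi _ _ _ _ _ _ _ _ _ _ _ _ _ _ _ _ := by simp

variable {r : ℕ} (σ : DForm A L (r + 1)) (hσ : DForm.extd σ = 0)

/-- The inclusion of `Trunc(Ω[r])` into `𝔤_{r,σ}`. -/
def truncIncl : DGLA.Hom (trunc A L r) (gSigma σ hσ) where
  map n := ((LinearMap.inl ℝ (Forms A L) (L × L)) ∘ₗ (truncPart A L r n).subtype).codRestrict
    (gSigmaPart A L r n) fun v => ⟨v.2.1, fun _ => rfl, fun _ => rfl⟩
  map_d i j e w := Subtype.ext (by
    change ((d w.1, 0, 0) : Forms A L × L × L) = gSigmaD σ.toForms (w.1, 0, 0)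
    simp [gSigmaD_apply])
  map_br i j k e w w' := Subtype.ext (by
    change (0 : Forms A L × L × L) = gSigmaBr ((-1) ^ i) (w.1, 0, 0) (w'.1, 0, 0)
    simp [gSigmaBr_apply]
    rfl)

/-- The `k`-fold contraction `(x₁, …, x_k) ↦ ι_{x₁} ∘ ⋯ ∘ ι_{x_k}`, as an alternating map. -/
def multiContr (A L : Type u) [CommRing A] [LieRing L] [Module A L] [LieRingModule L A]
    [LieRinehartRing A L] [Algebra ℝ A] [LieAlgebra ℝ L] [LieRinehartAlgebra ℝ A L] (k : ℕ) :
    L [⋀^Fin k]→ₗ[ℝ] Module.End ℝ (Forms A L) :=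
  (ExteriorAlgebra.lift ℝ ⟨(ι : L →ₗ[ℝ] Module.End ℝ (Forms A L)), fun x => LinearMap.ext fun _ =>
    funext fun _ => DForm.contr_contr_self x _⟩).toLinearMap.compAlternatingMap
      (ExteriorAlgebra.ιMulti ℝ k)

lemma multiContr_zero (x : Fin 0 → L) (w : Forms A L) : multiContr A L 0 x w = w := by
  simp [multiContr]

lemma multiContr_succ (k : ℕ) (x : Fin (k + 1) → L) (w : Forms A L) :
    multiContr A L (k + 1) x w = ι (x 0) (multiContr A L k (Fin.tail x) w) := by
  simp [multiContr, ExteriorAlgebra.ιMulti_succ_apply]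
  rfl

lemma multiContr_apply_eq_zero {N : ℕ} {w : Forms A L} (hw : ∀ j, j ≠ N → w j = 0) (k : ℕ)
    (x : Fin k → L) (j : ℕ) (hj : j + k ≠ N) : multiContr A L k x w j = 0 := by
  induction k generalizing j with
  | zero => rw [multiContr_zero]; exact hw j hj
  | succ k ih =>
    rw [multiContr_succ]
    exact ι_eq_zero (ih _ _ (by omega)) _

/-- The element `ι_∞σ` of `CE(𝔛_{ham,σ}, Trunc(Ω[r]))`, whose component of arity `k` is
`x₁, …, x_k ↦ -ι_{x₁} ⋯ ι_{x_k} σ`. -/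
def iotaInf : CE (hamiltonian σ hσ) (trunc A L r) 1 := fun a n e =>
  ((LinearMap.applyₗ (-σ.toForms)).compAlternatingMap
    ((multiContr A L (a + 1)).compLinearMap (hamiltonian σ hσ).toSubmodule.subtype)).codRestrict
      (truncPart A L r n) fun x => by
    have hx : (LinearMap.applyₗ (-σ.toForms)).compAlternatingMap
        ((multiContr A L (a + 1)).compLinearMap (hamiltonian σ hσ).toSubmodule.subtype) x =
        -multiContr A L (a + 1) (fun i => (x i : L)) σ.toForms := by
      rw [← map_neg]; rfl
    rw [hx]
    refine neg_mem ⟨fun k hk => multiContr_apply_eq_zero (N := r + 1)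
      (fun k hk => Pi.single_eq_of_ne hk _) _ _ _ (by omega), fun hn => ?_, fun hn => by omega⟩
    obtain rfl : a = 0 := by omega
    rw [multiContr_succ, multiContr_zero]
    exact (x 0).2

/-- The Lie derivative embedding `x ↦ x` of `𝔛_{ham,σ}` into the degree-`0` part of
`(𝔤_{r,σ})^{≥ 0}`; the elements `x` act on forms by Lie derivatives. -/
def lieEmb : CE (hamiltonian σ hσ) (gSigma σ hσ).nonneg 1 :=
  CE.ofLinear
    { toFun := fun x => ⟨⟨(0, 0, x.1), fun _ _ => rfl, fun _ => rfl, fun h => by simp at h⟩,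
        fun h => by simp at h⟩
      map_add' := fun x y => Subtype.ext (Subtype.ext (by
        change ((0, 0, x.1 + y.1) : Forms A L × L × L) = (0, 0, x.1) + (0, 0, y.1)
        simp))
      map_smul' := fun c x => Subtype.ext (Subtype.ext (by
        change ((0, 0, c • x.1) : Forms A L × L × L) = c • (0, 0, x.1)
        simp)) }

/-- The element `ι` of `CE(𝔛_{ham,σ}, 𝔤_{r,σ})` of degree `0`, `x ↦ x_{[1]}`. -/
def iota : CE (hamiltonian σ hσ) (gSigma σ hσ) 0 :=
  CE.ofLinear
    { toFun := fun x => ⟨(0, x.1, 0), fun _ _ => rfl, fun h => by simp at h, fun _ => rfl⟩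
      map_add' := fun x y => Subtype.ext (by
        change ((0, x.1 + y.1, 0) : Forms A L × L × L) = (0, x.1, 0) + (0, y.1, 0)
        simp)
      map_smul' := fun c x => Subtype.ext (by
        change ((0, c • x.1, 0) : Forms A L × L × L) = c • (0, x.1, 0)
        simp) }

/-- The composition `𝔛_{ham,σ} → (𝔤_{r,σ})^{≥ 0} ⊆ 𝔤_{r,σ}`. -/
def lieComp : CE (hamiltonian σ hσ) (gSigma σ hσ) 1 :=
  CE.comp (gSigma σ hσ).nonnegIncl (lieEmb σ hσ)

/-- The composition `𝔛_{ham,σ} → Trunc(Ω[r]) ⊆ 𝔤_{r,σ}`. -/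
def iotaInfComp : CE (hamiltonian σ hσ) (gSigma σ hσ) 1 :=
  CE.comp (truncIncl σ hσ) (iotaInf σ hσ)

end ClosedForm

end

noncomputable section

open scoped Polynomial TensorProduct

/-! ### Unshuffle sums and alternatization -/

section UnshuffleLemmas

open Equiv
open MultilinearMap (alternatization alternatization_apply domDomCongr_apply)

variable {L W W' : Type u} [AddCommGroup L] [Module ℝ L] [AddCommGroup W] [Module ℝ W]
  [AddCommGroup W'] [Module ℝ W']

/-! Write ξ for `iota`, ℓ for `lieComp`, c = ξ ◁ [·,·] for the map x, y ↦ [x, y]_{[1]}, M_k for the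
component of `iotaInfComp` of arity k + 1, κ = ℓ ◁ [·,·] and μ_k = M_k ◁ [·,·]. The
Chevalley–Eilenberg brackets and differentials of these elements close up on a short table,
`IsContractionSystem`: dξ = c + ℓ - M_0, [ξ, ℓ] = 2c, [ξ, c] = 0, [ξ, M_n] = (n + 2) M_{n+1},
dM_{n+1} = μ_{n+1} - μ_n, and so on. Hence the terms of the gauge series are c - ℓ + M_0, then M_1 -
c, then M_n for n ≥ 2. Adding ℓ, everything cancels except ∑ M_n = ι_∞σ, and the sum is finite
because M_n contracts an (r + 1)-form n + 1 times.

With tξ in place of ξ, the n-th term acquires the factor t^{n+1}, and d(tξ) contributes ξ dt. So H =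
A + ξ dt with A = (1 - t)ℓ + (t - t²)c + ∑ t^{n+1} M_n. The Maurer–Cartan equation of H splits into
dA + ½[A, A] = 0 for the coefficient differential and the flow equation A' = [ξ, A] - dξ; both are
polynomial identities that follow from the table. No general theorem on gauge invariance is invoked.
The Maurer–Cartan equations of ℓ and ι_∞σ are not inputs either: they result from evaluating H at t
= 0 and t = 1. `isMaurerCartan_iff_isLInftyMorphism` translates them into L∞-morphism equations, and
`isMaurerCartan_of_comp` brings them down to the sub-DGLAs.

The table itself is Cartan calculus. A Hamiltonian x satisfies L_x σ = 0, so L_x acts on iterated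
contractions of σ as a derivation in the contracted vector fields (`lie_hamContr`), and dι_x = L_x -
ι_x d yields d ∘ M_{k+1} = M_k ◁ [·,·] by induction (`d_hamContr_succ`). The relations [ℓ, c] = 0
and c ◁ [·,·] = 0 are the Jacobi identity. Unshuffle sums are handled as full alternatizations
divided by p! q!, where permuting arguments costs only a sign; the coefficients then come from
comparing factorials (`unshuffleSum_of_alternating`, `unshuffleSum_derivation`,
`eq_compBracket_of_recursion`). -/

lemma alternatization_domDomCongr {N : ℕ} (f : MultilinearMap ℝ (fun _ : Fin N => L) W)
    (σ : Perm (Fin N)) :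
    alternatization (f.domDomCongr σ) = Perm.sign σ • alternatization f := by
  ext v
  rw [AlternatingMap.smul_apply, alternatization_apply, alternatization_apply, Finset.smul_sum]
  refine Fintype.sum_equiv (Equiv.mulRight σ) _ _ fun τ => ?_
  rw [Equiv.coe_mulRight, Perm.sign_mul, smul_smul, mul_comm, mul_assoc, Int.units_mul_self,
    mul_one]
  rfl

lemma alternatization_real_smul {N : ℕ} (c : ℝ) (f : MultilinearMap ℝ (fun _ : Fin N => L) W) :
    alternatization (c • f) = c • alternatization f := by
  ext v
  simp [alternatization_apply, Finset.smul_sum, smul_comm c]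

lemma alternatization_units_smul {N : ℕ} (c : ℤˣ) (f : MultilinearMap ℝ (fun _ : Fin N => L) W) :
    alternatization (c • f) = c • alternatization f := by
  ext v
  simp [alternatization_apply, Finset.smul_sum, smul_comm c]

variable {p q N : ℕ}

lemma alternatization_blockMultilinear (h : p + q = N)
    (m : L [⋀^Fin p]→ₗ[ℝ] (L [⋀^Fin q]→ₗ[ℝ] W)) :
    alternatization (blockMultilinear h m) =
      (p.factorial * q.factorial : ℝ) • unshuffleSum h m :=
  AlternatingMap.ext fun x => alternatization_eq_smul_unshuffleSum h m x

/-- This trades the set of unshuffles, which is not a group, for the whole symmetric group, where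
sums may be reindexed by any permutation. -/
lemma unshuffleSum_eq_smul_alternatization (h : p + q = N)
    (m : L [⋀^Fin p]→ₗ[ℝ] (L [⋀^Fin q]→ₗ[ℝ] W)) :
    unshuffleSum h m =
      (p.factorial * q.factorial : ℝ)⁻¹ • alternatization (blockMultilinear h m) := by
  rw [alternatization_blockMultilinear, smul_smul, inv_mul_cancel₀ (by positivity), one_smul]

lemma alternatization_eq_factorial_smul (F : L [⋀^Fin N]→ₗ[ℝ] W) :
    alternatization (F : MultilinearMap ℝ (fun _ : Fin N => L) W) = (N.factorial : ℝ) • F := by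
  rw [AlternatingMap.coe_alternatization, Fintype.card_fin, Nat.cast_smul_eq_nsmul]

/-- When the pairing is already alternating in all arguments jointly, every unshuffle contributes
the same value, and there are N! / (p! q!) of them. -/
lemma unshuffleSum_of_alternating (h : p + q = N) (m : L [⋀^Fin p]→ₗ[ℝ] (L [⋀^Fin q]→ₗ[ℝ] W))
    (F : L [⋀^Fin N]→ₗ[ℝ] W)
    (hF : ∀ x, m (fun i => x (blockL h i)) (fun j => x (blockR h j)) = F x) :
    unshuffleSum h m = (N.choose p : ℝ) • F := by
  have e : blockMultilinear h m = (F : MultilinearMap ℝ (fun _ : Fin N => L) W) :=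
    MultilinearMap.ext hF
  subst h
  rw [unshuffleSum_eq_smul_alternatization, e, alternatization_eq_factorial_smul, smul_smul,
    Nat.cast_add_choose, div_eq_inv_mul]

lemma compAlternatingMap_unshuffleSum (h : p + q = N) (g : W →ₗ[ℝ] W')
    (m : L [⋀^Fin p]→ₗ[ℝ] (L [⋀^Fin q]→ₗ[ℝ] W)) (m' : L [⋀^Fin p]→ₗ[ℝ] (L [⋀^Fin q]→ₗ[ℝ] W'))
    (hm : ∀ x y, g (m x y) = m' x y) :
    g.compAlternatingMap (unshuffleSum h m) = unshuffleSum h m' := by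
  ext x
  simp only [LinearMap.compAlternatingMap_apply, unshuffleSum_apply, map_sum, ← hm]
  refine Finset.sum_congr rfl fun τ _ => ?_
  simp only [Units.smul_def, map_zsmul]

lemma unshuffleSum_add (h : p + q = N) (m m' : L [⋀^Fin p]→ₗ[ℝ] (L [⋀^Fin q]→ₗ[ℝ] W)) :
    unshuffleSum h (m + m') = unshuffleSum h m + unshuffleSum h m' := by
  ext x
  simp [unshuffleSum_apply, Finset.sum_add_distrib]

lemma unshuffleSum_smul (h : p + q = N) (c : ℝ) (m : L [⋀^Fin p]→ₗ[ℝ] (L [⋀^Fin q]→ₗ[ℝ] W)) :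
    unshuffleSum h (c • m) = c • unshuffleSum h m := by
  ext x
  simp [unshuffleSum_apply, Finset.smul_sum, smul_comm c]

lemma unshuffleSum_zero (h : p + q = N) :
    unshuffleSum h (0 : L [⋀^Fin p]→ₗ[ℝ] (L [⋀^Fin q]→ₗ[ℝ] W)) = 0 := by
  ext x
  simp [unshuffleSum_apply]

lemma unshuffleSum_apply_eq_zero (h : p + q = N) (m : L [⋀^Fin p]→ₗ[ℝ] (L [⋀^Fin q]→ₗ[ℝ] W))
    (hm : ∀ x y, m x y = 0) : unshuffleSum h m = 0 := by
  rw [show m = 0 from AlternatingMap.ext fun x => AlternatingMap.ext fun y => hm x y,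
    unshuffleSum_zero]

lemma finRotate_pow_apply (n k : ℕ) (i : Fin (n + 1)) :
    ((finRotate (n + 1) ^ k) i : ℕ) = (i + k) % (n + 1) := by
  induction k with
  | zero => simp [Nat.mod_eq_of_lt i.2]
  | succ k ih =>
    rw [pow_succ', Perm.mul_apply, finRotate_apply, Fin.val_add, ih]
    rw [Fin.val_one', ← Nat.add_mod, add_assoc]

/-- Exchanging a block of length p with one of length q is a permutation of sign (-1)^{pq}. It is
realized as the p-th power of the long cycle. -/
lemma unshuffleSum_comm (h : p + q = N) (h' : q + p = N)
    (m : L [⋀^Fin p]→ₗ[ℝ] (L [⋀^Fin q]→ₗ[ℝ] W)) (m' : L [⋀^Fin q]→ₗ[ℝ] (L [⋀^Fin p]→ₗ[ℝ] W))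
    (hm : ∀ x y, m x y = m' y x) :
    unshuffleSum h m = (-1 : ℝ) ^ (p * q) • unshuffleSum h' m' := by
  -- The long cycle needs a nonempty index set; for N = 0 both blocks are empty.
  rcases N with _ | n
  · obtain rfl : p = 0 := by omega
    obtain rfl : q = 0 := by omega
    rw [zero_mul, pow_zero, one_smul]
    ext x
    rw [unshuffleSum_apply, unshuffleSum_apply]
    refine Finset.sum_congr rfl fun τ _ => ?_
    rw [hm]
    congr 1
    exact congrArg₂ (fun y z => m' y z) (Subsingleton.elim _ _) (Subsingleton.elim _ _)
  · have e : blockMultilinear h m =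
        (blockMultilinear h' m').domDomCongr (finRotate (n + 1) ^ p) := by
      ext x
      have h1 : ∀ j, (finRotate (n + 1) ^ p) (blockL h' j) = blockR h j := fun j => by
        ext
        rw [finRotate_pow_apply, Nat.mod_eq_of_lt]
        · simp [blockL, blockR, add_comm]
        · simp [blockL]; omega
      have h2 : ∀ i, (finRotate (n + 1) ^ p) (blockR h' i) = blockL h i := fun i => by
        ext
        rw [finRotate_pow_apply]
        simp only [blockL, blockR, Fin.val_cast, Fin.val_natAdd, Fin.val_castAdd]
        rw [show q + (i : ℕ) + p = i + (n + 1) by omega, Nat.add_mod_right,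
          Nat.mod_eq_of_lt (by omega)]
      rw [blockMultilinear_apply, hm, domDomCongr_apply, blockMultilinear_apply]
      exact congrArg₂ (fun y z => m' y z) (funext fun j => congrArg x (h1 j).symm)
        (funext fun i => congrArg x (h2 i).symm)
    -- A cycle of length p + q has sign (-1)^{p+q-1}. Its p-th power has exponent p(p - 1) + pq, in
    -- which p(p - 1) is even.
    have hs : (Perm.sign (finRotate (n + 1) ^ p)) = (-1) ^ (p * q) := by
      rw [map_pow, sign_finRotate, ← pow_mul]
      rcases p with _ | p
      · simp
      · rw [show n + 1 - 1 = p + q by omega, add_mul, mul_comm (p + 1) q, pow_add]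
        simp [Even.neg_one_pow (Nat.even_mul_succ_self p)]
    rw [unshuffleSum_eq_smul_alternatization, unshuffleSum_eq_smul_alternatization, e,
      alternatization_domDomCongr, hs, smul_comm, mul_comm (q.factorial : ℝ)]
    rcases neg_one_pow_eq_or ℤ (p * q) with h0 | h0
    · have hu : (-1 : ℤˣ) ^ (p * q) = 1 := by ext; simpa using h0
      have hr : (-1 : ℝ) ^ (p * q) = 1 := by exact_mod_cast h0
      rw [hu, hr, one_smul, one_smul]
    · have hu : (-1 : ℤˣ) ^ (p * q) = -1 := by ext; simpa using h0
      have hr : (-1 : ℝ) ^ (p * q) = -1 := by exact_mod_cast h0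
      rw [hu, hr, Units.neg_smul, neg_smul, one_smul, one_smul]

end UnshuffleLemmas

/-! ### Composition with the Lie bracket, as an alternatization. -/

section CompBracketLemmas

open Equiv
open MultilinearMap (alternatization alternatization_apply domDomCongr_apply)

variable {L W W' : Type u} [LieRing L] [LieAlgebra ℝ L] [AddCommGroup W] [Module ℝ W]
  [AddCommGroup W'] [Module ℝ W']

/-- The multilinear map `(x₀, …, x_{a + 1}) ↦ f([x₀, x₁], x₂, …, x_{a + 1})`. -/
def bracketMultilinear {a : ℕ} (f : L [⋀^Fin (a + 1)]→ₗ[ℝ] W) :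
    MultilinearMap ℝ (fun _ : Fin (a + 2) => L) W :=
  blockMultilinear (Nat.add_comm 2 a) (f.curryLeft.compAlternatingMap (lieAlt L))

lemma bracketMultilinear_cons {a : ℕ} (f : L [⋀^Fin (a + 1)]→ₗ[ℝ] W) (x y : L) (v : Fin a → L) :
    bracketMultilinear f (Fin.cons x (Fin.cons y v)) = f (Fin.cons ⁅x, y⁆ v) := by
  rw [bracketMultilinear, blockMultilinear_apply]
  change f (Matrix.vecCons _ _) = _
  congr 1
  ext j
  cases j using Fin.cases with
  | zero =>
    simp only [Matrix.cons_val_zero, lieAlt_apply, Fin.cons_zero]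
    rfl
  | succ j =>
    simp only [Matrix.cons_val_succ, Fin.cons_succ]
    rw [show blockR (Nat.add_comm 2 a) j = j.succ.succ from Fin.ext (Nat.add_comm 2 j)]
    simp

lemma alternatization_bracketMultilinear {a : ℕ} (f : L [⋀^Fin (a + 1)]→ₗ[ℝ] W) :
    alternatization (bracketMultilinear f) = (2 * a.factorial : ℝ) • compBracket f := by
  rw [bracketMultilinear, alternatization_blockMultilinear]
  norm_num [compBracket]

lemma compBracket_eq {a : ℕ} (f : L [⋀^Fin (a + 1)]→ₗ[ℝ] W) :
    compBracket f = (2 * a.factorial : ℝ)⁻¹ • alternatization (bracketMultilinear f) := by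
  rw [alternatization_bracketMultilinear, smul_smul, inv_mul_cancel₀ (by positivity), one_smul]

/-- There is exactly one (2, 0)-unshuffle, so the bracket occurs once and without a factor. -/
lemma compBracket_arity_one (f : L [⋀^Fin 1]→ₗ[ℝ] W) (x : Fin 2 → L) :
    compBracket f x = f ![⁅x 0, x 1⁆] := by
  have : compBracket f = ((Nat.choose 2 2 : ℕ) : ℝ) •
      ((AlternatingMap.ofSubsingleton ℝ L W (0 : Fin 1)).symm f).compAlternatingMap (lieAlt L) :=
    unshuffleSum_of_alternating _ _ _ fun x => by
      change f (Matrix.vecCons _ _) = f _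
      congr 1
      ext j
      fin_cases j
      rfl
  rw [this, Nat.choose_self, Nat.cast_one, one_smul]
  change f _ = f _
  congr 1
  ext j
  fin_cases j
  rfl

lemma compAlternatingMap_compBracket {a : ℕ} (g : W →ₗ[ℝ] W') (f : L [⋀^Fin (a + 1)]→ₗ[ℝ] W) :
    g.compAlternatingMap (compBracket f) = compBracket (g.compAlternatingMap f) :=
  compAlternatingMap_unshuffleSum _ _ _ _ fun _ _ => rfl

lemma compBracket_add {a : ℕ} (f g : L [⋀^Fin (a + 1)]→ₗ[ℝ] W) :
    compBracket (f + g) = compBracket f + compBracket g := by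
  rw [compBracket, compBracket, compBracket, ← unshuffleSum_add]
  congr 1

lemma compBracket_smul {a : ℕ} (c : ℝ) (f : L [⋀^Fin (a + 1)]→ₗ[ℝ] W) :
    compBracket (c • f) = c • compBracket f := by
  rw [compBracket, compBracket, ← unshuffleSum_smul]
  congr 1

/-- The multilinear map `(x, y₀, …, y_a) ↦ ∑_j f(y₀, …, [x, y_j], …, y_a)`. -/
def derivationMultilinear {a : ℕ} (f : L [⋀^Fin (a + 1)]→ₗ[ℝ] W) :
    MultilinearMap ℝ (fun _ : Fin (a + 2) => L) W :=
  ∑ j : Fin (a + 1), Perm.sign (swap 0 j) •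
    (bracketMultilinear f).domDomCongr (blockPerm (Nat.add_comm 1 (a + 1)) 1 (swap 0 j))

lemma blockPerm_one_zero {a : ℕ} (σ : Perm (Fin (a + 1))) :
    blockPerm (Nat.add_comm 1 (a + 1)) 1 σ 0 = 0 :=
  blockPerm_blockL (Nat.add_comm 1 (a + 1)) 1 σ 0

lemma blockPerm_one_succ {a : ℕ} (σ : Perm (Fin (a + 1))) (j : Fin (a + 1)) :
    blockPerm (Nat.add_comm 1 (a + 1)) 1 σ j.succ = (σ j).succ := by
  have e : ∀ j, blockR (Nat.add_comm 1 (a + 1)) j = Fin.succ j := fun j => by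
    ext; simp [blockR, add_comm]
  rw [← e, ← e, blockPerm_blockR]

lemma cons_comp_blockPerm_one {a : ℕ} (σ : Perm (Fin (a + 1))) (x : L) (y : Fin (a + 1) → L) :
    (fun i => (Fin.cons x y : Fin (a + 2) → L) (blockPerm (Nat.add_comm 1 (a + 1)) 1 σ i)) =
      Fin.cons x (y ∘ σ) := by
  ext i
  cases i using Fin.cases with
  | zero => rw [blockPerm_one_zero]; rfl
  | succ i => rw [blockPerm_one_succ]; rfl

/-- Each summand of the derivation action is a permuted copy of `bracketMultilinear f`: the
transposition of 0 and j brings [x, y_j] to the front. The sign in the definition undoes the sign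
that f produces when the bracket is put back in place. -/
lemma derivationMultilinear_cons {a : ℕ} (f : L [⋀^Fin (a + 1)]→ₗ[ℝ] W) (x : L)
    (y : Fin (a + 1) → L) :
    derivationMultilinear f (Fin.cons x y) = ∑ j, f (Function.update y j ⁅x, y j⁆) := by
  rw [derivationMultilinear, sum_apply]
  refine Finset.sum_congr rfl fun j _ => ?_
  rw [smul_apply, domDomCongr_apply, cons_comp_blockPerm_one,
    ← Fin.cons_self_tail (y ∘ swap 0 j), bracketMultilinear_cons, eq_comm, ← inv_smul_eq_iff,
    Int.units_inv_eq_self, ← AlternatingMap.map_perm]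
  congr 1
  ext i
  cases i using Fin.cases with
  | zero => simp
  | succ i =>
    simp only [Function.comp_apply, Fin.cons_succ, Fin.tail]
    rw [Function.update_of_ne]
    intro h
    have := congrArg (swap 0 j) h
    simp at this

/-- In each of the a + 1 summands the sign of the transposition appears twice and cancels, so all
have the alternatization of `bracketMultilinear f`, which is 2 a! times `compBracket f`. -/
lemma alternatization_derivationMultilinear {a : ℕ} (f : L [⋀^Fin (a + 1)]→ₗ[ℝ] W) :
    alternatization (derivationMultilinear f) =
      (2 * (a + 1).factorial : ℝ) • compBracket f := by
  rw [derivationMultilinear, map_sum]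
  simp only [alternatization_units_smul, alternatization_domDomCongr, sign_blockPerm, map_one,
    one_mul, smul_smul, Int.units_mul_self, one_smul]
  rw [Finset.sum_const, Finset.card_univ, Fintype.card_fin, alternatization_bracketMultilinear,
    ← Nat.cast_smul_eq_nsmul ℝ, smul_smul, Nat.factorial_succ]
  congr 1
  push_cast
  ring

/-- The alternating sum of a derivation action is twice the composition with the bracket. -/
lemma unshuffleSum_derivation {a : ℕ} (h : 1 + (a + 1) = a + 2) (f : L [⋀^Fin (a + 1)]→ₗ[ℝ] W)
    (m : L [⋀^Fin 1]→ₗ[ℝ] (L [⋀^Fin (a + 1)]→ₗ[ℝ] W))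
    (hm : ∀ x y, m x y = ∑ j, f (Function.update y j ⁅x 0, y j⁆)) :
    unshuffleSum h m = (2 : ℝ) • compBracket f := by
  have e : blockMultilinear h m = derivationMultilinear f := by
    ext x
    rw [blockMultilinear_apply, hm, ← Fin.cons_self_tail x, derivationMultilinear_cons]
    have e : ∀ j, blockR h j = Fin.succ j := fun j => by
      ext; simp [blockR, add_comm]
    simp only [e, Fin.cons_succ]
    rfl
  -- The factor 2 is the quotient of 2 (a + 1)! by 1! (a + 1)!. Each pair of arguments is bracketed
  -- twice, with either of the two as the acting one.
  rw [unshuffleSum_eq_smul_alternatization, e, alternatization_derivationMultilinear, smul_smul]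
  congr 1
  have : ((a + 1).factorial : ℝ) ≠ 0 := by positivity
  simp only [Nat.factorial_one, Nat.cast_one, one_mul]
  field_simp

/-- The recursion `D f'(x, y) = ∑_j f(…, [x, y_j], …) - ι_x (f₀ ◁ [·,·])(y)`, where `f = ι f₀`,
determines an alternating map as `f ◁ [·,·]`. -/
lemma eq_compBracket_of_recursion {a : ℕ} (f₀ : L [⋀^Fin (a + 1)]→ₗ[ℝ] W)
    (f : L [⋀^Fin (a + 2)]→ₗ[ℝ] W) (F : L [⋀^Fin (a + 3)]→ₗ[ℝ] W) (i : L → W →ₗ[ℝ] W)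
    (hf : ∀ x y, f (Fin.cons x y) = i x (f₀ y))
    (hF : ∀ x y, F (Fin.cons x y) =
      ∑ j, f (Function.update y j ⁅x, y j⁆) - i x (compBracket f₀ y)) :
    F = compBracket f := by
  -- The 3-cycle that turns (x, z, z', w) into (z, z', x, w); being even, it does not affect
  -- alternatizations.
  set c : Perm (Fin (a + 3)) := swap 0 1 * swap 1 2 with hc
  have hcs : Perm.sign c = 1 := by
    rw [hc, map_mul, Perm.sign_swap (by simp), Perm.sign_swap (by
      rw [Ne, Fin.ext_iff]; simp [Nat.mod_eq_of_lt])]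
    rfl
  -- Both parts of the recursion are written through permuted copies of `bracketMultilinear f`, the
  -- second by expanding f₀ ◁ [·,·] as a sum over all permutations of y. The alternatization of F
  -- thereby becomes a multiple of f ◁ [·,·].
  have e : (F : MultilinearMap ℝ (fun _ : Fin (a + 3) => L) W) = derivationMultilinear f +
      (2 * a.factorial : ℝ)⁻¹ • ∑ σ : Perm (Fin (a + 2)), Perm.sign σ •
        ((bracketMultilinear f).domDomCongr c).domDomCongr
          (blockPerm (Nat.add_comm 1 (a + 2)) 1 σ) := by
    ext x
    obtain ⟨x, y, rfl⟩ : ∃ x' y, x = Fin.cons x' y := ⟨x 0, Fin.tail x, (Fin.cons_self_tail x).symm⟩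
    rw [AlternatingMap.coe_multilinearMap, hF, add_apply,
      derivationMultilinear_cons, sub_eq_add_neg]
    congr 1
    rw [compBracket_eq, AlternatingMap.smul_apply, alternatization_apply, map_smul, map_sum,
      smul_apply, sum_apply, ← smul_neg, ← Finset.sum_neg_distrib]
    congr 1
    refine Finset.sum_congr rfl fun σ _ => ?_
    rw [smul_apply, Units.smul_def, map_zsmul, ← smul_neg, Units.smul_def]
    congr 1
    change -(i x (bracketMultilinear f₀ (y ∘ σ))) = bracketMultilinear f (fun j => (fun k =>
      (Fin.cons x y : Fin (a + 3) → L) (blockPerm (Nat.add_comm 1 (a + 2)) 1 σ k)) (c j))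
    rw [cons_comp_blockPerm_one]
    obtain ⟨z, z', w, hz⟩ : ∃ z z' w, y ∘ σ = Fin.cons z (Fin.cons z' w) :=
      ⟨_, _, _, by rw [Fin.cons_self_tail, Fin.cons_self_tail]⟩
    rw [hz, bracketMultilinear_cons, ← hf]
    have hx : (fun j => (Fin.cons x (Fin.cons z (Fin.cons z' w)) : Fin (a + 3) → L) (c j)) =
        Fin.cons z (Fin.cons z' (Fin.cons x w)) := by
      ext j
      rw [hc, Perm.mul_apply]
      cases j using Fin.cases with
      | zero =>
        rw [show swap (1 : Fin (a + 3)) 2 0 = 0 from swap_apply_of_ne_of_ne (by simp)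
          (by rw [Ne, Fin.ext_iff]; simp [Nat.mod_eq_of_lt]), swap_apply_left]
        rfl
      | succ j =>
        cases j using Fin.cases with
        | zero =>
          rw [show (Fin.succ 0 : Fin (a + 3)) = 1 from rfl, swap_apply_left,
            swap_apply_of_ne_of_ne (by rw [Ne, Fin.ext_iff]; simp [Nat.mod_eq_of_lt])
              (by rw [Ne, Fin.ext_iff]; simp [Nat.mod_eq_of_lt])]
          rfl
        | succ j =>
          cases j using Fin.cases with
          | zero =>
            rw [show (Fin.succ (Fin.succ 0) : Fin (a + 3)) = 2 from rfl, swap_apply_right,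
              swap_apply_right]
            rfl
          | succ j =>
            rw [swap_apply_of_ne_of_ne (a := 1), swap_apply_of_ne_of_ne]
            · simp
            all_goals
              rw [Ne, Fin.ext_iff]
              simp [Nat.mod_eq_of_lt]
    rw [hx, bracketMultilinear_cons]
    -- Interchanging x and [z, z'] produces the minus sign that compensates for the one in `hF`.
    have hsw : (Fin.cons x (Fin.cons ⁅z, z'⁆ w) : Fin (a + 2) → L) =
        Fin.cons ⁅z, z'⁆ (Fin.cons x w) ∘ swap 0 1 := by
      ext j
      cases j using Fin.cases with
      | zero => simp
      | succ j =>
        cases j using Fin.cases with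
        | zero => simp
        | succ j =>
          rw [Function.comp_apply, swap_apply_of_ne_of_ne]
          · simp
          all_goals
            rw [Ne, Fin.ext_iff]
            simp [Nat.mod_eq_of_lt]
    rw [hsw, AlternatingMap.map_swap _ _ (by simp), neg_neg]
  -- On the left F is multiplied by (a + 3)!. On the right the coefficient of f ◁ [·,·] is 2 (a +
  -- 2)! + (a + 2)! · 2 (a + 1)! / (2 a!) = (a + 2)! (2 + a + 1), which is the same number.
  have h := congrArg alternatization e
  rw [alternatization_eq_factorial_smul, map_add, alternatization_derivationMultilinear,
    alternatization_real_smul, map_sum] at h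
  simp only [alternatization_units_smul, alternatization_domDomCongr, sign_blockPerm, map_one,
    one_mul, hcs, smul_smul, Int.units_mul_self, one_smul] at h
  rw [Finset.sum_const, Finset.card_univ, Fintype.card_perm, Fintype.card_fin,
    alternatization_bracketMultilinear, ← Nat.cast_smul_eq_nsmul ℝ, smul_smul, smul_smul,
    ← add_smul] at h
  have hne : ((a + 3).factorial : ℝ) ≠ 0 := by positivity
  refine smul_right_injective _ hne (h.trans ?_)
  congr 1
  have : (a.factorial : ℝ) ≠ 0 := by positivity
  simp only [Nat.factorial_succ]
  push_cast
  field_simp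
  ring

/-- Cyclic permutations of three arguments are even, so three times the alternatization is the
alternatization of the cyclic sum. This is the form in which the Jacobi identity is used. -/
lemma alternatization_eq_zero_of_cyclic (B : MultilinearMap ℝ (fun _ : Fin 3 => L) W)
    (hB : ∀ x y z, B ![x, y, z] + B ![y, z, x] + B ![z, x, y] = 0) : alternatization B = 0 := by
  have e : B + B.domDomCongr (finRotate 3) + B.domDomCongr (finRotate 3 ^ 2) = 0 := by
    ext v
    have h := hB (v 0) (v 1) (v 2)
    simp only [add_apply, domDomCongr_apply, zero_apply]
    convert h using 3 <;> congr 1 <;> ext i <;> fin_cases i <;> rfl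
  have h := congrArg alternatization e
  rw [map_add, map_add, alternatization_domDomCongr, alternatization_domDomCongr, map_pow,
    sign_finRotate, map_zero] at h
  norm_num at h
  have h3 : (3 : ℝ) • alternatization B = 0 := by
    linear_combination (norm := module) h
  exact (smul_eq_zero.1 h3).resolve_left (by norm_num)

end CompBracketLemmas

/-! ### Calculus in the Chevalley–Eilenberg DGLA -/

lemma compAlternatingMap_sum {ι : Type*} {V W W' : Type u} [AddCommGroup V] [Module ℝ V]
    [AddCommGroup W] [Module ℝ W] [AddCommGroup W'] [Module ℝ W'] {k : ℕ} (φ : W →ₗ[ℝ] W')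
    (s : Finset ι) (f : ι → V [⋀^Fin k]→ₗ[ℝ] W) :
    φ.compAlternatingMap (∑ i ∈ s, f i) = ∑ i ∈ s, φ.compAlternatingMap (f i) := by
  classical
  induction s using Finset.induction_on with
  | empty => ext; simp
  | insert i s hi ih => rw [Finset.sum_insert hi, Finset.sum_insert hi, ← ih]; ext; simp

lemma compAlternatingMap_smul {V W W' : Type u} [AddCommGroup V] [Module ℝ V]
    [AddCommGroup W] [Module ℝ W] [AddCommGroup W'] [Module ℝ W'] {k : ℕ} (φ : W →ₗ[ℝ] W')
    (c : ℝ) (f : V [⋀^Fin k]→ₗ[ℝ] W) :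
    φ.compAlternatingMap (c • f) = c • φ.compAlternatingMap f := by
  ext; simp

namespace CE

variable {L : Type u} [LieRing L] [LieAlgebra ℝ L] {g h : DGLA.{u}} {n m p q : ℤ}

@[ext] lemma ext_apply {f f' : CE L h n} (H : ∀ a d e, f a d e = f' a d e) : f = f' :=
  funext fun a => funext fun d => funext fun e => H a d e

lemma add_apply' (f f' : CE L h n) (a : ℕ) (d : ℤ) (e) : (f + f') a d e = f a d e + f' a d e := rfl

lemma sub_apply' (f f' : CE L h n) (a : ℕ) (d : ℤ) (e) : (f - f') a d e = f a d e - f' a d e := by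
  rw [sub_eq_add_neg, sub_eq_add_neg]; rfl

lemma neg_apply' (f : CE L h n) (a : ℕ) (d : ℤ) (e) : (-f) a d e = -f a d e := rfl

lemma smul_apply' (c : ℝ) (f : CE L h n) (a : ℕ) (d : ℤ) (e) : (c • f) a d e = c • f a d e := rfl

lemma zero_apply' (a : ℕ) (d : ℤ) (e) : (0 : CE L h n) a d e = 0 := rfl

lemma sum_apply' {I : Type*} (s : Finset I) (f : I → CE L h n) (a : ℕ) (d : ℤ) (e) :
    (∑ i ∈ s, f i) a d e = ∑ i ∈ s, f i a d e := by
  classical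
  induction s using Finset.induction_on with
  | empty => rw [Finset.sum_empty, Finset.sum_empty, zero_apply']
  | insert i s hi ih => rw [Finset.sum_insert hi, Finset.sum_insert hi, add_apply', ih]

/-- The composition `f ◁ [·,·]`, as an element of `CE(L, h)`. -/
def compBr (e : n + 1 = m) (f : CE L h n) : CE L h m
  | 0, _, _ => 0
  | a + 1, d, e' => compBracket (f a d (by push_cast at e'; omega))

/-- The composition `d_h ∘ f`, as an element of `CE(L, h)`. -/
def dComp (e : n + 1 = m) (f : CE L h n) : CE L h m := fun a d _ =>
  (h.d (d - 1) d (by omega)).compAlternatingMap (f a (d - 1) (by omega))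

/-- The sign depends on the arity and the internal degree only through the total degree n, so it is
a global factor and the two parts of the differential can be computed separately. -/
lemma d_eq (e : n + 1 = m) (f : CE L h n) :
    CE.d e f = compBr e f - (-1 : ℝ) ^ (n - 1) • dComp e f := by
  ext1 a d e'
  rw [sub_apply', smul_apply']
  cases a with
  | zero => rw [compBr, zero_sub, ← neg_smul]; rfl
  | succ a => rfl

lemma compBr_add (e : n + 1 = m) (f f' : CE L h n) :
    compBr e (f + f') = compBr e f + compBr e f' := by
  ext1 a d e'
  rw [add_apply']
  cases a with
  | zero => exact (add_zero _).symm
  | succ a => exact compBracket_add _ _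

lemma compBr_smul (e : n + 1 = m) (c : ℝ) (f : CE L h n) : compBr e (c • f) = c • compBr e f := by
  ext1 a d e'
  rw [smul_apply']
  cases a with
  | zero => exact (smul_zero _).symm
  | succ a => exact compBracket_smul _ _

/-- The differential of `CE(L, h)` as a linear map. -/
def dLin (e : n + 1 = m) : CE L h n →ₗ[ℝ] CE L h m where
  toFun := CE.d e
  map_add' f f' := by
    have h1 : dComp e (f + f') = dComp e f + dComp e f' := by
      ext a d e' x
      exact (h.d _ _ _).map_add _ _
    rw [d_eq, d_eq, d_eq, h1, compBr_add]
    module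
  map_smul' c f := by
    have h1 : dComp e (c • f) = c • dComp e f := by
      ext a d e' x
      exact (h.d _ _ _).map_smul _ _
    rw [d_eq, d_eq, h1, compBr_smul, RingHom.id_apply]
    module

lemma dLin_apply (e : n + 1 = m) (f : CE L h n) : dLin e f = CE.d e f := rfl

/-- The alternating map `[·,·]_h ∘ (f ⊗ g) ∘ P` for components `f` and `g` of given arities. -/
def brTerm (f : CE L h p) (g : CE L h q) (i j : ℕ) {a : ℕ} {di dj d : ℤ}
    (hi : (i : ℤ) + 1 + di = p) (hj : (j : ℤ) + 1 + dj = q) (ha : i + 1 + (j + 1) = a + 1)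
    (hd : di + dj = d) : L [⋀^Fin (a + 1)]→ₗ[ℝ] h.V d :=
  unshuffleSum ha (pairAlt (h.br di dj d hd) (f i di hi) (g j dj hj))

/-- The arity of f determines the other arity and both degrees, but different sums produce different
expressions for them. This identifies the corresponding terms without casts. -/
lemma brTerm_congr (f : CE L h p) (g : CE L h q) {i j i' j' a : ℕ} {di dj di' dj' d : ℤ}
    {hi : (i : ℤ) + 1 + di = p} {hj : (j : ℤ) + 1 + dj = q} {ha : i + 1 + (j + 1) = a + 1}
    {hd : di + dj = d} {hi' : (i' : ℤ) + 1 + di' = p} {hj' : (j' : ℤ) + 1 + dj' = q}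
    {ha' : i' + 1 + (j' + 1) = a + 1} {hd' : di' + dj' = d} (e : i = i') :
    brTerm f g i j hi hj ha hd = brTerm f g i' j' hi' hj' ha' hd' := by
  subst e
  obtain rfl : j = j' := by omega
  obtain rfl : di = di' := by omega
  obtain rfl : dj = dj' := by omega
  rfl

lemma br_apply (e : p + q = n) (f : CE L h p) (g : CE L h q) (a : ℕ) (d : ℤ) (e') :
    br e f g a d e' = ∑ i : Fin a, -(-1 : ℝ) ^ ((p - (i + 1)) * q) •
      brTerm f g i (a - 1 - i) (di := p - (i + 1)) (dj := q - (a - i)) (by omega) (by omega)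
        (by omega) (by omega) := rfl

section

variable {i j a : ℕ} {di dj d : ℤ} (hi : (i : ℤ) + 1 + di = p) (hj : (j : ℤ) + 1 + dj = q)
  (ha : i + 1 + (j + 1) = a + 1) (hd : di + dj = d)

lemma brTerm_add_left (f f' : CE L h p) (g : CE L h q) :
    brTerm (f + f') g i j hi hj ha hd = brTerm f g i j hi hj ha hd + brTerm f' g i j hi hj ha hd := by
  rw [brTerm, brTerm, brTerm, ← unshuffleSum_add]
  congr 1
  ext x y
  simp [add_apply']

lemma brTerm_add_right (f : CE L h p) (g g' : CE L h q) :
    brTerm f (g + g') i j hi hj ha hd = brTerm f g i j hi hj ha hd + brTerm f g' i j hi hj ha hd := by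
  rw [brTerm, brTerm, brTerm, ← unshuffleSum_add]
  congr 1
  ext x y
  simp [add_apply']

lemma brTerm_smul_left (c : ℝ) (f : CE L h p) (g : CE L h q) :
    brTerm (c • f) g i j hi hj ha hd = c • brTerm f g i j hi hj ha hd := by
  rw [brTerm, brTerm, ← unshuffleSum_smul]
  congr 1
  ext x y
  simp [smul_apply']

lemma brTerm_smul_right (c : ℝ) (f : CE L h p) (g : CE L h q) :
    brTerm f (c • g) i j hi hj ha hd = c • brTerm f g i j hi hj ha hd := by
  rw [brTerm, brTerm, ← unshuffleSum_smul]
  congr 1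
  ext x y
  simp [smul_apply']

end

/-- The bracket of `CE(L, h)` as a bilinear map. -/
def brLin (e : p + q = n) : CE L h p →ₗ[ℝ] CE L h q →ₗ[ℝ] CE L h n :=
  LinearMap.mk₂ ℝ (br e)
    (fun _ _ _ => by
      ext1 a d e'
      simp only [br_apply, add_apply', brTerm_add_left, smul_add, Finset.sum_add_distrib])
    (fun c _ _ => by
      ext1 a d e'
      simp only [br_apply, smul_apply', brTerm_smul_left, Finset.smul_sum, smul_comm c])
    (fun _ _ _ => by
      ext1 a d e'
      simp only [br_apply, add_apply', brTerm_add_right, smul_add, Finset.sum_add_distrib])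
    (fun c _ _ => by
      ext1 a d e'
      simp only [br_apply, smul_apply', brTerm_smul_right, Finset.smul_sum, smul_comm c])

lemma brLin_apply (e : p + q = n) (f : CE L h p) (g : CE L h q) : brLin e f g = br e f g := rfl

lemma brTerm_comm (f : CE L h p) (g : CE L h q) {i j a : ℕ} {di dj d : ℤ}
    (hi : (i : ℤ) + 1 + di = p) (hj : (j : ℤ) + 1 + dj = q) (ha : i + 1 + (j + 1) = a + 1)
    (hd : di + dj = d) :
    brTerm f g i j hi hj ha hd = (-(-1 : ℝ) ^ (di * dj) * (-1) ^ ((i + 1) * (j + 1))) •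
      brTerm g f j i hj hi (by omega) (by omega) := by
  rw [mul_comm, ← smul_smul, brTerm, unshuffleSum_comm ha (by omega) _
    (-(-1 : ℝ) ^ (di * dj) • pairAlt (h.br dj di d (by omega)) (g j dj hj) (f i di hi)),
    unshuffleSum_smul]
  · rfl
  · intro x y
    exact h.skew _ _ _ _ _ _ _

/-- The bracket is symmetric on elements of degree `1`. -/
lemma br_comm (e : (1 : ℤ) + 1 = n) (f g : CE L h 1) : br e f g = br e g f := by
  ext1 a d e'
  rw [br_apply, br_apply]
  -- Reversing the summation index exchanges the arities of the two arguments.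
  refine Fintype.sum_equiv Fin.revPerm _ _ fun i => ?_
  rw [brTerm_comm, smul_smul]
  have hi : ((Fin.rev i : Fin a) : ℤ) = a - 1 - i := by
    rw [Fin.val_rev]; omega
  refine congrArg₂ (· • ·) ?_ (brTerm_congr g f (by rw [Fin.revPerm_apply, Fin.val_rev]; omega))
  rw [Fin.revPerm_apply, hi]
  -- Now the two factors have arities i + 1, k + 1 and degrees -i, -k. The sign -(-1)^{ik} of
  -- skew-symmetry times the block sign (-1)^{(i+1)(k+1)} is (-1)^{i+k}, and this converts the
  -- prefactor of one summand into that of the other.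
  obtain ⟨k, hk⟩ : ∃ k : ℕ, a = i + k + 1 := ⟨a - 1 - i, by omega⟩
  have e1 : (a : ℤ) - 1 - i = k := by omega
  have e2 : (a : ℤ) - i = k + 1 := by omega
  have e3 : a - 1 - i = k := by omega
  rw [e1, e2, e3, mul_one, mul_one]
  have e4 : ∀ x : ℤ, (1 - (x + 1)) = -x := fun x => by ring
  rw [e4, e4, neg_mul_neg, zpow_neg, zpow_neg]
  have e5 : ∀ j : ℕ, (-1 : ℝ) ^ (j : ℤ) = (-1) ^ j := fun j => zpow_natCast _ _
  have e7 : ∀ j : ℕ, ((-1 : ℝ) ^ j)⁻¹ = (-1) ^ j := fun j => by rw [← inv_pow, inv_neg, inv_one]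
  rw [e5, e5, ← Nat.cast_mul, e5, e7, e7, add_mul, mul_add]
  have e6 : ∀ j : ℕ, (-1 : ℝ) ^ j * (-1) ^ j = 1 := fun j => by
    rw [← mul_pow]; simp
  simp only [mul_one, one_mul, pow_add, pow_one]
  linear_combination (-(-1 : ℝ) ^ (i : ℕ) * (-1) ^ (i : ℕ) * (-1) ^ k) * e6 (i * k) -
    (-1 : ℝ) ^ k * e6 i

/-- The two equations agree arity by arity: for an element of degree 1 the sign in front of d_h is
(-1)^0, and the bracket prefactor is -(-1)^{-i}. In total degree 2 the arity fixes the internal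
degree, so arity 1 (degree 1) and the arities a + 2 (degree -a) exhaust all components. -/
lemma isMaurerCartan_iff_isLInftyMorphism (f : CE L h 1) :
    IsMaurerCartan f ↔ IsLInftyMorphism f := by
  have key0 : ∀ d e, (CE.d (n := 1) (m := 2) rfl f + (1 / 2 : ℝ) •
      br (p := 1) (q := 1) (n := 2) rfl f f) 0 d e =
        -(h.d (d - 1) d (by omega)).compAlternatingMap (f 0 (d - 1) (by omega)) := fun d e => by
    rw [add_apply', smul_apply', br_apply]
    simp [CE.d]
  have key : ∀ (a : ℕ) (e : ((a + 1 : ℕ) : ℤ) + 1 + -a = 2),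
      (CE.d (n := 1) (m := 2) rfl f + (1 / 2 : ℝ) •
      br (p := 1) (q := 1) (n := 2) rfl f f) (a + 1) (-a) e = compBracket (f a (-a) (by omega)) -
    ((h.d (-a - 1) (-a) (by omega)).compAlternatingMap (f (a + 1) (-a - 1) (by push_cast; omega)) +
    (1 / 2 : ℝ) • ∑ i : Fin (a + 1), (-1 : ℝ) ^ (-(i : ℤ)) •
      unshuffleSum (p := i + 1) (q := a - i + 1) (by omega)
        (pairAlt (h.br (-i) (i - a) (-a) (by omega)) (f i (-i) (by omega))
          (f (a - i) (i - a) (by omega)))) := fun a e => by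
    rw [add_apply', smul_apply', br_apply, CE.d, sub_self, zpow_zero, one_smul, ← sub_sub,
      sub_eq_add_neg (_ - _) ((1 / 2 : ℝ) • _), ← smul_neg, ← Finset.sum_neg_distrib]
    congr 2
    refine Finset.sum_congr rfl fun i _ => ?_
    rw [← neg_smul]
    refine congrArg₂ (· • ·) ?_ ?_
    · congr 2
      ring
    · exact brTerm_congr f f rfl
  constructor
  · intro H
    refine ⟨?_, fun a => ?_⟩
    · have h1 := key0 1 rfl
      rw [show _ = (0 : CE L h 2) from H] at h1
      exact (neg_eq_zero.1 h1.symm)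
    · have h1 := key a (by push_cast; ring)
      rw [show _ = (0 : CE L h 2) from H] at h1
      exact sub_eq_zero.1 h1.symm
  · rintro ⟨H0, H⟩
    ext1 a d e
    cases a with
    | zero =>
      obtain rfl : d = 1 := by simp at e; omega
      rw [key0]
      exact neg_eq_zero.2 H0
    | succ a =>
      obtain rfl : d = -a := by push_cast at e; omega
      rw [key, sub_eq_zero.2 (H a)]
      rfl

/-! ### Elements concentrated in a single arity. -/

/-- `f` is concentrated in arity `k + 1`. -/
def IsArity (k : ℕ) (f : CE L h n) : Prop := ∀ a, a ≠ k → ∀ d e, f a d e = 0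

/-- The component of arity `k + 1`. -/
def arityPart (k : ℕ) (f : CE L h n) : CE L h n := fun a d e => if a = k then f a d e else 0

lemma isArity_arityPart (k : ℕ) (f : CE L h n) : IsArity k (arityPart k f) :=
  fun _ ha _ _ => if_neg ha

lemma arityPart_self (k : ℕ) (f : CE L h n) (d : ℤ) (e) : arityPart k f k d e = f k d e :=
  if_pos rfl

lemma IsArity.ext {k : ℕ} {f f' : CE L h n} (hf : IsArity k f) (hf' : IsArity k f')
    (H : ∀ d e, f k d e = f' k d e) : f = f' := by
  ext1 a d e
  by_cases ha : a = k
  · subst ha; exact H d e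
  · rw [hf a ha, hf' a ha]

lemma IsArity.smul {k : ℕ} {f : CE L h n} (hf : IsArity k f) (c : ℝ) : IsArity k (c • f) :=
  fun a ha d e => by rw [smul_apply', hf a ha, smul_zero]

lemma isArity_ofLinear (f : L →ₗ[ℝ] h.V (n - 1)) : IsArity 0 (ofLinear f : CE L h n) :=
  fun a ha d e => by
    cases a with
    | zero => exact absurd rfl ha
    | succ a => rfl

lemma compBracket_zero {W : Type u} [AddCommGroup W] [Module ℝ W] {a : ℕ} :
    compBracket (0 : L [⋀^Fin (a + 1)]→ₗ[ℝ] W) = 0 := by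
  simpa using compBracket_smul (0 : ℝ) (0 : L [⋀^Fin (a + 1)]→ₗ[ℝ] W)

lemma IsArity.compBr {k : ℕ} {f : CE L h n} (hf : IsArity k f) (e : n + 1 = m) :
    IsArity (k + 1) (compBr e f) := fun a ha d e' => by
  cases a with
  | zero => rfl
  | succ a =>
    rw [CE.compBr, hf a (by omega), compBracket_zero]

lemma IsArity.dComp {k : ℕ} {f : CE L h n} (hf : IsArity k f) (e : n + 1 = m) :
    IsArity k (dComp e f) := fun a ha d e' => by
  rw [CE.dComp, hf a ha]
  ext x
  simp

lemma brTerm_zero_left (f : CE L h p) (g : CE L h q) {i j a : ℕ} {di dj d : ℤ}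
    {hi : (i : ℤ) + 1 + di = p} {hj : (j : ℤ) + 1 + dj = q} {ha : i + 1 + (j + 1) = a + 1}
    {hd : di + dj = d} (H : f i di hi = 0) : brTerm f g i j hi hj ha hd = 0 :=
  unshuffleSum_apply_eq_zero _ _ fun x y => by simp [H]

lemma brTerm_zero_right (f : CE L h p) (g : CE L h q) {i j a : ℕ} {di dj d : ℤ}
    {hi : (i : ℤ) + 1 + di = p} {hj : (j : ℤ) + 1 + dj = q} {ha : i + 1 + (j + 1) = a + 1}
    {hd : di + dj = d} (H : g j dj hj = 0) : brTerm f g i j hi hj ha hd = 0 :=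
  unshuffleSum_apply_eq_zero _ _ fun x y => by simp [H]

/-- At most one summand of the bracket survives. The degrees are free variables subject to
equations, so that concrete values such as -1 and d + 1 can be supplied. -/
lemma IsArity.br_apply {k : ℕ} {f : CE L h p} (hf : IsArity k f) (g : CE L h q) (e : p + q = n)
    {a j : ℕ} {d di dj : ℤ} (e') (hi : (k : ℤ) + 1 + di = p) (hj : (j : ℤ) + 1 + dj = q)
    (ha : k + 1 + (j + 1) = a + 1) (hd : di + dj = d) :
    br e f g a d e' = -(-1 : ℝ) ^ (di * q) • brTerm f g k j hi hj ha hd := by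
  rw [CE.br_apply, Finset.sum_eq_single (⟨k, by omega⟩ : Fin a)]
  · refine congrArg₂ (· • ·) ?_ (brTerm_congr f g rfl)
    congr 3
    simp only
    omega
  · intro i _ hik
    rw [brTerm_zero_left f g (hf i (fun h => hik (Fin.ext h)) _ _), smul_zero]
  · intro h
    exact absurd (Finset.mem_univ _) h

/-- The index k stands for arity k + 1, and arities add; hence the additional 1. -/
lemma IsArity.br {k j : ℕ} {f : CE L h p} {g : CE L h q} (hf : IsArity k f) (hg : IsArity j g)
    (e : p + q = n) : IsArity (k + j + 1) (br e f g) := fun a ha d e' => by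
  rw [CE.br_apply]
  refine Finset.sum_eq_zero fun i _ => ?_
  by_cases hi : (i : ℕ) = k
  · rw [brTerm_zero_right f g (hg _ (by omega) _ _), smul_zero]
  · rw [brTerm_zero_left f g (hf _ hi _ _), smul_zero]

/-- The hypothesis is pointwise: all values of f bracket to zero with all values of g. -/
lemma br_eq_zero {f : CE L h p} {g : CE L h q} (e : p + q = n)
    (H : ∀ i di hi j dj hj d hd x y, h.br di dj d hd (f i di hi x) (g j dj hj y) = 0) :
    br e f g = 0 := by
  ext1 a d e'
  rw [CE.br_apply]
  refine Finset.sum_eq_zero fun i _ => ?_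
  rw [brTerm, unshuffleSum_apply_eq_zero _ _ fun x y => H _ _ _ _ _ _ _ _ x y, smul_zero]

/-! ### Composition with strict morphisms of DGLAs. -/

lemma comp_add (F : DGLA.Hom g h) (f f' : CE L g n) : comp F (f + f') = comp F f + comp F f' := by
  ext a d e x
  exact (F.map d).map_add _ _

lemma comp_smul (F : DGLA.Hom g h) (c : ℝ) (f : CE L g n) : comp F (c • f) = c • comp F f := by
  ext a d e x
  exact (F.map d).map_smul _ _

lemma comp_d (F : DGLA.Hom g h) (e : n + 1 = m) (f : CE L g n) :
    comp F (CE.d e f) = CE.d e (comp F f) := by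
  have h1 : comp F (compBr e f) = compBr e (comp F f) := by
    ext1 a d e'
    cases a with
    | zero => ext; exact (F.map d).map_zero
    | succ a => exact compAlternatingMap_compBracket _ _
  have h2 : comp F (dComp e f) = dComp e (comp F f) := by
    ext a d e' x
    exact F.map_d _ _ _ _
  rw [d_eq, d_eq, ← h1, ← h2, sub_eq_add_neg, comp_add, ← neg_smul, comp_smul, neg_smul,
    ← sub_eq_add_neg]

lemma comp_br (F : DGLA.Hom g h) (e : p + q = n) (f : CE L g p) (f' : CE L g q) :
    comp F (br e f f') = br e (comp F f) (comp F f') := by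
  ext1 a d e'
  rw [comp, CE.br_apply, CE.br_apply]
  rw [compAlternatingMap_sum]
  refine Finset.sum_congr rfl fun i _ => by
    rw [compAlternatingMap_smul]
    refine congrArg _ ?_
    exact compAlternatingMap_unshuffleSum _ (F.map d) _ _ fun x y => F.map_br _ _ _ _ _ _

/-- Used to bring the Maurer–Cartan equation from `gSigma` down to its sub-DGLAs. -/
lemma isMaurerCartan_of_comp (F : DGLA.Hom g h) (hF : ∀ i, Function.Injective (F.map i))
    {f : CE L g 1} (hf : IsMaurerCartan (comp F f)) : IsMaurerCartan f := by
  have : comp F (CE.d (n := 1) (m := 2) rfl f + (1 / 2 : ℝ) •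
      br (p := 1) (q := 1) (n := 2) rfl f f) = 0 := by
    rw [comp_add, comp_smul, comp_d, comp_br]
    exact hf
  ext a d e x
  refine hF d ?_
  exact (DFunLike.congr_fun (congrFun (congrFun (congrFun this a) d) e) x).trans
    (F.map d).map_zero.symm

end CE

/-! ### The Chevalley–Eilenberg DGLA with polynomial coefficients -/

namespace DGLA

variable (h : DGLA.{u})

/-- The element `P(t) x` of `h[t, dt]`, as a bilinear map. -/
def polyInl (i : ℤ) : ℝ[X] →ₗ[ℝ] h.V i →ₗ[ℝ] h.poly.V i :=
  LinearMap.mk₂ ℝ (fun P x => ((P ⊗ₜ x, 0) : (ℝ[X] ⊗[ℝ] h.V i) × (ℝ[X] ⊗[ℝ] h.V (i - 1))))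
    (fun _ _ _ => Prod.ext (TensorProduct.add_tmul _ _ _) (add_zero 0).symm)
    (fun c _ _ => Prod.ext rfl (smul_zero c).symm)
    (fun _ _ _ => Prod.ext (TensorProduct.tmul_add _ _ _) (add_zero 0).symm)
    (fun c _ _ => Prod.ext (TensorProduct.tmul_smul _ _ _) (smul_zero c).symm)

/-- The element `P(t) x dt` of `h[t, dt]`, as a bilinear map. -/
def polyInr (i : ℤ) : ℝ[X] →ₗ[ℝ] h.V (i - 1) →ₗ[ℝ] h.poly.V i :=
  LinearMap.mk₂ ℝ (fun P x => ((0, P ⊗ₜ x) : (ℝ[X] ⊗[ℝ] h.V i) × (ℝ[X] ⊗[ℝ] h.V (i - 1))))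
    (fun _ _ _ => Prod.ext (add_zero 0).symm (TensorProduct.add_tmul _ _ _))
    (fun c _ _ => Prod.ext (smul_zero c).symm rfl)
    (fun _ _ _ => Prod.ext (add_zero 0).symm (TensorProduct.tmul_add _ _ _))
    (fun c _ _ => Prod.ext (smul_zero c).symm (TensorProduct.tmul_smul _ _ _))

variable {h} {i : ℤ} (P : ℝ[X])

lemma poly_d_inl (e : i - 1 + 1 = i) (x : h.V (i - 1)) :
    h.poly.d (i - 1) i e (h.polyInl (i - 1) P x) = h.polyInl i P (h.d (i - 1) i e x) +
      (-1 : ℝ) ^ (i - 1) • h.polyInr i (Polynomial.derivative P) x := by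
  refine Prod.ext ?_ ?_
  · change (h.d (i - 1) i e).lTensor _ (P ⊗ₜ x) = P ⊗ₜ h.d (i - 1) i e x + (-1 : ℝ) ^ (i - 1) • 0
    simp
  · change (-1 : ℝ) ^ (i - 1) • (h.castL rfl).lTensor _ (polyDeriv _ (P ⊗ₜ x)) +
      (h.d (i - 1 - 1) (i - 1) (by omega)).lTensor _ 0 =
        0 + (-1 : ℝ) ^ (i - 1) • (Polynomial.derivative P ⊗ₜ x)
    simp [castL_rfl]

lemma poly_d_inr (e : i - 1 + 1 = i) (x : h.V (i - 1 - 1)) :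
    h.poly.d (i - 1) i e (h.polyInr (i - 1) P x) =
      h.polyInr i P (h.d (i - 1 - 1) (i - 1) (by omega) x) := by
  refine Prod.ext ?_ ?_
  · change (h.d (i - 1) i e).lTensor ℝ[X] 0 = 0
    simp
  · change (-1 : ℝ) ^ (i - 1) • (h.castL rfl).lTensor _ (polyDeriv _ 0) +
      (h.d (i - 1 - 1) (i - 1) (by omega)).lTensor _ (P ⊗ₜ x) = _
    rw [map_zero, map_zero, smul_zero, zero_add]
    rfl

variable {j k : ℤ} (e : i + j = k) (Q : ℝ[X])

lemma poly_br_inl_inl (x : h.V i) (y : h.V j) :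
    h.poly.br i j k e (h.polyInl i P x) (h.polyInl j Q y) =
      h.polyInl k (P * Q) (h.br i j k e x y) := by
  refine Prod.ext rfl ?_
  change polyBilin (h.br i (j - 1) (k - 1) (by omega)) (P ⊗ₜ x) 0 +
    (-1 : ℝ) ^ j • polyBilin (h.br (i - 1) j (k - 1) (by omega)) 0 (Q ⊗ₜ y) = 0
  simp

lemma poly_br_inr_inl (x : h.V (i - 1)) (y : h.V j) :
    h.poly.br i j k e (h.polyInr i P x) (h.polyInl j Q y) =
      (-1 : ℝ) ^ j • h.polyInr k (P * Q) (h.br (i - 1) j (k - 1) (by omega) x y) := by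
  refine Prod.ext ?_ ?_
  · change polyBilin (h.br i j k e) 0 (Q ⊗ₜ y) = (-1 : ℝ) ^ j • 0
    simp
  · change polyBilin (h.br i (j - 1) (k - 1) (by omega)) 0 0 +
      (-1 : ℝ) ^ j • polyBilin (h.br (i - 1) j (k - 1) (by omega)) (P ⊗ₜ x) (Q ⊗ₜ y) = _
    rw [map_zero, zero_add]
    rfl

lemma poly_br_inl_inr (x : h.V i) (y : h.V (j - 1)) :
    h.poly.br i j k e (h.polyInl i P x) (h.polyInr j Q y) =
      h.polyInr k (P * Q) (h.br i (j - 1) (k - 1) (by omega) x y) := by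
  refine Prod.ext ?_ ?_
  · change polyBilin (h.br i j k e) (P ⊗ₜ x) 0 = 0
    simp
  · change polyBilin (h.br i (j - 1) (k - 1) (by omega)) (P ⊗ₜ x) (Q ⊗ₜ y) +
      (-1 : ℝ) ^ j • polyBilin (h.br (i - 1) j (k - 1) (by omega)) 0 0 = _
    rw [map_zero, smul_zero, add_zero]
    rfl

lemma poly_br_inr_inr (x : h.V (i - 1)) (y : h.V (j - 1)) :
    h.poly.br i j k e (h.polyInr i P x) (h.polyInr j Q y) = 0 := by
  refine Prod.ext ?_ ?_
  · change polyBilin (h.br i j k e) 0 0 = 0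
    simp
  · change polyBilin (h.br i (j - 1) (k - 1) (by omega)) 0 (Q ⊗ₜ y) +
      (-1 : ℝ) ^ j • polyBilin (h.br (i - 1) j (k - 1) (by omega)) (P ⊗ₜ x) 0 = 0
    simp

end DGLA

namespace CE

variable {L : Type u} [LieRing L] [LieAlgebra ℝ L] {h : DGLA.{u}} {n m p q : ℤ}

/-- The element `P(t) f` of `CE(L, h[t, dt])`, as a bilinear map in `P` and `f`. -/
def polyMul : ℝ[X] →ₗ[ℝ] CE L h n →ₗ[ℝ] CE L h.poly n :=
  LinearMap.mk₂ ℝ (fun P f a d e => (h.polyInl d P).compAlternatingMap (f a d e))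
    (fun P Q f => by
      ext a d e x
      exact LinearMap.congr_fun (map_add (h.polyInl d) P Q) _)
    (fun c P f => by
      ext a d e x
      exact LinearMap.congr_fun (map_smul (h.polyInl d) c P) _)
    (fun P f g => by
      ext a d e x
      exact map_add (h.polyInl d P) _ _)
    (fun c P f => by
      ext a d e x
      exact map_smul (h.polyInl d P) _ _)

lemma polyMul_apply (P : ℝ[X]) (f : CE L h n) (a : ℕ) (d : ℤ) (e) : polyMul P f a d e =
    (h.polyInl d P).compAlternatingMap (f a d e) := rfl

/-- The element `P(t) f dt` of `CE(L, h[t, dt])`, with the sign `(-1)^a` on the component of arity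
`a + 1`, as a bilinear map in `P` and `f`. -/
def polyDt (e : n + 1 = m) : ℝ[X] →ₗ[ℝ] CE L h n →ₗ[ℝ] CE L h.poly m :=
  LinearMap.mk₂ ℝ (fun P f a d _ => ((-1 : ℝ) ^ a • h.polyInr d P).compAlternatingMap
      (f a (d - 1) (by omega)))
    (fun P Q f => by
      ext a d e x
      change (-1 : ℝ) ^ a • h.polyInr d (P + Q) (f a (d - 1) (by omega) x) =
        (-1 : ℝ) ^ a • h.polyInr d P (f a (d - 1) (by omega) x) +
          (-1 : ℝ) ^ a • h.polyInr d Q (f a (d - 1) (by omega) x)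
      rw [map_add, LinearMap.add_apply, smul_add])
    (fun c P f => by
      ext a d e x
      change (-1 : ℝ) ^ a • h.polyInr d (c • P) (f a (d - 1) (by omega) x) =
        c • (-1 : ℝ) ^ a • h.polyInr d P (f a (d - 1) (by omega) x)
      rw [map_smul, LinearMap.smul_apply, smul_comm])
    (fun P f g => by
      ext a d e x
      exact map_add ((-1 : ℝ) ^ a • h.polyInr d P) _ _)
    (fun c P f => by
      ext a d e x
      exact map_smul ((-1 : ℝ) ^ a • h.polyInr d P) _ _)

lemma polyDt_apply (e : n + 1 = m) (P : ℝ[X]) (f : CE L h n) (a : ℕ) (d : ℤ) (e') :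
    polyDt e P f a d e' = ((-1 : ℝ) ^ a • h.polyInr d P).compAlternatingMap
      (f a (d - 1) (by omega)) := rfl

lemma smulT_eq (ξ : CE L h 0) : smulT ξ = polyMul Polynomial.X ξ := rfl

lemma comp_polyConst (f : CE L h n) : comp h.polyConst f = polyMul 1 f := rfl

lemma br_polyMul (e : p + q = n) (P Q : ℝ[X]) (f : CE L h p) (g : CE L h q) :
    br e (polyMul P f) (polyMul Q g) = polyMul (P * Q) (br e f g) := by
  ext1 a d e'
  rw [br_apply, polyMul_apply, br_apply, compAlternatingMap_sum]
  refine Finset.sum_congr rfl fun i _ => ?_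
  rw [compAlternatingMap_smul]
  refine congrArg _ (compAlternatingMap_unshuffleSum _ _ _ _ fun x y => ?_).symm
  exact (DGLA.poly_br_inl_inl _ _ _ _ _).symm

/-- The sign built into `polyDt` makes this formula free of signs. Moving dt past a value of g costs
(-1)^{dj}, and the degree of the first argument, larger by one, costs (-1)^q. Since dj = q - (a -
i), their product is (-1)^{a-i}, the ratio of the `polyDt` signs at indices a and i. -/
lemma br_polyDt_polyMul (e : p + q = n) (e₁ : p + 1 = m) {n' : ℤ} (e₂ : m + q = n')
    (P Q : ℝ[X]) (f : CE L h p) (g : CE L h q) :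
    br e₂ (polyDt e₁ P f) (polyMul Q g) = polyDt (by omega) (P * Q) (br e f g) := by
  subst e₁
  ext1 a d e'
  rw [br_apply, polyDt_apply, br_apply, compAlternatingMap_sum]
  refine Finset.sum_congr rfl fun i _ => ?_
  rw [compAlternatingMap_smul, ← brTerm_congr f g (i := i) (j := a - 1 - i)
    (di := p + 1 - (i + 1) - 1) (dj := q - (a - i)) (hi := by omega) (hj := by omega)
    (ha := by omega) (hd := by omega) rfl]
  have e3 : brTerm (polyDt rfl P f) (polyMul Q g) i (a - 1 - i) (di := p + 1 - (i + 1))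
      (dj := q - (a - i)) (a := a) (d := d) (by omega) (by omega) (by omega) (by omega) =
      ((-1 : ℝ) ^ (i : ℕ) * (-1) ^ (q - (a - i))) • (h.polyInr d (P * Q)).compAlternatingMap
        (brTerm f g i (a - 1 - i) (di := p + 1 - (i + 1) - 1) (dj := q - (a - i)) (by omega)
          (by omega) (by omega) (by omega)) := by
    rw [← compAlternatingMap_smul]
    rw [brTerm, brTerm, ← unshuffleSum_smul]
    refine (compAlternatingMap_unshuffleSum _ _ _ _ fun x y => ?_).symm
    have := DGLA.poly_br_inr_inl (h := h) (i := p + 1 - (i + 1)) (j := q - (a - i)) (k := d)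
      P (by omega) Q (f i (p + 1 - (i + 1) - 1) (by omega) x) (g (a - 1 - i) _ (by omega) y)
    rw [AlternatingMap.smul_apply, AlternatingMap.smul_apply, map_smul, ← smul_smul]
    refine (congrArg _ this.symm).trans ?_
    exact (LinearMap.congr_fun (map_smul (h.poly.br _ _ _ _) ((-1 : ℝ) ^ (i : ℕ)) _) _).symm
  have e8 : ((-1 : ℝ) ^ a • h.polyInr d (P * Q)).compAlternatingMap
      (brTerm f g i (a - 1 - i) (di := p + 1 - (i + 1) - 1) (dj := q - (a - i)) (a := a) (by omega)
          (by omega) (by omega) (by omega)) = (-1 : ℝ) ^ a •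
        (h.polyInr d (P * Q)).compAlternatingMap
      (brTerm f g i (a - 1 - i) (di := p + 1 - (i + 1) - 1) (dj := q - (a - i)) (a := a) (by omega)
          (by omega) (by omega) (by omega)) := rfl
  rw [e3, e8, smul_smul, smul_smul]
  congr 1
  have e4 := DGLA.neg_one_zpow_mul_self q
  have e5 : ∀ k : ℕ, (-1 : ℝ) ^ k * (-1) ^ k = 1 := fun k => by rw [← mul_pow]; simp
  -- The sign of the internal degree of g, expressed through q, a and i.
  have e6 : (-1 : ℝ) ^ (q - (a - i)) = (-1) ^ q * ((-1) ^ a * (-1) ^ (i : ℕ)) := by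
    rw [← sub_add, zpow_add₀ (by norm_num), zpow_sub₀ (by norm_num), zpow_natCast,
      zpow_natCast, div_eq_mul_inv, ← inv_pow, inv_neg, inv_one]
    ring
  have e7 : (p + 1 - ((i : ℤ) + 1)) * q = (p - (i + 1)) * q + q := by ring
  rw [e6, e7, zpow_add₀ (by norm_num)]
  linear_combination (-(-1 : ℝ) ^ ((p - ((i : ℤ) + 1)) * q) * (-1) ^ a * (-1) ^ (i : ℕ) *
    (-1) ^ (i : ℕ)) * e4 - ((-1 : ℝ) ^ ((p - ((i : ℤ) + 1)) * q) * (-1) ^ a) * e5 i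

lemma br_polyDt_polyDt (e₁ : p + 1 = m) {q m' : ℤ} (e₂ : q + 1 = m') (e : m + m' = n) (P Q : ℝ[X])
    (f : CE L h p) (g : CE L h q) : br e (polyDt e₁ P f) (polyDt e₂ Q g) = 0 :=
  br_eq_zero _ fun i di hi j dj hj d hd x y => by
    change h.poly.br di dj d hd ((-1 : ℝ) ^ i • h.polyInr di P (f i (di - 1) _ x))
      ((-1 : ℝ) ^ j • h.polyInr dj Q (g j (dj - 1) _ y)) = 0
    rw [map_smul, map_smul, LinearMap.smul_apply, DGLA.poly_br_inr_inr, smul_zero, smul_zero]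

/-- Only a vanishing statement is needed for this order of the factors: it is applied to tξ and ξ
dt, where all values bracket to zero. -/
lemma br_polyMul_polyDt_eq_zero (e₁ : q + 1 = m) (e : p + m = n) (P Q : ℝ[X])
    (f : CE L h p) (g : CE L h q)
    (H : ∀ i di hi j dj hj d hd x y, h.br di dj d hd (f i di hi x) (g j dj hj y) = 0) :
    br e (polyMul P f) (polyDt e₁ Q g) = 0 :=
  br_eq_zero _ fun i di hi j dj hj d hd x y => by
    change h.poly.br di dj d hd (h.polyInl di P (f i di _ x))
      ((-1 : ℝ) ^ j • h.polyInr dj Q (g j (dj - 1) _ y)) = 0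
    rw [map_smul, DGLA.poly_br_inl_inr, H, map_zero, smul_zero]

lemma compBr_polyMul (e : n + 1 = m) (P : ℝ[X]) (f : CE L h n) :
    compBr e (polyMul P f) = polyMul P (compBr e f) := by
  ext1 a d e'
  cases a with
  | zero =>
    ext x
    exact (h.polyInl d P).map_zero.symm
  | succ a => exact (compAlternatingMap_compBracket _ _).symm

/-- Composition with the bracket raises the arity by one, which flips the sign in `polyDt`. -/
lemma compBr_polyDt {m' : ℤ} (e : n + 1 = m) (e₁ : m + 1 = m') (P : ℝ[X]) (f : CE L h n) :
    compBr e₁ (polyDt e P f) = -polyDt e₁ P (compBr e f) := by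
  ext1 a d e'
  rw [neg_apply']
  cases a with
  | zero =>
    ext x
    exact (neg_eq_zero.2 ((-1 : ℝ) ^ 0 • h.polyInr d P).map_zero).symm
  | succ a =>
    rw [polyDt_apply, pow_succ, mul_neg_one]
    refine (compAlternatingMap_compBracket _ _).symm.trans ?_
    ext x
    rw [neg_smul]
    exact (neg_neg _).symm

/-- The derivative term carries -(-1)^{n-1} from the differential of CE and (-1)^{d-1} from that of
h[t, dt]. As n - 1 = (d - 1) + a, their product is -(-1)^a, the sign of `-polyDt`. -/
lemma d_polyMul (e : n + 1 = m) (P : ℝ[X]) (f : CE L h n) :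
    CE.d e (polyMul P f) = polyMul P (CE.d e f) - polyDt e (Polynomial.derivative P) f := by
  have h1 : (-1 : ℝ) ^ (n - 1) • dComp e (polyMul P f) =
      polyMul P ((-1 : ℝ) ^ (n - 1) • dComp e f) + polyDt e (Polynomial.derivative P) f := by
    ext a d e' x
    have e1 : (-1 : ℝ) ^ (n - 1) = (-1) ^ (d - 1) * (-1) ^ a := by
      rw [show n - 1 = d - 1 + a by omega, zpow_add₀ (by norm_num), zpow_natCast]
    rw [map_smul]
    change (-1 : ℝ) ^ (n - 1) • h.poly.d (d - 1) d (by omega)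
        (h.polyInl (d - 1) P (f a (d - 1) (by omega) x)) =
      (-1 : ℝ) ^ (n - 1) • h.polyInl d P (h.d (d - 1) d (by omega) (f a (d - 1) (by omega) x)) +
        (-1 : ℝ) ^ a • h.polyInr d (Polynomial.derivative P) (f a (d - 1) (by omega) x)
    rw [DGLA.poly_d_inl, smul_add, smul_smul]
    congr 2
    rw [e1]
    linear_combination (-1 : ℝ) ^ a * DGLA.neg_one_zpow_mul_self (d - 1)
  rw [d_eq, d_eq, compBr_polyMul, h1, map_sub, sub_sub]

/-- The bracket part anticommutes with `polyDt`. The internal part commutes with it, but its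
prefactor changes sign because the total degree has gone up by one. -/
lemma d_polyDt {m' : ℤ} (e : n + 1 = m) (e₁ : m + 1 = m') (P : ℝ[X]) (f : CE L h n) :
    CE.d e₁ (polyDt e P f) = -polyDt e₁ P (CE.d e f) := by
  have h1 : dComp e₁ (polyDt e P f) = polyDt e₁ P (dComp e f) := by
    ext a d e' x
    change h.poly.d (d - 1) d (by omega)
        ((-1 : ℝ) ^ a • h.polyInr (d - 1) P (f a (d - 1 - 1) (by omega) x)) = (-1 : ℝ) ^ a •
      h.polyInr d P (h.d (d - 1 - 1) (d - 1) (by omega) (f a (d - 1 - 1) (by omega) x))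
    rw [map_smul, DGLA.poly_d_inr]
  have h2 : (-1 : ℝ) ^ (m - 1) = -(-1) ^ (n - 1) := by
    rw [← e, add_sub_cancel_right, DGLA.neg_one_zpow_sub_one, neg_neg]
  rw [d_eq, d_eq, compBr_polyDt e, h1, map_sub, map_smul, h2]
  module

lemma comp_polyEv_polyMul (s : ℝ) (P : ℝ[X]) (f : CE L h n) :
    comp (h.polyEv s) (polyMul P f) = P.eval s • f := by
  ext a d e x
  exact DGLA.polyEval_tmul _ _ _

lemma comp_polyEv_polyDt (s : ℝ) (e : n + 1 = m) (P : ℝ[X]) (f : CE L h n) :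
    comp (h.polyEv s) (polyDt e P f) = 0 := by
  ext a d e x
  change (h.polyEv s).map d ((-1 : ℝ) ^ a • h.polyInr d P (f a (d - 1) (by omega) x)) = 0
  rw [map_smul]
  exact (congrArg _ (DGLA.polyEval s (h.V d)).map_zero).trans (smul_zero _)

end CE

/-! ### Gauge transformations and homotopies -/

namespace CE

variable {L : Type u} [LieRing L] [LieAlgebra ℝ L] {h : DGLA.{u}}

lemma br_add_left {p q n : ℤ} (e : p + q = n) (f f' : CE L h p) (g : CE L h q) :
    br e (f + f') g = br e f g + br e f' g :=
  LinearMap.congr_fun (map_add (brLin e) f f') g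

lemma br_add_right {p q n : ℤ} (e : p + q = n) (f : CE L h p) (g g' : CE L h q) :
    br e f (g + g') = br e f g + br e f g' :=
  map_add (brLin e f) g g'

lemma comp_sum {g : DGLA.{u}} {n : ℤ} (F : DGLA.Hom g h) {I : Type*} (s : Finset I)
    (f : I → CE L g n) : CE.comp F (∑ i ∈ s, f i) = ∑ i ∈ s, CE.comp F (f i) :=
  map_sum (AddMonoidHom.mk' (CE.comp F) (comp_add F)) f s

lemma gaugeTerm_zero (ξ : CE L h 0) (x : CE L h 1) :
    gaugeTerm ξ x 0 = br (zero_add 1) ξ x - CE.d (zero_add 1) ξ := by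
  simp [gaugeTerm]

/-- Replaces iterates and factorials by a recursion, in which the factor of [ξ, M_n] cancels
exactly. -/
lemma gaugeTerm_succ (ξ : CE L h 0) (x : CE L h 1) (n : ℕ) :
    gaugeTerm ξ x (n + 1) = ((n : ℝ) + 2)⁻¹ • br (zero_add 1) ξ (gaugeTerm ξ x n) := by
  rw [gaugeTerm, gaugeTerm, Function.iterate_succ_apply', ← brLin_apply _ _ (_ • _), map_smul,
    brLin_apply, smul_smul, Nat.factorial_succ (n + 1), ← mul_inv]
  push_cast
  congr 3
  ring

lemma IsMaurerCartan.comp {g : DGLA.{u}} (F : DGLA.Hom g h) {f : CE L g 1}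
    (hf : IsMaurerCartan f) : IsMaurerCartan (comp F f) := by
  rw [IsMaurerCartan, ← comp_d, ← comp_br, ← comp_smul, ← comp_add]
  rw [show _ = (0 : CE L g 2) from hf]
  ext a d e x
  exact (F.map d).map_zero

/-- Elements `ξ` of degree `0` and `ℓ`, `c`, `Mₙ` of degree `1`, whose brackets and differentials
are those of `ι`, of `L`, of `ι ◁ [·,·]`, and of the components of `ι_∞σ`. -/
structure IsContractionSystem (ξ : CE L h 0) (ℓ c : CE L h 1) (M : ℕ → CE L h 1)
    (κ : CE L h 2) (μ : ℕ → CE L h 2) (N : ℕ) : Prop where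
  d_xi : CE.d (zero_add 1) ξ = c + ℓ - M 0
  br_xi_l : br (zero_add 1) ξ ℓ = (2 : ℝ) • c
  br_xi_c : br (zero_add 1) ξ c = 0
  br_xi_M : ∀ n, br (zero_add 1) ξ (M n) = ((n : ℝ) + 2) • M (n + 1)
  br_xi_xi : ∀ i di hi j dj hj d hd x y, h.br di dj d hd (ξ i di hi x) (ξ j dj hj y) = 0
  M_eq_zero : ∀ n, N ≤ n → M n = 0
  mu_eq_zero : ∀ n, N ≤ n → μ n = 0
  d_l : CE.d (n := 1) (m := 2) rfl ℓ = κ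
  d_c : CE.d (n := 1) (m := 2) rfl c = μ 0 - κ
  d_M_zero : CE.d (n := 1) (m := 2) rfl (M 0) = μ 0
  d_M_succ : ∀ n, CE.d (n := 1) (m := 2) rfl (M (n + 1)) = μ (n + 1) - μ n
  br_l_l : br (p := 1) (q := 1) (n := 2) rfl ℓ ℓ = (-2 : ℝ) • κ
  br_l_c : br (p := 1) (q := 1) (n := 2) rfl ℓ c = 0
  br_l_M : ∀ n, br (p := 1) (q := 1) (n := 2) rfl ℓ (M n) = (-2 : ℝ) • μ n
  br_c_c : br (p := 1) (q := 1) (n := 2) rfl c c = 0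
  br_c_M : ∀ n, br (p := 1) (q := 1) (n := 2) rfl c (M n) = μ (n + 1)
  br_M_M : ∀ n m, br (p := 1) (q := 1) (n := 2) rfl (M n) (M m) = 0

namespace IsContractionSystem

variable {ξ : CE L h 0} {ℓ c : CE L h 1} {M : ℕ → CE L h 1} {κ : CE L h 2} {μ : ℕ → CE L h 2}
  {N : ℕ} (S : IsContractionSystem ξ ℓ c M κ μ N)

include S

lemma gaugeTerm_zero : gaugeTerm ξ ℓ 0 = c - ℓ + M 0 := by
  rw [CE.gaugeTerm_zero, S.br_xi_l, S.d_xi]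
  module

lemma gaugeTerm_one : gaugeTerm ξ ℓ 1 = M 1 - c := by
  rw [gaugeTerm_succ, S.gaugeTerm_zero, ← brLin_apply, map_add, map_sub, brLin_apply, brLin_apply,
    brLin_apply, S.br_xi_c, S.br_xi_l, S.br_xi_M]
  push_cast
  module

lemma gaugeTerm_add_two (n : ℕ) : gaugeTerm ξ ℓ (n + 2) = M (n + 2) := by
  induction n with
  | zero =>
    rw [gaugeTerm_succ, S.gaugeTerm_one, ← brLin_apply, map_sub, brLin_apply, brLin_apply,
      S.br_xi_c, S.br_xi_M, sub_zero, smul_smul, inv_mul_cancel₀ (by positivity), one_smul]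
  | succ n ih =>
    rw [gaugeTerm_succ, ih, S.br_xi_M, smul_smul, inv_mul_cancel₀ (by positivity), one_smul]

lemma gaugeTerm_eq_zero (n : ℕ) (hn : N + 2 ≤ n) : gaugeTerm ξ ℓ n = 0 := by
  obtain ⟨k, rfl⟩ : ∃ k, n = k + 2 := ⟨n - 2, by omega⟩
  rw [S.gaugeTerm_add_two, S.M_eq_zero _ (by omega)]

/-- The contributions of ℓ and c cancel: ℓ + (c - ℓ + M_0) + (M_1 - c) = M_0 + M_1. The bound is N +
2 rather than N so that the two exceptional terms can be split off whatever N is. -/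
lemma isGaugeTransform : IsGaugeTransform ξ ℓ (∑ n ∈ Finset.range (N + 2), M n) := by
  refine ⟨N + 2, S.gaugeTerm_eq_zero, ?_⟩
  rw [Finset.sum_range_succ', Finset.sum_range_succ', Finset.sum_range_succ',
    Finset.sum_range_succ', S.gaugeTerm_zero, S.gaugeTerm_one]
  simp only [add_assoc, Nat.reduceAdd, S.gaugeTerm_add_two]
  module

/-- The dt-part comes from d(tξ) = t dξ - ξ dt. -/
lemma gaugeTerm_smulT_zero : gaugeTerm (smulT ξ) (CE.comp h.polyConst ℓ) 0 =
    polyMul (Polynomial.X) (gaugeTerm ξ ℓ 0) + polyDt (zero_add 1) 1 ξ := by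
  rw [CE.gaugeTerm_zero, CE.gaugeTerm_zero, smulT_eq, comp_polyConst, br_polyMul, d_polyMul,
    map_sub, mul_one, Polynomial.derivative_X, sub_sub_eq_add_sub, add_sub_right_comm]

/-- The dt-part does not propagate, because the values of ξ commute with each other; every further
bracket with tξ contributes one power of t. -/
lemma gaugeTerm_smulT_succ (n : ℕ) : gaugeTerm (smulT ξ) (CE.comp h.polyConst ℓ) (n + 1) =
    polyMul (Polynomial.X ^ (n + 2)) (gaugeTerm ξ ℓ (n + 1)) := by
  induction n with
  | zero =>
    rw [gaugeTerm_succ, S.gaugeTerm_smulT_zero, ← brLin_apply, map_add, brLin_apply, brLin_apply,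
      smulT_eq, br_polyMul, br_polyMul_polyDt_eq_zero _ _ _ _ _ _ S.br_xi_xi, add_zero,
      gaugeTerm_succ ξ, map_smul, ← pow_two]
  | succ n ih =>
    rw [gaugeTerm_succ, ih, smulT_eq, br_polyMul, gaugeTerm_succ ξ ℓ (n + 1), map_smul, ← pow_succ']

/-- The series `e^{tξ} ⋆ ℓ`. -/
lemma isGaugeTransform_smulT : IsGaugeTransform (smulT ξ) (CE.comp h.polyConst ℓ)
    (polyMul 1 ℓ + ∑ n ∈ Finset.range (N + 2), polyMul (Polynomial.X ^ (n + 1)) (gaugeTerm ξ ℓ n) +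
      polyDt (zero_add 1) 1 ξ) := by
  refine ⟨N + 2, fun n hn => ?_, ?_⟩
  · obtain ⟨k, rfl⟩ : ∃ k, n = k + 1 := ⟨n - 1, by omega⟩
    rw [S.gaugeTerm_smulT_succ, S.gaugeTerm_eq_zero _ hn, map_zero]
  · rw [Finset.sum_range_succ', Finset.sum_range_succ' (gaugeTerm _ _), S.gaugeTerm_smulT_zero,
      comp_polyConst]
    simp only [← comp_polyConst, S.gaugeTerm_smulT_succ, zero_add, pow_one]
    abel

/-- The dt-free part A of the gauge path in closed form: collecting the coefficients of ℓ gives 1 -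
t, those of c give t - t². -/
lemma sum_polyMul_gaugeTerm : polyMul 1 ℓ +
    ∑ n ∈ Finset.range (N + 2), polyMul (Polynomial.X ^ (n + 1)) (gaugeTerm ξ ℓ n) =
      polyMul (1 - Polynomial.X) ℓ + polyMul (Polynomial.X - Polynomial.X ^ 2) c +
        ∑ n ∈ Finset.range (N + 2), polyMul (Polynomial.X ^ (n + 1)) (M n) := by
  rw [Finset.sum_range_succ', Finset.sum_range_succ', Finset.sum_range_succ',
    Finset.sum_range_succ', S.gaugeTerm_zero, S.gaugeTerm_one]
  simp only [S.gaugeTerm_add_two, map_sub, map_add, LinearMap.sub_apply, zero_add, pow_one,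
    Nat.reduceAdd]
  abel

/-! ### The Maurer–Cartan equation along the gauge path. -/

/-- The generating function of the `μₙ`. -/
lemma sum_polyMul_mu_succ (P : ℝ[X]) :
    ∑ n ∈ Finset.range (N + 2), polyMul (P * Polynomial.X ^ (n + 2)) (μ (n + 1)) =
      ∑ n ∈ Finset.range (N + 2), polyMul (P * Polynomial.X ^ (n + 1)) (μ n) -
        polyMul (P * Polynomial.X) (μ 0) := by
  rw [eq_sub_iff_add_eq]
  have h1 := Finset.sum_range_succ'
    (fun n => polyMul (P * Polynomial.X ^ (n + 1)) (μ n)) (N + 2)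
  rw [Finset.sum_range_succ, S.mu_eq_zero (N + 2) (by omega), map_zero, add_zero, zero_add,
    pow_one] at h1
  exact h1.symm

/-- With E = ∑ t^{n+1} μ_n the right side is E - tE: the differences μ_{n+1} - μ_n shift the
generating function by one power of t. The last term of tE is dropped because μ_{N+1} = 0. -/
lemma sum_polyMul_d : ∑ n ∈ Finset.range (N + 2),
    polyMul (Polynomial.X ^ (n + 1)) (CE.d (n := 1) (m := 2) rfl (M n)) =
      ∑ n ∈ Finset.range (N + 2), polyMul (Polynomial.X ^ (n + 1)) (μ n) -
        ∑ n ∈ Finset.range (N + 2), polyMul (Polynomial.X * Polynomial.X ^ (n + 1)) (μ n) := by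
  rw [Finset.sum_range_succ', Finset.sum_range_succ' (fun n => polyMul _ (μ n)),
    Finset.sum_range_succ (fun n => polyMul (Polynomial.X * _) (μ n)),
    S.mu_eq_zero (N + 1) (by omega), map_zero, add_zero, S.d_M_zero, add_sub_right_comm,
    ← Finset.sum_sub_distrib]
  congr 1
  refine Finset.sum_congr rfl fun n _ => ?_
  rw [S.d_M_succ, map_sub, ← pow_succ']

/-- On the generating function ∑ t^{n+1} M_n, bracketing with ξ is differentiation in t up to the
constant term M_0, since (t^{n+2})' = (n + 2) t^{n+1}. -/
lemma sum_polyDt {m : ℤ} (e : (1 : ℤ) + 1 = m) : ∑ n ∈ Finset.range (N + 2),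
    polyDt e (Polynomial.X ^ (n + 1)) (((n : ℝ) + 2) • M (n + 1)) =
      ∑ n ∈ Finset.range (N + 2), polyDt e (Polynomial.derivative (Polynomial.X ^ (n + 1))) (M n) -
        polyDt e 1 (M 0) := by
  have h0 : ∀ n : ℕ, polyDt e (Polynomial.derivative (Polynomial.X ^ (n + 1))) (M n) =
      polyDt e (Polynomial.X ^ n) (((n : ℝ) + 1) • M n) := fun n => by
    rw [Polynomial.derivative_X_pow, Nat.add_sub_cancel, ← Polynomial.smul_eq_C_mul, map_smul,
      map_smul, LinearMap.smul_apply, Nat.cast_succ]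
  have h1 := Finset.sum_range_succ'
    (fun n => polyDt e (Polynomial.X ^ n) (((n : ℝ) + 1) • M n)) (N + 2)
  rw [Finset.sum_range_succ, S.M_eq_zero (N + 2) (by omega), smul_zero, map_zero, add_zero] at h1
  simp only [h0, eq_sub_iff_add_eq]
  rw [h1, pow_zero, Nat.cast_zero, zero_add, one_smul]
  congr 1
  refine Finset.sum_congr rfl fun n _ => ?_
  push_cast
  rw [add_assoc, one_add_one_eq_two]

lemma d_polyPart : CE.d (n := 1) (m := 2) rfl (polyMul (1 - Polynomial.X) ℓ +
    polyMul (Polynomial.X - Polynomial.X ^ 2) c +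
      ∑ n ∈ Finset.range (N + 2), polyMul (Polynomial.X ^ (n + 1)) (M n)) =
    polyMul (1 - Polynomial.X) κ + polyMul (Polynomial.X - Polynomial.X ^ 2) (μ 0 - κ) +
      (∑ n ∈ Finset.range (N + 2), polyMul (Polynomial.X ^ (n + 1)) (μ n) -
        ∑ n ∈ Finset.range (N + 2), polyMul (Polynomial.X * Polynomial.X ^ (n + 1)) (μ n)) -
    (-polyDt (m := 2) rfl 1 ℓ + polyDt (m := 2) rfl (1 - (2 : ℝ) • Polynomial.X) c +
      (∑ n ∈ Finset.range (N + 2), polyDt (m := 2) rfl (Polynomial.X ^ (n + 1))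
        (((n : ℝ) + 2) • M (n + 1)) + polyDt (m := 2) rfl 1 (M 0))) := by
  rw [S.sum_polyDt, ← S.sum_polyMul_d, sub_add_cancel, ← dLin_apply, map_add, map_add, map_sum]
  simp only [dLin_apply, d_polyMul, Finset.sum_sub_distrib, S.d_l, S.d_c]
  have h1 : Polynomial.derivative (1 - Polynomial.X : ℝ[X]) = -1 := by simp
  have h2 : Polynomial.derivative (Polynomial.X - Polynomial.X ^ 2 : ℝ[X]) =
      1 - (2 : ℝ) • Polynomial.X := by
    rw [map_sub, Polynomial.derivative_X, Polynomial.derivative_X_pow, Polynomial.smul_eq_C_mul]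
    simp
  rw [h1, h2, map_neg, LinearMap.neg_apply]
  abel

/-- The right side is -2 times the dt-free part of dA in `d_polyPart`, so the coefficient
Maurer–Cartan equation holds for A. -/
lemma br_polyPart : br (p := 1) (q := 1) (n := 2) rfl
    (polyMul (1 - Polynomial.X) ℓ + polyMul (Polynomial.X - Polynomial.X ^ 2) c +
      ∑ n ∈ Finset.range (N + 2), polyMul (Polynomial.X ^ (n + 1)) (M n))
    (polyMul (1 - Polynomial.X) ℓ + polyMul (Polynomial.X - Polynomial.X ^ 2) c +
      ∑ n ∈ Finset.range (N + 2), polyMul (Polynomial.X ^ (n + 1)) (M n)) =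
    (-2 : ℝ) • (polyMul (1 - Polynomial.X) κ + polyMul (Polynomial.X - Polynomial.X ^ 2) (μ 0 - κ) +
      (∑ n ∈ Finset.range (N + 2), polyMul (Polynomial.X ^ (n + 1)) (μ n) -
        ∑ n ∈ Finset.range (N + 2), polyMul (Polynomial.X * Polynomial.X ^ (n + 1)) (μ n))) := by
  set P : ℝ[X] := 1 - Polynomial.X with hP
  set Q : ℝ[X] := Polynomial.X - Polynomial.X ^ 2 with hQ
  set s := ∑ n ∈ Finset.range (N + 2), polyMul (Polynomial.X ^ (n + 1)) (M n) with hs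
  set E := ∑ n ∈ Finset.range (N + 2), polyMul (Polynomial.X ^ (n + 1)) (μ n) with hE
  set E' := ∑ n ∈ Finset.range (N + 2), polyMul (Polynomial.X * Polynomial.X ^ (n + 1)) (μ n)
    with hE'
  -- This is the identity (1 - t)² = (1 - t) - (t - t²).
  have h11 : br (p := 1) (q := 1) (n := 2) rfl (polyMul P ℓ) (polyMul P ℓ) =
      (-2 : ℝ) • (polyMul P κ - polyMul Q κ) := by
    rw [br_polyMul, S.br_l_l, map_smul, ← LinearMap.sub_apply, ← map_sub]
    congr 3
    rw [hP, hQ]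
    ring
  have h12 : br (p := 1) (q := 1) (n := 2) rfl (polyMul P ℓ) (polyMul Q c) = 0 := by
    rw [br_polyMul, S.br_l_c, map_zero]
  have h22 : br (p := 1) (q := 1) (n := 2) rfl (polyMul Q c) (polyMul Q c) = 0 := by
    rw [br_polyMul, S.br_c_c, map_zero]
  have hEP : ∑ n ∈ Finset.range (N + 2), polyMul (P * Polynomial.X ^ (n + 1)) (μ n) = E - E' := by
    rw [hE, hE', ← Finset.sum_sub_distrib]
    refine Finset.sum_congr rfl fun n _ => ?_
    rw [hP, sub_mul, one_mul, map_sub, LinearMap.sub_apply]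
  have h1s : br (p := 1) (q := 1) (n := 2) rfl (polyMul P ℓ) s = (-2 : ℝ) • (E - E') := by
    rw [← brLin_apply, hs, map_sum, ← hEP, Finset.smul_sum]
    refine Finset.sum_congr rfl fun n _ => ?_
    rw [brLin_apply, br_polyMul, S.br_l_M, map_smul]
  -- Since t - t² = (1 - t)t, the index shift in [c, M_n] = μ_{n+1} is absorbed by the extra factor
  -- t, except for the missing initial term.
  have h2s : br (p := 1) (q := 1) (n := 2) rfl (polyMul Q c) s = E - E' - polyMul Q (μ 0) := by
    rw [← brLin_apply, hs, map_sum, ← hEP, show Q = P * Polynomial.X by rw [hP, hQ]; ring,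
      ← S.sum_polyMul_mu_succ]
    refine Finset.sum_congr rfl fun n _ => ?_
    rw [brLin_apply, br_polyMul, S.br_c_M, mul_assoc, ← pow_succ']
  have hss : br (p := 1) (q := 1) (n := 2) rfl s s = 0 := by
    rw [← brLin_apply, hs, map_sum]
    refine Finset.sum_eq_zero fun n _ => ?_
    rw [brLin_apply, br_comm, ← brLin_apply, map_sum]
    refine Finset.sum_eq_zero fun m _ => ?_
    rw [brLin_apply, br_polyMul, S.br_M_M, map_zero]
  simp only [br_add_left, br_add_right, h11, h12, h22, h1s, h2s, hss,
    br_comm _ (polyMul Q c) (polyMul P ℓ), br_comm _ s (polyMul P ℓ), br_comm _ s (polyMul Q c),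
    map_sub (polyMul Q)]
  module

lemma br_polyDt_polyPart : br (p := 1) (q := 1) (n := 2) rfl (polyDt (zero_add 1) 1 ξ)
    (polyMul (1 - Polynomial.X) ℓ + polyMul (Polynomial.X - Polynomial.X ^ 2) c +
      ∑ n ∈ Finset.range (N + 2), polyMul (Polynomial.X ^ (n + 1)) (M n)) =
    (2 : ℝ) • polyDt (m := 2) rfl (1 - Polynomial.X) c + ∑ n ∈ Finset.range (N + 2),
      polyDt (m := 2) rfl (Polynomial.X ^ (n + 1)) (((n : ℝ) + 2) • M (n + 1)) := by
  rw [← brLin_apply, map_add, map_add, map_sum]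
  simp only [brLin_apply, br_polyDt_polyMul (zero_add 1), one_mul, S.br_xi_l, S.br_xi_c, S.br_xi_M,
    map_zero, add_zero, map_smul]

/-- The element `e^{tξ} ⋆ ℓ` is a Maurer–Cartan element. -/
lemma isMaurerCartan_smulT : IsMaurerCartan
    (polyMul 1 ℓ + ∑ n ∈ Finset.range (N + 2), polyMul (Polynomial.X ^ (n + 1)) (gaugeTerm ξ ℓ n) +
      polyDt (zero_add 1) 1 ξ) := by
  rw [S.sum_polyMul_gaugeTerm, IsMaurerCartan]
  have h1 := S.d_polyPart
  have h2 := S.br_polyPart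
  have h3 := S.br_polyDt_polyPart
  set A := polyMul (1 - Polynomial.X) ℓ + polyMul (Polynomial.X - Polynomial.X ^ 2) c +
      ∑ n ∈ Finset.range (N + 2), polyMul (Polynomial.X ^ (n + 1)) (M n)
  have h4 : ∀ A : CE L h.poly 1, br (p := 1) (q := 1) (n := 2) rfl (A + polyDt (zero_add 1) 1 ξ)
      (A + polyDt (zero_add 1) 1 ξ) = br (p := 1) (q := 1) (n := 2) rfl A A +
        -- The square of the dt-part vanishes and the bracket is symmetric in degree 1. After
        -- multiplication by ½, the dt-coefficient of the Maurer–Cartan equation is the flow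
        -- equation A' = [ξ, A] - dξ.
        (2 : ℝ) • br (p := 1) (q := 1) (n := 2) rfl (polyDt (zero_add 1) 1 ξ) A := fun A => by
    rw [br_add_left, br_add_right, br_add_right, br_polyDt_polyDt, br_comm _ A (polyDt _ _ _)]
    module
  rw [h4, h2, h3, ← dLin_apply, map_add, dLin_apply, dLin_apply, h1, d_polyDt (zero_add 1), S.d_xi]
  simp only [map_sub, map_add, map_smul, LinearMap.sub_apply, LinearMap.smul_apply]
  module

/-- The element `e^{tξ} ⋆ ℓ` is a homotopy from `ℓ` to `∑ₙ Mₙ`. -/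
lemma isHomotopy_smulT : IsHomotopy
    (polyMul 1 ℓ + ∑ n ∈ Finset.range (N + 2), polyMul (Polynomial.X ^ (n + 1)) (gaugeTerm ξ ℓ n) +
      polyDt (zero_add 1) 1 ξ) ℓ (∑ n ∈ Finset.range (N + 2), M n) := by
  refine ⟨(isMaurerCartan_iff_isLInftyMorphism _).1 S.isMaurerCartan_smulT, ?_, ?_⟩ <;>
  -- Evaluation kills dt. At t = 0 only ℓ survives; at t = 1 the coefficients of ℓ and c vanish and
  -- all powers of t equal 1.
  rw [S.sum_polyMul_gaugeTerm, comp_add, comp_add, comp_add, comp_sum, comp_polyEv_polyDt] <;>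
  simp only [comp_polyEv_polyMul] <;>
  simp

end IsContractionSystem

end CE

/-! ### Contractions of a closed form with Hamiltonian vector fields -/

section HamiltonianContractions

open Forms

variable {A L : Type u} [CommRing A] [LieRing L] [Module A L] [LieRingModule L A]
  [LieRinehartRing A L] [Algebra ℝ A] [LieAlgebra ℝ L] [LieRinehartAlgebra ℝ A L]
  {r : ℕ} (σ : DForm A L (r + 1)) (hσ : DForm.extd σ = 0)

/-- As σ is closed, L_x σ = dι_x σ, and the differential of an exact form vanishes. -/
lemma lie_hamiltonian (x : hamiltonian σ hσ) : lie x.1 σ.toForms = 0 := by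
  obtain ⟨w, hw⟩ := x.2
  have h := cartan x.1 σ.toForms
  rwa [d_toForms hσ, map_zero, add_zero, ← hw, d_d, eq_comm] at h

/-- The alternating map `x₀, …, x_k ↦ -ι_{x₀} ⋯ ι_{x_k} σ` on Hamiltonian vector fields. -/
def hamContr (k : ℕ) : hamiltonian σ hσ [⋀^Fin (k + 1)]→ₗ[ℝ] Forms A L :=
  (LinearMap.applyₗ (-σ.toForms)).compAlternatingMap
    ((multiContr A L (k + 1)).compLinearMap (hamiltonian σ hσ).toSubmodule.subtype)

lemma hamContr_zero (x : Fin 1 → hamiltonian σ hσ) :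
    hamContr σ hσ 0 x = -ι (x 0).1 σ.toForms := by
  change multiContr A L 1 (fun i => (x i).1) (-σ.toForms) = _
  rw [multiContr_succ, multiContr_zero, map_neg]

lemma hamContr_cons {k : ℕ} (x : hamiltonian σ hσ) (y : Fin (k + 1) → hamiltonian σ hσ) :
    hamContr σ hσ (k + 1) (Fin.cons x y) = ι x.1 (hamContr σ hσ k y) := by
  change multiContr A L (k + 2) (fun i => ((Fin.cons x y : Fin (k + 2) → hamiltonian σ hσ) i).1)
    (-σ.toForms) = _
  rw [multiContr_succ]
  rfl

/-- Commuting L_x past each contraction with [L_x, ι_y] = ι_{[x,y]} leaves one bracket term per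
argument, and L_x σ = 0 at the end. -/
lemma lie_hamContr (k : ℕ) (x : hamiltonian σ hσ) (y : Fin (k + 1) → hamiltonian σ hσ) :
    lie x.1 (hamContr σ hσ k y) = ∑ j, hamContr σ hσ k (Function.update y j ⁅x, y j⁆) := by
  induction k with
  | zero =>
    have h := lie_ι x.1 (y 0).1 σ.toForms
    rw [lie_hamiltonian, map_zero, sub_zero] at h
    rw [Fin.sum_univ_one, hamContr_zero, hamContr_zero, map_neg, h, Function.update_self]
    rfl
  | succ k ih =>
    obtain ⟨z, w, rfl⟩ : ∃ z w, y = Fin.cons z w := ⟨y 0, Fin.tail y, (Fin.cons_self_tail y).symm⟩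
    have h := lie_ι x.1 z.1 (hamContr σ hσ k w)
    rw [sub_eq_iff_eq_add] at h
    rw [Fin.sum_univ_succ, hamContr_cons, h, ih, map_sum]
    simp only [Fin.cons_zero, Fin.cons_succ, Fin.update_cons_zero, ← Fin.cons_update,
      hamContr_cons]
    rfl

lemma d_hamContr_zero (x : Fin 1 → hamiltonian σ hσ) : d (hamContr σ hσ 0 x) = 0 := by
  have h := cartan (x 0).1 σ.toForms
  rw [d_toForms hσ, map_zero, add_zero, lie_hamiltonian] at h
  rw [hamContr_zero, map_neg, h, neg_zero]

lemma d_hamContr_cons {k : ℕ} (x : hamiltonian σ hσ) (y : Fin (k + 1) → hamiltonian σ hσ) :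
    d (hamContr σ hσ (k + 1) (Fin.cons x y)) =
      ∑ j, hamContr σ hσ k (Function.update y j ⁅x, y j⁆) - ι x.1 (d (hamContr σ hσ k y)) := by
  rw [hamContr_cons, ← lie_hamContr, ← cartan, add_sub_cancel_right]

/-- The iterated Cartan formula for dι_{x₀} ⋯ ι_{x_{k+1}} σ; of its terms only those with a bracket
[x_i, x_j] remain, as dσ and all L_{x_i} σ vanish. `d_hamContr_cons` supplies the recursion required
by `eq_compBracket_of_recursion`. -/
lemma d_hamContr_succ (k : ℕ) :
    d.compAlternatingMap (hamContr σ hσ (k + 1)) = compBracket (hamContr σ hσ k) := by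
  induction k with
  | zero =>
    ext1 x
    rw [compBracket_arity_one, ← Fin.cons_self_tail x, LinearMap.compAlternatingMap_apply,
      d_hamContr_cons, d_hamContr_zero, map_zero, sub_zero, Fin.sum_univ_one]
    congr 1
    ext i
    fin_cases i
    rfl
  | succ k ih =>
    refine eq_compBracket_of_recursion (hamContr σ hσ k) (hamContr σ hσ (k + 1)) _
      (fun x => ι x.1) (fun x y => hamContr_cons σ hσ x y) fun x y => ?_
    rw [LinearMap.compAlternatingMap_apply, d_hamContr_cons, ← ih]
    rfl

end HamiltonianContractions

/-! ### The elements `L`, `ι` and `ι_∞σ` -/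

section GaugeEquivalence

open Forms CE

variable {A L : Type u} [CommRing A] [LieRing L] [Module A L] [LieRingModule L A]
  [LieRinehartRing A L] [Algebra ℝ A] [LieAlgebra ℝ L] [LieRinehartAlgebra ℝ A L]
  {r : ℕ} (σ : DForm A L (r + 1)) (hσ : DForm.extd σ = 0)

lemma lieComp_val (d : ℤ) (e) (x : Fin 1 → hamiltonian σ hσ) :
    (lieComp σ hσ 0 d e x).1 = (0, 0, (x 0).1) := by
  obtain rfl : d = 1 - 1 := by simpa using e
  rfl

lemma iota_val (d : ℤ) (e) (x : Fin 1 → hamiltonian σ hσ) :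
    (iota σ hσ 0 d e x).1 = (0, (x 0).1, 0) := by
  obtain rfl : d = 0 - 1 := by push_cast at e; omega
  rfl

lemma iotaInfComp_val (k : ℕ) (d : ℤ) (e) (x : Fin (k + 1) → hamiltonian σ hσ) :
    (iotaInfComp σ hσ k d e x).1 = (hamContr σ hσ k x, 0, 0) := rfl

lemma isArity_lieComp : IsArity 0 (lieComp σ hσ) := fun a ha d e => by
  rw [lieComp, CE.comp, lieEmb, isArity_ofLinear _ a ha]
  ext1 x
  exact ((gSigma σ hσ).nonnegIncl.map d).map_zero

lemma isArity_iota : IsArity 0 (iota σ hσ) := isArity_ofLinear _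

/-- The component of `ι_∞σ` of arity `k + 1`, with values in `𝔤_{r,σ}`. -/
def iotaInfPart (k : ℕ) : CE (hamiltonian σ hσ) (gSigma σ hσ) 1 := arityPart k (iotaInfComp σ hσ)

lemma isArity_iotaInfPart (k : ℕ) : IsArity k (iotaInfPart σ hσ k) := isArity_arityPart _ _

lemma iotaInfPart_val (k : ℕ) (d : ℤ) (e) (x : Fin (k + 1) → hamiltonian σ hσ) :
    (iotaInfPart σ hσ k k d e x).1 = (hamContr σ hσ k x, 0, 0) := by
  rw [iotaInfPart, arityPart_self, iotaInfComp_val]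

/-- The element `x, y ↦ [x, y]_{[1]}`. -/
def iotaBracket : CE (hamiltonian σ hσ) (gSigma σ hσ) 1 := compBr (zero_add 1) (iota σ hσ)

lemma isArity_iotaBracket : IsArity 1 (iotaBracket σ hσ) := (isArity_iota σ hσ).compBr _

lemma iotaBracket_val (d : ℤ) (e) (x : Fin 2 → hamiltonian σ hσ) :
    (iotaBracket σ hσ 1 d e x).1 = (0, ⁅(x 0).1, (x 1).1⁆, 0) := by
  rw [iotaBracket, compBr, compBracket_arity_one, iota_val]
  rfl

/-- The element `x, y ↦ [x, y]`. -/
def lieBracketComp : CE (hamiltonian σ hσ) (gSigma σ hσ) 2 :=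
  compBr (n := 1) (m := 2) rfl (lieComp σ hσ)

lemma isArity_lieBracketComp : IsArity 1 (lieBracketComp σ hσ) := (isArity_lieComp σ hσ).compBr _

lemma lieBracketComp_val (d : ℤ) (e) (x : Fin 2 → hamiltonian σ hσ) :
    (lieBracketComp σ hσ 1 d e x).1 = (0, 0, ⁅(x 0).1, (x 1).1⁆) := by
  rw [lieBracketComp, compBr, compBracket_arity_one, lieComp_val]
  rfl

/-- The composition of the component of `ι_∞σ` of arity `k + 1` with the Lie bracket. -/
def iotaInfBracket (k : ℕ) : CE (hamiltonian σ hσ) (gSigma σ hσ) 2 :=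
  compBr (n := 1) (m := 2) rfl (iotaInfPart σ hσ k)

lemma isArity_iotaInfBracket (k : ℕ) : IsArity (k + 1) (iotaInfBracket σ hσ k) :=
  (isArity_iotaInfPart σ hσ k).compBr _

lemma iotaInfBracket_apply (k : ℕ) (d : ℤ) (e) (e') :
    iotaInfBracket σ hσ k (k + 1) d e = compBracket (iotaInfPart σ hσ k k d e') := rfl

/-- Composition with the bracket commutes with linear maps, here the inclusion of the degree-d part
into the ambient product and the inclusion of the forms. -/
lemma iotaInfBracket_val (k : ℕ) (d : ℤ) (e) (x : Fin (k + 2) → hamiltonian σ hσ) :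
    (iotaInfBracket σ hσ k (k + 1) d e x).1 = (compBracket (hamContr σ hσ k) x, 0, 0) := by
  rw [iotaInfBracket_apply σ hσ k d e (by push_cast at e; omega)]
  have h1 := compAlternatingMap_compBracket (gSigmaPart A L r d).subtype
    (iotaInfPart σ hσ k k d (by push_cast at e; omega))
  have h2 := compAlternatingMap_compBracket (LinearMap.inl ℝ (Forms A L) (L × L)) (hamContr σ hσ k)
  have h3 : (gSigmaPart A L r d).subtype.compAlternatingMap
      (iotaInfPart σ hσ k k d (by push_cast at e; omega)) =
      (LinearMap.inl ℝ (Forms A L) (L × L)).compAlternatingMap (hamContr σ hσ k) :=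
    AlternatingMap.ext fun y => iotaInfPart_val σ hσ k d _ y
  exact DFunLike.congr_fun (h1.trans ((congrArg compBracket h3).trans h2.symm)) x

lemma exists_iota_val (a : ℕ) (d : ℤ) (e) (x : Fin (a + 1) → hamiltonian σ hσ) :
    ∃ y, (iota σ hσ a d e x).1 = (0, y, 0) := by
  by_cases ha : a = 0
  · subst ha; exact ⟨_, iota_val σ hσ d e x⟩
  · rw [isArity_iota σ hσ a ha]; exact ⟨0, rfl⟩

lemma exists_iotaBracket_val (a : ℕ) (d : ℤ) (e) (x : Fin (a + 1) → hamiltonian σ hσ) :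
    ∃ y, (iotaBracket σ hσ a d e x).1 = (0, y, 0) := by
  by_cases ha : a = 1
  · subst ha; exact ⟨_, iotaBracket_val σ hσ d e x⟩
  · rw [isArity_iotaBracket σ hσ a ha]; exact ⟨0, rfl⟩

lemma exists_iotaInfPart_val (k a : ℕ) (d : ℤ) (e) (x : Fin (a + 1) → hamiltonian σ hσ) :
    ∃ w, (iotaInfPart σ hσ k a d e x).1 = (w, 0, 0) := by
  by_cases ha : a = k
  · subst ha; exact ⟨_, iotaInfPart_val σ hσ a d e x⟩
  · rw [isArity_iotaInfPart σ hσ k a ha]; exact ⟨0, rfl⟩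

lemma gSigma_br_val (i j k : ℤ) (e) (u v) :
    ((gSigma σ hσ).br i j k e u v).1 = gSigmaBr ((-1) ^ i) u.1 v.1 := rfl

lemma gSigma_d_val (i j : ℤ) (e) (v) : ((gSigma σ hσ).d i j e v).1 = gSigmaD σ.toForms v.1 := rfl

lemma gSigma_br_eq_zero_of_contr {i j k : ℤ} {e} {u : (gSigma σ hσ).V i} {v : (gSigma σ hσ).V j}
    (hu : ∃ y, u.1 = (0, y, 0)) (hv : ∃ y, v.1 = (0, y, 0)) : (gSigma σ hσ).br i j k e u v = 0 := by
  obtain ⟨y, hy⟩ := hu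
  obtain ⟨z, hz⟩ := hv
  refine Subtype.ext ?_
  rw [gSigma_br_val, hy, hz, gSigmaBr_apply]
  simp
  rfl

lemma gSigma_br_eq_zero_of_forms {i j k : ℤ} {e} {u : (gSigma σ hσ).V i} {v : (gSigma σ hσ).V j}
    (hu : ∃ w, u.1 = (w, 0, 0)) (hv : ∃ w, v.1 = (w, 0, 0)) : (gSigma σ hσ).br i j k e u v = 0 := by
  obtain ⟨y, hy⟩ := hu
  obtain ⟨z, hz⟩ := hv
  refine Subtype.ext ?_
  rw [gSigma_br_val, hy, hz, gSigmaBr_apply]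
  simp
  rfl

/-! #### Brackets -/

lemma cons_block_one {W : Type*} {k : ℕ} (h : 0 + 1 + (k + 1) = k + 1 + 1) (x : Fin (k + 2) → W) :
    (Fin.cons (x (blockL h 0)) (fun j => x (blockR h j)) : Fin (k + 2) → W) = x := by
  ext i
  cases i using Fin.cases with
  | zero => rfl
  | succ i =>
    rw [Fin.cons_succ]
    congr 1
    ext
    simp [blockR, add_comm]

/-- The pairing {x_{[1]}, M_k(y)} = ι_x M_k(y) = M_{k+1}(x, y) is already alternating in all
arguments, so each of the k + 2 unshuffles contributes the same. The prefactor is -(-1)^{-1} = 1. -/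
lemma br_iota_iotaInfPart (k : ℕ) : br (zero_add 1) (iota σ hσ) (iotaInfPart σ hσ k) =
    ((k : ℝ) + 2) • iotaInfPart σ hσ (k + 1) := by
  refine IsArity.ext (k := k + 1) ?_ ((isArity_iotaInfPart σ hσ (k + 1)).smul _) fun d e => ?_
  · simpa using (isArity_iota σ hσ).br (isArity_iotaInfPart σ hσ k) (zero_add 1)
  rw [(isArity_iota σ hσ).br_apply (iotaInfPart σ hσ k) (zero_add 1) (j := k) (di := -1)
    (dj := d + 1) e (by simp) (by push_cast at e; omega) (by omega) (by omega), brTerm,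
    unshuffleSum_of_alternating _ _ (iotaInfPart σ hσ (k + 1) (k + 1) d e)]
  · rw [smul_apply']
    norm_num
    congr 1
    ring
  · intro x
    refine Subtype.ext ?_
    rw [pairAlt_apply, gSigma_br_val, iota_val, iotaInfPart_val, iotaInfPart_val, gSigmaBr_apply]
    conv_rhs => rw [← cons_block_one (by omega) x, hamContr_cons]
    simp

/-- Here {x_{[1]}, y} = -[y, x]_{[1]} = [x, y]_{[1]}, which is alternating; the 2 counts the (1,
1)-unshuffles. -/
lemma br_iota_lieComp : br (zero_add 1) (iota σ hσ) (lieComp σ hσ) =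
    (2 : ℝ) • iotaBracket σ hσ := by
  refine IsArity.ext (k := 1) ((isArity_iota σ hσ).br (isArity_lieComp σ hσ) (zero_add 1))
    ((isArity_iotaBracket σ hσ).smul _) fun d e => ?_
  rw [(isArity_iota σ hσ).br_apply (lieComp σ hσ) (zero_add 1) (j := 0) (di := -1)
    (dj := d + 1) e (by simp) (by push_cast at e; omega) (by omega) (by omega), brTerm,
    unshuffleSum_of_alternating _ _ (iotaBracket σ hσ 1 d e)]
  · rw [smul_apply']
    norm_num
  · intro x
    refine Subtype.ext ?_
    rw [pairAlt_apply, gSigma_br_val, iota_val, lieComp_val, iotaBracket_val, gSigmaBr_apply]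
    simp
    rfl

lemma br_lieComp_lieComp : br (p := 1) (q := 1) (n := 2) rfl (lieComp σ hσ) (lieComp σ hσ) =
    (-2 : ℝ) • lieBracketComp σ hσ := by
  refine IsArity.ext (k := 1) ((isArity_lieComp σ hσ).br (isArity_lieComp σ hσ) rfl)
    ((isArity_lieBracketComp σ hσ).smul _) fun d e => ?_
  rw [(isArity_lieComp σ hσ).br_apply (lieComp σ hσ) rfl (j := 0) (di := 0)
    (dj := d) e (by simp) (by push_cast at e; omega) (by omega) (by omega), brTerm,
    unshuffleSum_of_alternating _ _ (lieBracketComp σ hσ 1 d e)]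
  · rw [smul_apply']
    norm_num
  · intro x
    refine Subtype.ext ?_
    rw [pairAlt_apply, gSigma_br_val, lieComp_val, lieComp_val, lieBracketComp_val, gSigmaBr_apply]
    simp
    rfl

/-- L_x acts on M_k(y) as a derivation in the arguments y, so `unshuffleSum_derivation` gives the
factor 2; the prefactor is -(-1)^0 = -1. -/
lemma br_lieComp_iotaInfPart (k : ℕ) :
    br (p := 1) (q := 1) (n := 2) rfl (lieComp σ hσ) (iotaInfPart σ hσ k) =
      (-2 : ℝ) • iotaInfBracket σ hσ k := by
  refine IsArity.ext (k := k + 1) ?_ ((isArity_iotaInfBracket σ hσ k).smul _) fun d e => ?_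
  · simpa using (isArity_lieComp σ hσ).br (isArity_iotaInfPart σ hσ k) rfl
  rw [(isArity_lieComp σ hσ).br_apply (iotaInfPart σ hσ k) rfl (j := k) (di := 0)
    (dj := d) e (by simp) (by push_cast at e; omega) (by omega) (by omega), brTerm,
    unshuffleSum_derivation _ (iotaInfPart σ hσ k k d (by push_cast at e; omega))]
  · rw [smul_apply', iotaInfBracket_apply σ hσ k d e (by push_cast at e; omega)]
    norm_num
  · intro x y
    refine Subtype.ext ?_
    rw [pairAlt_apply, gSigma_br_val, lieComp_val, iotaInfPart_val, gSigmaBr_apply,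
      lie_hamContr]
    -- The sum over j is transported to the ambient product, where the values of `iotaInfPart` are
    -- known.
    refine Eq.trans ?_ ((map_sum (LinearMap.inl ℝ (Forms A L) (L × L))
      (fun j => hamContr σ hσ k (Function.update y j ⁅x 0, y j⁆)) Finset.univ).trans
      ((Finset.sum_congr rfl fun j _ => (iotaInfPart_val σ hσ k d _ _).symm).trans
        (map_sum (gSigmaPart A L r d).subtype _ _).symm))
    rw [LinearMap.inl_apply]
    simp

/-- As ι_{[x,y]} M_k = M_{k+1}([x, y], …), this unshuffle sum is term by term the one defining
M_{k+1} ◁ [·,·]. -/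
lemma br_iotaBracket_iotaInfPart (k : ℕ) :
    br (p := 1) (q := 1) (n := 2) rfl (iotaBracket σ hσ) (iotaInfPart σ hσ k) =
      iotaInfBracket σ hσ (k + 1) := by
  refine IsArity.ext (k := k + 1 + 1) ?_ (isArity_iotaInfBracket σ hσ (k + 1)) fun d e => ?_
  · simpa [add_comm, add_left_comm, add_assoc] using
      (isArity_iotaBracket σ hσ).br (isArity_iotaInfPart σ hσ k) rfl
  rw [(isArity_iotaBracket σ hσ).br_apply (iotaInfPart σ hσ k) rfl (j := k) (di := -1)
    (dj := d + 1) e (by simp) (by push_cast at e; omega) (by omega) (by omega), brTerm,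
    iotaInfBracket_apply σ hσ (k + 1) d e (by push_cast at e; push_cast; omega), compBracket]
  norm_num
  congr 1
  ext1 x
  ext1 y
  refine Subtype.ext ?_
  rw [pairAlt_apply, gSigma_br_val, iotaBracket_val, iotaInfPart_val, gSigmaBr_apply]
  refine Eq.trans ?_ (iotaInfPart_val σ hσ (k + 1) d _ (Fin.cons ⁅x 0, x 1⁆ y)).symm
  rw [hamContr_cons]
  simp

/-- The cyclic sum of {x, [y, z]_{[1]}} = [x, [y, z]]_{[1]} vanishes by the Jacobi identity. -/
lemma br_lieComp_iotaBracket :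
    br (p := 1) (q := 1) (n := 2) rfl (lieComp σ hσ) (iotaBracket σ hσ) = 0 := by
  refine IsArity.ext (k := 2) ((isArity_lieComp σ hσ).br (isArity_iotaBracket σ hσ) rfl)
    (fun _ _ _ _ => rfl) fun d e => ?_
  rw [(isArity_lieComp σ hσ).br_apply (iotaBracket σ hσ) rfl (j := 1) (di := 0)
    (dj := d) e (by simp) (by push_cast at e; omega) (by omega) (by omega), brTerm,
    unshuffleSum_eq_smul_alternatization, alternatization_eq_zero_of_cyclic, smul_zero, smul_zero]
  · rfl
  · intro x y z
    refine Subtype.ext ?_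
    change (_ : Forms A L × L × L) + _ + _ = 0
    simp only [blockMultilinear_apply, pairAlt_apply]
    rw [gSigma_br_val, gSigma_br_val, gSigma_br_val]
    simp only [lieComp_val, iotaBracket_val, gSigmaBr_apply]
    refine Prod.ext ?_ (Prod.ext ?_ ?_)
    · simp
    · refine Eq.trans ?_ (lie_jacobi x.1 y.1 z.1)
      simp only [zero_lie, lie_zero, sub_zero, Prod.snd_add, Prod.fst_add]
      rfl
    · simp

/-- Composing with the bracket twice gives the alternatization of [[x, y], z]_{[1]}, again zero by
Jacobi. -/
lemma compBr_iotaBracket : compBr (n := 1) (m := 2) rfl (iotaBracket σ hσ) = 0 := by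
  refine IsArity.ext (k := 2) ((isArity_iotaBracket σ hσ).compBr rfl)
    (fun _ _ _ _ => rfl) fun d e => ?_
  rw [compBr, compBracket_eq, alternatization_eq_zero_of_cyclic, smul_zero]
  · rfl
  · intro x y z
    refine Subtype.ext ?_
    have e' : ((1 : ℕ) : ℤ) + 1 + d = 1 := by push_cast at e ⊢; omega
    have key : ∀ x y z : hamiltonian σ hσ, (bracketMultilinear
        (iotaBracket σ hσ 1 d e') ![x, y, z]).1 =
          ((0, ⁅⁅x.1, y.1⁆, z.1⁆, 0) : Forms A L × L × L) := fun x y z => by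
      have h := bracketMultilinear_cons (iotaBracket σ hσ 1 d e') x y ![z]
      exact (congrArg (gSigmaPart A L r d).subtype h).trans
        (iotaBracket_val σ hσ d e' (Fin.cons ⁅x, y⁆ ![z]))
    refine (congrArg₂ (· + ·) (congrArg₂ (· + ·) (key x y z) (key y z x)) (key z x y)).trans ?_
    refine Prod.ext ?_ (Prod.ext ?_ ?_)
    · simp only [Prod.fst_add, add_zero]
      rfl
    · refine Eq.trans ?_ ((congrArg Neg.neg (lie_jacobi z.1 x.1 y.1)).trans neg_zero)
      simp only [Prod.snd_add, Prod.fst_add, neg_add, lie_skew]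
    · simp only [Prod.snd_add, add_zero]
      rfl

/-! #### Differentials -/

lemma dComp_lieComp : dComp (n := 1) (m := 2) rfl (lieComp σ hσ) = 0 := by
  refine IsArity.ext (k := 0) ((isArity_lieComp σ hσ).dComp rfl) (fun _ _ _ _ => rfl) fun d e => ?_
  ext1 x
  refine Subtype.ext ?_
  rw [dComp, LinearMap.compAlternatingMap_apply, gSigma_d_val, lieComp_val, gSigmaD_apply,
    lie_hamiltonian]
  simp
  rfl

/-- The minus sign reflects d x_{[1]} = x + ι_x σ together with M_0(x) = -ι_x σ. -/
lemma dComp_iota : dComp (zero_add 1) (iota σ hσ) = lieComp σ hσ - iotaInfPart σ hσ 0 := by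
  refine IsArity.ext (k := 0) ((isArity_iota σ hσ).dComp _) (fun a ha d e => ?_) fun d e => ?_
  · rw [sub_apply', isArity_lieComp σ hσ a ha, isArity_iotaInfPart σ hσ 0 a ha, sub_zero]
  ext1 x
  refine Subtype.ext ?_
  rw [dComp, LinearMap.compAlternatingMap_apply, gSigma_d_val, iota_val, gSigmaD_apply, sub_apply']
  refine Eq.trans ?_ (congrArg₂ (· - ·) (lieComp_val σ hσ d e x) (iotaInfPart_val σ hσ 0 d e x)).symm
  rw [hamContr_zero]
  simp

lemma dComp_iotaBracket : dComp (n := 1) (m := 2) rfl (iotaBracket σ hσ) =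
    lieBracketComp σ hσ - iotaInfBracket σ hσ 0 := by
  refine IsArity.ext (k := 1) ((isArity_iotaBracket σ hσ).dComp _) (fun a ha d e => ?_)
    fun d e => ?_
  · rw [sub_apply', isArity_lieBracketComp σ hσ a ha, isArity_iotaInfBracket σ hσ 0 a ha, sub_zero]
  ext1 x
  refine Subtype.ext ?_
  rw [dComp, LinearMap.compAlternatingMap_apply, gSigma_d_val, iotaBracket_val, gSigmaD_apply,
    sub_apply']
  refine Eq.trans ?_ (congrArg₂ (· - ·) (lieBracketComp_val σ hσ d e x)
    (iotaInfBracket_val σ hσ 0 d e x)).symm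
  rw [compBracket_arity_one, hamContr_zero]
  simp

lemma dComp_iotaInfPart_zero : dComp (n := 1) (m := 2) rfl (iotaInfPart σ hσ 0) = 0 := by
  refine IsArity.ext (k := 0) ((isArity_iotaInfPart σ hσ 0).dComp rfl) (fun _ _ _ _ => rfl)
    fun d e => ?_
  ext1 x
  refine Subtype.ext ?_
  rw [dComp, LinearMap.compAlternatingMap_apply, gSigma_d_val, iotaInfPart_val, gSigmaD_apply,
    d_hamContr_zero]
  simp
  rfl

lemma dComp_iotaInfPart_succ (k : ℕ) : dComp (n := 1) (m := 2) rfl (iotaInfPart σ hσ (k + 1)) =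
    iotaInfBracket σ hσ k := by
  refine IsArity.ext (k := k + 1) ((isArity_iotaInfPart σ hσ (k + 1)).dComp rfl)
    (isArity_iotaInfBracket σ hσ k) fun d e => ?_
  ext1 x
  refine Subtype.ext ?_
  rw [dComp, LinearMap.compAlternatingMap_apply, gSigma_d_val, iotaInfPart_val, gSigmaD_apply,
    iotaInfBracket_val, ← d_hamContr_succ]
  simp

/-- In arity k + 1 the values are forms of degree r - k, which is negative for k > r. -/
lemma iotaInfPart_eq_zero (k : ℕ) (hk : r + 1 ≤ k) : iotaInfPart σ hσ k = 0 := by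
  refine IsArity.ext (k := k) (isArity_iotaInfPart σ hσ k) (fun _ _ _ _ => rfl) fun d e => ?_
  ext1 x
  refine Subtype.ext ?_
  have h := (iotaInfPart σ hσ k k d e x).2.1
  rw [iotaInfPart_val] at h ⊢
  have h0 : hamContr σ hσ k x = 0 := funext fun j => h j (by omega)
  rw [h0]
  rfl

/-- The upper limit is N + 2 with N = r + 1; the components beyond r vanish, so the excess is
harmless. -/
lemma sum_iotaInfPart : ∑ k ∈ Finset.range (r + 1 + 2), iotaInfPart σ hσ k = iotaInfComp σ hσ := by
  ext1 a d e
  rw [sum_apply']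
  by_cases ha : a < r + 1 + 2
  · rw [Finset.sum_eq_single_of_mem a (Finset.mem_range.2 ha) fun k _ hk =>
      isArity_iotaInfPart σ hσ k a hk.symm d e, iotaInfPart, arityPart_self]
  · rw [Finset.sum_eq_zero fun k hk => isArity_iotaInfPart σ hσ k a
      (fun h => ha (h ▸ Finset.mem_range.1 hk)) d e, ← arityPart_self a (iotaInfComp σ hσ)]
    exact (congrFun (congrFun (congrFun (iotaInfPart_eq_zero σ hσ a (by omega)) a) d) e).symm

lemma isContractionSystem : IsContractionSystem (iota σ hσ) (lieComp σ hσ) (iotaBracket σ hσ)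
    (iotaInfPart σ hσ) (lieBracketComp σ hσ) (iotaInfBracket σ hσ) (r + 1) where
  d_xi := by
    rw [d_eq, dComp_iota, iotaBracket]
    norm_num
    abel
  br_xi_l := br_iota_lieComp σ hσ
  br_xi_c := br_eq_zero _ fun _ _ _ _ _ _ _ _ _ _ => gSigma_br_eq_zero_of_contr σ hσ
    (exists_iota_val σ hσ _ _ _ _) (exists_iotaBracket_val σ hσ _ _ _ _)
  br_xi_M := br_iota_iotaInfPart σ hσ
  br_xi_xi := fun _ _ _ _ _ _ _ _ _ _ => gSigma_br_eq_zero_of_contr σ hσ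
    (exists_iota_val σ hσ _ _ _ _) (exists_iota_val σ hσ _ _ _ _)
  M_eq_zero := iotaInfPart_eq_zero σ hσ
  mu_eq_zero k hk := by
    rw [iotaInfBracket, iotaInfPart_eq_zero σ hσ k hk]
    simpa using compBr_smul (n := 1) (m := 2) rfl (0 : ℝ)
      (0 : CE (hamiltonian σ hσ) (gSigma σ hσ) 1)
  d_l := by
    rw [d_eq, dComp_lieComp, smul_zero, sub_zero, lieBracketComp]
  d_c := by
    rw [d_eq, dComp_iotaBracket, compBr_iotaBracket, sub_self, zpow_zero, one_smul]
    abel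
  d_M_zero := by
    rw [d_eq, dComp_iotaInfPart_zero, smul_zero, sub_zero, iotaInfBracket]
  d_M_succ k := by
    rw [d_eq, dComp_iotaInfPart_succ, sub_self, zpow_zero, one_smul]
    rfl
  br_l_l := br_lieComp_lieComp σ hσ
  br_l_c := br_lieComp_iotaBracket σ hσ
  br_l_M := br_lieComp_iotaInfPart σ hσ
  br_c_c := br_eq_zero _ fun _ _ _ _ _ _ _ _ _ _ => gSigma_br_eq_zero_of_contr σ hσ
    (exists_iotaBracket_val σ hσ _ _ _ _) (exists_iotaBracket_val σ hσ _ _ _ _)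
  br_c_M := br_iotaBracket_iotaInfPart σ hσ
  br_M_M k l := br_eq_zero _ fun _ _ _ _ _ _ _ _ _ _ => gSigma_br_eq_zero_of_forms σ hσ
    (exists_iotaInfPart_val σ hσ _ _ _ _ _) (exists_iotaInfPart_val σ hσ _ _ _ _ _)

theorem iotaInf_gauge_equivalence :
    CE.IsLInftyMorphism (lieEmb σ hσ) ∧
    CE.IsLInftyMorphism (iotaInf σ hσ) ∧
    CE.IsMaurerCartan (lieComp σ hσ) ∧
    CE.IsMaurerCartan (iotaInfComp σ hσ) ∧
    CE.IsGaugeTransform (iota σ hσ) (lieComp σ hσ) (iotaInfComp σ hσ) ∧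
    ∃ H : CE (hamiltonian σ hσ) (gSigma σ hσ).poly 1,
      CE.IsGaugeTransform (CE.smulT (iota σ hσ))
        (CE.comp (gSigma σ hσ).polyConst (lieComp σ hσ)) H ∧
      CE.IsMaurerCartan H ∧
      CE.IsHomotopy H (lieComp σ hσ) (iotaInfComp σ hσ) := by
  have S := isContractionSystem σ hσ
  have hg := S.isGaugeTransform
  have hH := S.isHomotopy_smulT
  rw [sum_iotaInfPart] at hg hH
  -- Evaluation at an endpoint is a strict morphism of DGLAs, so it carries the Maurer–Cartan
  -- element H to Maurer–Cartan elements.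
  have h0 : IsMaurerCartan (lieComp σ hσ) := by
    rw [← hH.2.1]
    exact S.isMaurerCartan_smulT.comp _
  have h1 : IsMaurerCartan (iotaInfComp σ hσ) := by
    rw [← hH.2.2]
    exact S.isMaurerCartan_smulT.comp _
  exact ⟨(isMaurerCartan_iff_isLInftyMorphism _).1
      (isMaurerCartan_of_comp _ (fun _ => Subtype.val_injective) h0),
    (isMaurerCartan_iff_isLInftyMorphism _).1 (isMaurerCartan_of_comp _
      -- An element of the truncated complex is determined by the form component of its image.
      (fun _ _ _ h => Subtype.ext (congrArg (fun v => v.1.1) h)) h1),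
    h0, h1, hg, _, S.isGaugeTransform_smulT, S.isMaurerCartan_smulT, hH⟩

end GaugeEquivalence

end

theorem mainTheorem5 (n : ℕ) (M : Type u) [TopologicalSpace M] [T2Space M] [SigmaCompactSpace M]
    [ChartedSpace (EuclideanSpace ℝ (Fin n)) M] [IsManifold (𝓡 n) ∞ M]
    (r : ℕ) (σ : DForm (SmoothFun n M) (SmoothVF n M) (r + 1)) (hσ : DForm.extd σ = 0) :
    CE.IsLInftyMorphism (lieEmb σ hσ) ∧
    CE.IsLInftyMorphism (iotaInf σ hσ) ∧
    CE.IsMaurerCartan (lieComp σ hσ) ∧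
    CE.IsMaurerCartan (iotaInfComp σ hσ) ∧
    CE.IsGaugeTransform (iota σ hσ) (lieComp σ hσ) (iotaInfComp σ hσ) ∧
    ∃ H : CE (hamiltonian σ hσ) (gSigma σ hσ).poly 1,
      CE.IsGaugeTransform (CE.smulT (iota σ hσ))
        (CE.comp (gSigma σ hσ).polyConst (lieComp σ hσ)) H ∧
      CE.IsMaurerCartan H ∧
      CE.IsHomotopy H (lieComp σ hσ) (iotaInfComp σ hσ) := by
  exact iotaInf_gauge_equivalence σ hσ
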